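/- Let $W=\{w_1,\dots,w_J\}$ be the finite vertex set of a network. For each $w\in W$ let $\psi(w,\cdot)$ be a probability density on $(0,\infty)$ (waiting times), with survival function $\phi(w,t)=1-\int_0^t\psi(w,r)\,dr$. Let $\lambda(w_j,w_i)\ge 0$ with $\sum_j\lambda(w_j,w_i)=1$ be the probability that a jump from $w_i$ leads to $w_j$. Let $\beta(w,t)\ge 0$ (death rate) and $\eta(w,t)\ge 0$ (creation density) be locally integrable in $t\in[0,\infty)$. A particle created on $w_0$ at time $t_0\ge 0$ performs a continuous time random walk: on arriving at a vertex $w_i$ it waits a time with density $\psi(w_i,\cdot)$ and then jumps to $w_j$ with probability $\lambda(w_j,w_i)$, where the waiting time and the jump are independent of each other and of the past. While it is on $w$ at time $t$ it dies at rate $\beta(w,t)$; that is, given its trajectory, it is alive at time $t$ with probability $e^{-\int\beta}$, the integral being taken along the trajectory from $t_0$ to $t$. Let $\rho(w,t\,|\,w_0,t_0)$ be the probability that it is alive and on $w$ at time $t$, and let $$u(w,t)=\sum_{w_0\in W}\int_0^t\rho(w,t\,|\,w_0,t_0)\,\eta(w_0,t_0)\,dt_0$$ be the density of particles on $w$ at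 time $t$. For a function $f$ write $\mathcal L\{f\}(s)=\int_0^\infty e^{-st}f(t)\,dt$ for $\operatorname{Re}s>0$. Then the following hold. 1. For each $w$ there is exactly one tempered distribution $K(w,\cdot)$ on $\mathbb R$, supported in $[0,\infty)$, whose Laplace transform is $\mathcal L\{\psi(w,\cdot)\}(s)/\mathcal L\{\phi(w,\cdot)\}(s)$ for all $\operatorname{Re}s>0$ (the memory kernel $K=\mathcal L^{-1}\{\bar\psi/\bar\phi\}$; for $\psi(w,t)=\alpha e^{-\alpha t}$ it is $\alpha\,\delta(t)$). 2. For each $w$ there is a locally integrable function $$I(w,t)=\int_0^t K(w,t-t')\,e^{-\int_{t'}^t\beta(w,t'')\,dt''}\,u(w,t')\,dt'$$ on $[0,\infty)$, in the sense that the function $t\mapsto e^{\int_0^t\beta(w,s)\,ds}I(w,t)$ is the convolution of the distribution $K(w,\cdot)$ with the function $t\mapsto e^{\int_0^t\beta(w,s)\,ds}u(w,t)$, $t\ge0$. 3. For each $w_j$ the function $u(w_j,\cdot)$ is absolutely continuous on every $[0,T]$, and for almost every $t>0$ it is differentiable at $t$ and satisfies the generalized master equation $$\frac{du(w_j,t)}{dt}=\sum_{i=1}^J\lambda(w_j,w_i)I(w_i,t)-I(w_j,t)-\beta(w_j,t)u(w_j,t)+\eta(w_j,t),$$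 that is, $$\frac{du(w_j,t)}{dt}=\int_0^t\Bigl[\sum_{i=1}^J K(w_i,t-t')\lambda(w_j,w_i)e^{-\int_{t'}^t\beta(w_i,t'')dt''}u(w_i,t')-K(w_j,t-t')e^{-\int_{t'}^t\beta(w_j,t'')dt''}u(w_j,t')\Bigr]dt'-\beta(w_j,t)u(w_j,t)+\eta(w_j,t).$$ In particular the transport operator $u\mapsto\sum_i\lambda(w_j,w_i)I(w_i,t)-I(w_j,t)$ depends on the death rate $\beta$ but not on the creation density $\eta$. 4. If $\beta(w,\cdot)$ and $\eta(w,\cdot)$ are continuous on $[0,\infty)$ for every $w$, then $I$ can be chosen continuous in $t$, and the equation holds for every $t\ge 0$ (with the right derivative at $t=0$). -/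

import Mathlib

open Set MeasureTheory ProbabilityTheory
open scoped SchwartzMap

noncomputable section

namespace NetworkCTRW

/-! ### Waiting times, jumps and the random walk -/

/-- `ψ` is a probability density on `(0, ∞)`. -/
structure IsWaitingDensity (ψ : ℝ → ℝ) : Prop where
  nonneg : ∀ t, 0 < t → 0 ≤ ψ t
  integrable : IntegrableOn ψ (Ioi 0)
  integral_eq_one : ∫ t in Ioi 0, ψ t = 1

/-- `lam j i` is the probability that a jump from the vertex `i` leads to the vertex `j`. -/
structure IsJumpDensity {W : Type*} [Fintype W] (lam : W → W → ℝ) : Prop where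
  nonneg : ∀ j i, 0 ≤ lam j i
  sum_eq_one : ∀ i, ∑ j, lam j i = 1

/-- The probability `φ(t) = 1 - ∫₀ᵗ ψ` of not jumping during a period of length `t`. -/
def survival (ψ : ℝ → ℝ) (t : ℝ) : ℝ := 1 - ∫ r in (0 : ℝ)..t, ψ r

/-- Under `P`, the random variables `X 0, X 1, …` (vertices visited) and `S 0, S 1, …` (waiting
times at these vertices) form a continuous time random walk started at `w₀`: a walker at the
vertex `i` waits a time with density `ψ i` and then jumps to `j` with probability `lam j i`,
independently of the waiting time and of the past.
The random variable `E` is an independent standard exponential clock. The walker dies when its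
accumulated death hazard reaches `E`. -/
structure IsCTRW {W Ω : Type*} [Fintype W] [DecidableEq W] [MeasurableSpace W]
    [MeasurableSpace Ω] (ψ : W → ℝ → ℝ) (lam : W → W → ℝ)
    (X : ℕ → Ω → W) (S : ℕ → Ω → ℝ) (E : Ω → ℝ) (w₀ : W) (P : Measure Ω) : Prop where
  measurable_vertex : ∀ n, Measurable (X n)
  measurable_wait : ∀ n, Measurable (S n)
  measurable_clock : Measurable E
  law : ∀ (n : ℕ) (x : ℕ → W) (A : ℕ → Set ℝ), (∀ k, MeasurableSet (A k)) →
    P {ω | ∀ k ≤ n, X k ω = x k ∧ S k ω ∈ A k} =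
      (if x 0 = w₀ then 1 else 0) *
        (∏ k ∈ Finset.range n, ENNReal.ofReal (lam (x (k + 1)) (x k))) *
        ∏ k ∈ Finset.range (n + 1), ∫⁻ r in A k ∩ Ioi 0, ENNReal.ofReal (ψ (x k) r)
  clock_law : P.map E = expMeasure 1
  clock_indep : IndepFun E (fun ω k => (X k ω, S k ω)) P

/-- The time of arrival after `n` steps, for a walker created at time `t₀`. -/
def arrivalTime {Ω : Type*} (S : ℕ → Ω → ℝ) (t₀ : ℝ) (n : ℕ) (ω : Ω) : ℝ :=
  t₀ + ∑ k ∈ Finset.range n, S k ω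

/-- The death rate integrated from `t₀` to `t` along the trajectory, when the walker has made
exactly `n` steps by time `t`. -/
def hazard {W Ω : Type*} (β : W → ℝ → ℝ) (X : ℕ → Ω → W) (S : ℕ → Ω → ℝ)
    (t₀ t : ℝ) (n : ℕ) (ω : Ω) : ℝ :=
  (∑ k ∈ Finset.range n,
    ∫ s in arrivalTime S t₀ k ω..arrivalTime S t₀ (k + 1) ω, β (X k ω) s) +
  ∫ s in arrivalTime S t₀ n ω..t, β (X n ω) s

/-- The event that the walker created at time `t₀` is alive and on the vertex `w` at time `t`. -/
def aliveAt {W Ω : Type*} (β : W → ℝ → ℝ) (X : ℕ → Ω → W) (S : ℕ → Ω → ℝ) (E : Ω → ℝ)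
    (t₀ : ℝ) (w : W) (t : ℝ) : Set Ω :=
  {ω | ∃ n, X n ω = w ∧ arrivalTime S t₀ n ω ≤ t ∧ t < arrivalTime S t₀ (n + 1) ω ∧
    hazard β X S t₀ t n ω < E ω}

/-- `ρ(w, t | w₀, t₀)`: the probability that a walker created on `w₀` at time `t₀` is alive and on
`w` at time `t`. Here `P w₀` is the law of the walk started at `w₀`. -/
def walkerDensity {W Ω : Type*} [MeasurableSpace Ω] (β : W → ℝ → ℝ)
    (X : ℕ → Ω → W) (S : ℕ → Ω → ℝ) (E : Ω → ℝ) (P : W → Measure Ω)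
    (w : W) (t : ℝ) (w₀ : W) (t₀ : ℝ) : ℝ :=
  (P w₀).real (aliveAt β X S E t₀ w t)

/-- The density of particles `u(w, t) = ∑_{w₀} ∫₀ᵗ ρ(w, t | w₀, t₀) η(w₀, t₀) dt₀`. -/
def particleDensity {W Ω : Type*} [Fintype W] [MeasurableSpace Ω] (β η : W → ℝ → ℝ)
    (X : ℕ → Ω → W) (S : ℕ → Ω → ℝ) (E : Ω → ℝ) (P : W → Measure Ω)
    (w : W) (t : ℝ) : ℝ :=
  ∑ w₀, ∫ t₀ in (0 : ℝ)..t, walkerDensity β X S E P w t w₀ t₀ * η w₀ t₀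

/-! ### The memory kernel -/

/-- The Laplace transform of a function on `(0, ∞)`. -/
def laplace (f : ℝ → ℝ) (s : ℂ) : ℂ := ∫ t in Ioi (0 : ℝ), Complex.exp (-s * t) * (f t : ℂ)

/-- The tempered distribution `K` is supported in `[0, ∞)` and its Laplace transform on the right
half plane is `F`. As `K` does not see a test function outside `[0, ∞)`, the transform at `s` is
the value of `K` at any Schwartz function that is equal to `e^{-s x}` for `x ≥ 0`. -/
structure HasLaplaceTransform (K : 𝓢'(ℝ, ℂ)) (F : ℂ → ℂ) : Prop where
  causal : Distribution.IsVanishingOn K (Iio (0 : ℝ))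
  transform : ∀ s : ℂ, 0 < s.re → ∀ θ : 𝓢(ℝ, ℂ),
    (∀ x : ℝ, 0 ≤ x → θ x = Complex.exp (-s * x)) → K θ = F s

/-- `K` is the inverse Laplace transform of the quotient of the Laplace transforms of the waiting
time density `ψ` and of the survival function `φ`. It is a distribution and in general not a
function: for `ψ t = α e^{-α t}` it is `α δ`. -/
def IsMemoryKernel (ψ : ℝ → ℝ) (K : 𝓢'(ℝ, ℂ)) : Prop :=
  HasLaplaceTransform K fun s => laplace ψ s / laplace (survival ψ) s

/-- The locally integrable function `g` on `[0, ∞)` is the convolution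
`g(t) = ∫₀ᵗ K(t - t') f(t') dt'` of the distribution `K`, supported in `[0, ∞)`, with the function
`f` on `[0, ∞)`. That is, for every test function `θ`,
`∫ g(t) θ(t) dt = ⟨K(x), ∫ f(t') θ(x + t') dt'⟩`.
The function `x ↦ ∫ f(t') θ(x + t') dt'` matters on `[0, ∞)` only, and `Θ` is an arbitrary
extension of it to a Schwartz function. -/
def IsCausalConvolution (K : 𝓢'(ℝ, ℂ)) (f g : ℝ → ℝ) : Prop :=
  LocallyIntegrableOn g (Ici 0) ∧
  ∀ θ : 𝓢(ℝ, ℂ), HasCompactSupport θ → ∀ Θ : 𝓢(ℝ, ℂ),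
    (∀ x : ℝ, 0 ≤ x → Θ x = ∫ t in Ioi (0 : ℝ), (f t : ℂ) * θ (x + t)) →
    K Θ = ∫ t in Ioi (0 : ℝ), (g t : ℂ) * θ t

/-- `I(t) = ∫₀ᵗ K(t - t') e^{-∫_{t'}^t β} v(t') dt'`. As `K` is a distribution, this is read as
`e^{∫₀ᵗ β} I(t) = ∫₀ᵗ K(t - t') e^{∫₀^{t'} β} v(t') dt'`. -/
def IsMemoryIntegral (K : 𝓢'(ℝ, ℂ)) (β v I : ℝ → ℝ) : Prop :=
  IsCausalConvolution K (fun t => Real.exp (∫ s in (0 : ℝ)..t, β s) * v t)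
    (fun t => Real.exp (∫ s in (0 : ℝ)..t, β s) * I t)

/-- The transport term `∑_i λ(w, w_i) I(w_i, t) - I(w, t)`, where `I(w_i, t)` is the memory
integral at `w_i`. -/
def transport {W : Type*} [Fintype W] (lam : W → W → ℝ) (I : W → ℝ → ℝ) (w : W) (t : ℝ) : ℝ :=
  (∑ i, lam w i * I i t) - I w t

end NetworkCTRW

end

noncomputable section

namespace NetworkCTRW

open Filter Topology
open scoped ENNReal

/-! ### Test functions generated by exponentials -/

/-! Write `B_w(t)` for the integral of `β(w, ·)` over `[0, t]`, `H` for the Heaviside function and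
`⋆` for causal convolution. During a stay on `w`, survival from `t'` to `t` has probability
`e^{B_w(t') - B_w(t)}`, so conjugation by `e^{B_w}` removes death from each single stay. Let `j_w`
be the density of arrivals at `w`, by creation or by a jump, and put `J_w = e^{B_w} j_w`. The
particles present have arrived and not yet left, so `e^{B_w} u_w = φ_w ⋆ J_w`; the rate `I_w` of
departures satisfies `e^{B_w} I_w = ψ_w ⋆ J_w`; and `j_w = η_w + ∑_i λ(w, i) I_i`. As `φ = H - ψ ⋆
H`, the function `e^{B_w} u_w` is a primitive of `J_w - ψ_w ⋆ J_w` (`toReal_tail_lconvolution`), and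
the product rule gives `u' = j - I - β u`, the master equation. Two facts remain: that the kernel
`K` maps `φ ⋆ J` to `ψ ⋆ J`, and that the random walk produces this `u`.

Kernel: let `M` be the renewal density, the sum of all convolution powers of `ψ`. From `M = ψ + ψ ⋆
M` follows `M ⋆ φ = ψ ⋆ H` (`renewal_lconvolution_tail`), so the distributional derivative of `M`
has Laplace transform `ψ̄ / φ̄`, and it sends `φ ⋆ J` to `(ψ ⋆ H ⋆ J)' = ψ ⋆ J`
(`renewalKernel_apply_convolution`). It is tempered because the transform of `M` is `O(1/σ)` as `σ →
0`. For uniqueness, the substitution `y = e^{-x}` turns the functions `e^{-(n+1)x}` into monomials,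
and polynomials are dense in the smooth functions on a compact interval (`eq_zero_of_apply_exp`).

Walk: the Markov property expresses the probability of being alive on `w` at time `t` after exactly
`n` jumps by `n` applications of a backward operator to the starting point
(`IsCTRW.measure_aliveAt`). The adjoint of this operator pushes a density of arrivals through one
jump; summing its iterates on `η` gives `j` (`tsum_sum_lintegral_backward_occupation`). The series
converges because, for the weight `e^{-σx}` with `σ` large, one waiting time contracts by an
arbitrarily small factor. The same contraction in a sup norm makes `j` locally bounded when `η` is
continuous, which gives the pointwise statement. -/

theorem hasDerivAt_comp_smul (g : 𝓢(ℝ, ℝ)) (a : 𝓢(ℝ, ℂ)) {f : ℝ → ℂ} (hf : ContDiff ℝ (⊤ : ℕ∞) f)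
    (x : ℝ) : HasDerivAt (fun x => f (g x) * a x)
      (f (g x) * SchwartzMap.derivCLM ℝ ℂ a x +
        deriv f (g x) * SchwartzMap.smulLeftCLM ℂ (SchwartzMap.derivCLM ℝ ℝ g) a x) x := by
  have h1 : HasDerivAt f (deriv f (g x)) (g x) :=
    ((hf.differentiable (by simp)) _).hasDerivAt
  have h2 := (h1.scomp x (g.hasDerivAt x)).mul (a.hasDerivAt x)
  convert! h2 using 1
  rw [SchwartzMap.smulLeftCLM_apply_apply (SchwartzMap.hasTemperateGrowth _)]
  simp only [SchwartzMap.derivCLM_apply, Complex.real_smul, Function.comp]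
  ring

theorem contDiff_comp_mul (g : 𝓢(ℝ, ℝ)) (a : 𝓢(ℝ, ℂ)) {f : ℝ → ℂ}
    (hf : ContDiff ℝ (⊤ : ℕ∞) f) : ContDiff ℝ (⊤ : ℕ∞) (fun x => f (g x) * a x) :=
  (hf.comp (g.smooth _)).mul (a.smooth _)

theorem contDiff_deriv {f : ℝ → ℂ} (hf : ContDiff ℝ (⊤ : ℕ∞) f) :
    ContDiff ℝ (⊤ : ℕ∞) (deriv f) :=
  (contDiff_infty_iff_deriv.mp hf).2

/-- The derivative of `f(g) a` is `f(g) a' + f'(g) g' a`, two products of the same form, so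
induction on `j` applies. The point is that `C` does not depend on `f`: convergence in `C^j` on `[0,
R]` becomes convergence of Schwartz seminorms. -/
theorem exists_decay_comp_mul (g : 𝓢(ℝ, ℝ)) {R : ℝ} (hg : ∀ x, g x ∈ Icc 0 R) (k j : ℕ) :
    ∀ a : 𝓢(ℝ, ℂ), ∃ C, 0 ≤ C ∧ ∀ f : ℝ → ℂ, ContDiff ℝ (⊤ : ℕ∞) f → ∀ ε,
      (∀ i ≤ j, ∀ y ∈ Icc 0 R, ‖iteratedDeriv i f y‖ ≤ ε) →
      ∀ x, |x| ^ k * ‖iteratedDeriv j (fun x => f (g x) * a x) x‖ ≤ C * ε := by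
  induction j with
  | zero =>
    intro a
    refine ⟨SchwartzMap.seminorm ℝ k 0 a, apply_nonneg _ _, fun f _ ε hε x => ?_⟩
    have h1 := a.le_seminorm' ℝ k 0 x
    have h2 := hε 0 le_rfl _ (hg x)
    simp only [iteratedDeriv_zero, norm_mul] at h1 h2 ⊢
    calc |x| ^ k * (‖f (g x)‖ * ‖a x‖) = (|x| ^ k * ‖a x‖) * ‖f (g x)‖ := by ring
      _ ≤ _ := mul_le_mul h1 h2 (norm_nonneg _) (apply_nonneg _ _)
  | succ j ih =>
    intro a
    obtain ⟨C₁, hC₁, h₁⟩ := ih (SchwartzMap.derivCLM ℝ ℂ a)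
    obtain ⟨C₂, hC₂, h₂⟩ := ih (SchwartzMap.smulLeftCLM ℂ (SchwartzMap.derivCLM ℝ ℝ g) a)
    refine ⟨C₁ + C₂, by positivity, fun f hf ε hε x => ?_⟩
    have e1 : deriv (fun x => f (g x) * a x) = fun x =>
        f (g x) * SchwartzMap.derivCLM ℝ ℂ a x +
        deriv f (g x) * SchwartzMap.smulLeftCLM ℂ (SchwartzMap.derivCLM ℝ ℝ g) a x :=
      funext fun x => (hasDerivAt_comp_smul g a hf x).deriv
    rw [iteratedDeriv_succ', e1, iteratedDeriv_fun_add
      ((contDiff_comp_mul g _ hf).contDiffAt.of_le (by exact_mod_cast le_top))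
      ((contDiff_comp_mul g _ (contDiff_deriv hf)).contDiffAt.of_le (by exact_mod_cast le_top))]
    have b1 := h₁ f hf ε (fun i hi => hε i (by omega)) x
    have b2 := h₂ (deriv f) (contDiff_deriv hf) ε (fun i hi y hy => by
      rw [← iteratedDeriv_succ']; exact hε (i + 1) (by omega) y hy) x
    calc _ ≤ |x| ^ k * (‖_‖ + ‖_‖) := by gcongr; exact norm_add_le _ _
      _ ≤ _ := by rw [mul_add, add_mul]; exact add_le_add b1 b2

/-- The product lives on `|x| ≥ n`, so one surplus power of `|x|` in the Schwartz bounds of `a` pays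
for the factor `1/n`. Differentiation reproduces the form, with `deriv h` in place of `h` and a
prefactor `1/n ≤ 1`. It is applied to a cutoff minus one. -/
theorem exists_decay_cutoff_mul (k j : ℕ) :
    ∀ (h : ℝ → ℂ), ContDiff ℝ (⊤ : ℕ∞) h → (∀ i, ∃ B, ∀ x, ‖iteratedDeriv i h x‖ ≤ B) →
      (∀ x, |x| < 1 → h x = 0) → ∀ a : 𝓢(ℝ, ℂ), ∃ C, 0 ≤ C ∧ ∀ n : ℕ, 1 ≤ n →
      ∀ x, |x| ^ k * ‖iteratedDeriv j (fun x => h (x / n) * a x) x‖ ≤ C / n := by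
  induction j with
  | zero =>
    intro h hh hb h0 a
    obtain ⟨B, hB⟩ := hb 0
    have hB0 : 0 ≤ B := (norm_nonneg _).trans (hB 0)
    refine ⟨B * SchwartzMap.seminorm ℝ (k + 1) 0 a, by positivity, fun n hn x => ?_⟩
    have hn' : (0 : ℝ) < n := by exact_mod_cast hn
    simp only [iteratedDeriv_zero, norm_mul] at hB ⊢
    by_cases hx : |x / n| < 1
    · rw [h0 _ hx]; simp; positivity
    · rw [not_lt, abs_div, abs_of_pos hn', one_le_div hn'] at hx
      rw [le_div_iff₀ hn']
      have h1 := a.le_seminorm' ℝ (k + 1) 0 x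
      simp only [iteratedDeriv_zero] at h1
      calc |x| ^ k * (‖h (x / n)‖ * ‖a x‖) * n ≤ |x| ^ k * (B * ‖a x‖) * |x| := by
            gcongr; exact hB _
        _ = B * (|x| ^ (k + 1) * ‖a x‖) := by ring
        _ ≤ _ := by gcongr
  | succ j ih =>
    intro h hh hb h0 a
    obtain ⟨C₁, hC₁, h₁⟩ := ih h hh hb h0 (SchwartzMap.derivCLM ℝ ℂ a)
    obtain ⟨C₂, hC₂, h₂⟩ := ih (deriv h) (contDiff_deriv hh)
      (fun i => by simpa only [← iteratedDeriv_succ'] using hb (i + 1))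
      (fun x hx => by
        have : h =ᶠ[𝓝 x] fun _ => 0 := by
          filter_upwards [(isOpen_lt continuous_abs continuous_const).mem_nhds hx] with y hy
          exact h0 y hy
        rw [this.deriv_eq]; simp) a
    refine ⟨C₁ + C₂, by positivity, fun n hn x => ?_⟩
    have hn' : (1 : ℝ) ≤ n := by exact_mod_cast hn
    have hs : ∀ (h : ℝ → ℂ), ContDiff ℝ (⊤ : ℕ∞) h → ∀ a : 𝓢(ℝ, ℂ),
        ContDiff ℝ (⊤ : ℕ∞) (fun x : ℝ => h (x / n) * a x) := fun h hh a =>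
      (hh.comp (contDiff_id.div_const _)).mul (a.smooth _)
    have e1 : deriv (fun x : ℝ => h (x / n) * a x) = fun x =>
        h (x / n) * SchwartzMap.derivCLM ℝ ℂ a x + (1 / n : ℂ) * (deriv h (x / n) * a x) := by
      funext x
      have g1 : HasDerivAt h (deriv h (x / n)) (x / n) :=
        ((hh.differentiable (by simp)) _).hasDerivAt
      have g2 := (g1.scomp x ((hasDerivAt_id x).div_const (n : ℝ))).mul (a.hasDerivAt x)
      refine g2.deriv.trans ?_
      simp only [SchwartzMap.derivCLM_apply, Complex.real_smul, Function.comp, id]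
      push_cast
      ring
    rw [iteratedDeriv_succ', e1, iteratedDeriv_fun_add
      ((hs _ hh _).contDiffAt.of_le (by exact_mod_cast le_top))
      ((contDiff_const.mul (hs _ (contDiff_deriv hh) _)).contDiffAt.of_le
        (by exact_mod_cast le_top))]
    rw [iteratedDeriv_const_mul_field]
    have b1 := h₁ n hn x
    have b2 := h₂ n hn x
    have hle : ‖(1 / n : ℂ)‖ ≤ 1 := by
      simp only [norm_div, norm_one, Complex.norm_natCast]
      rw [div_le_one (by linarith)]; exact hn'
    calc _ ≤ |x| ^ k * (‖_‖ + ‖_‖) := by gcongr; exact norm_add_le _ _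
      _ ≤ |x| ^ k * (‖iteratedDeriv j (fun x => h (x / n) * SchwartzMap.derivCLM ℝ ℂ a x) x‖ +
          1 * ‖iteratedDeriv j (fun x => deriv h (x / n) * a x) x‖) := by
          rw [norm_mul]; gcongr
      _ ≤ _ := by rw [one_mul, mul_add, add_div]; exact add_le_add b1 b2

theorem tendsto_schwartz_of_decay {φ : ℕ → 𝓢(ℝ, ℂ)} {θ : 𝓢(ℝ, ℂ)}
    (h : ∀ k j, ∃ C, 0 ≤ C ∧ ∀ᶠ n : ℕ in atTop, ∀ x, |x| ^ k *
      ‖iteratedDeriv j (fun x => φ n x - θ x) x‖ ≤ C / n) :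
    Tendsto φ atTop (𝓝 θ) := by
  rw [(schwartz_withSeminorms ℝ ℝ ℂ).tendsto_nhds]
  rintro ⟨k, j⟩ ε hε
  obtain ⟨C, hC, hn⟩ := h k j
  have h1 : Tendsto (fun n : ℕ => C / n) atTop (𝓝 0) := tendsto_const_div_atTop_nhds_zero_nat C
  filter_upwards [hn, h1.eventually_lt_const hε] with n hn hlt
  refine lt_of_le_of_lt ?_ hlt
  refine SchwartzMap.seminorm_le_bound' ℝ k j _ (by positivity) fun x => ?_
  exact hn x

/-- Compactly supported functions are dense in the Schwartz space. -/
theorem exists_tendsto_hasCompactSupport (θ : 𝓢(ℝ, ℂ)) :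
    ∃ φ : ℕ → 𝓢(ℝ, ℂ), (∀ n, HasCompactSupport (φ n)) ∧ Tendsto φ atTop (𝓝 θ) := by
  let b : ContDiffBump (0 : ℝ) := ⟨1, 2, one_pos, one_lt_two⟩
  let h : ℝ → ℂ := fun x => ((b x : ℝ) : ℂ)
  have hh : ContDiff ℝ (⊤ : ℕ∞) h := Complex.ofRealCLM.contDiff.comp b.contDiff
  have hc : HasCompactSupport h := b.hasCompactSupport.comp_left (g := Complex.ofReal) rfl
  have hcn : ∀ n : ℕ, HasCompactSupport (fun x : ℝ => h (x / (n + 1 : ℕ)) * θ x) := fun n => by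
    refine HasCompactSupport.mul_right ?_
    have := hc.comp_homeomorph (Homeomorph.mulRight₀ ((n + 1 : ℕ) : ℝ)⁻¹ (by positivity))
    simpa [Function.comp_def, div_eq_mul_inv] using this
  have hsn : ∀ n : ℕ, ContDiff ℝ (⊤ : ℕ∞) (fun x : ℝ => h (x / (n + 1 : ℕ)) * θ x) := fun n =>
    (hh.comp (contDiff_id.div_const _)).mul (θ.smooth _)
  refine ⟨fun n => (hcn n).toSchwartzMap (hsn n), fun n => ?_, ?_⟩
  · exact hcn n
  -- With `n - 1` as index the dilation is by `n` itself for `n ≥ 1`, which matches the bound `C /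
  -- n`; the shift is undone by `tendsto_add_atTop_nat`.
  · have key := tendsto_schwartz_of_decay (θ := θ) (φ := fun n => (hcn (n - 1)).toSchwartzMap (hsn (n - 1)))
      (fun k j => ?_)
    · simpa [Function.comp_def] using key.comp (tendsto_add_atTop_nat 1)
    · have hb : ∀ i, ∃ B, ∀ x, ‖iteratedDeriv i (fun x => h x - 1) x‖ ≤ B := by
        rintro (_ | i)
        · refine ⟨2, fun x => ?_⟩
          simp only [iteratedDeriv_zero]
          refine (norm_sub_le _ _).trans ?_
          have : ‖h x‖ ≤ 1 := by
            simp only [h, Complex.norm_real, Real.norm_eq_abs, abs_of_nonneg b.nonneg]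
            exact b.le_one
          norm_num; linarith
        · have : iteratedDeriv (i + 1) (fun x => h x - 1) = iteratedDeriv (i + 1) h := by
            rw [iteratedDeriv_succ', iteratedDeriv_succ']; congr 1; funext x; simp
          rw [this]
          have hcs : HasCompactSupport (iteratedDeriv (i + 1) h) := by
            clear this
            induction (i + 1) with
            | zero => simpa using hc
            | succ m ih => rw [iteratedDeriv_succ]; exact ih.deriv
          exact hcs.exists_bound_of_continuous
            (hh.continuous_iteratedDeriv (i + 1) (by exact_mod_cast le_top))
      have h1 : ∀ x, |x| < 1 → h x - 1 = 0 := fun x hx => by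
        have : b x = 1 := b.one_of_mem_closedBall (by simpa using! hx.le)
        simp [h, this]
      obtain ⟨C, hC, hC'⟩ := exists_decay_cutoff_mul k j (fun x => h x - 1)
        (hh.sub contDiff_const) hb h1 θ
      refine ⟨C, hC, ?_⟩
      filter_upwards [eventually_ge_atTop 1] with n hn x
      have := hC' n hn x
      convert this using 6 with y
      have e : n - 1 + 1 = n := by omega
      change h (y / (n - 1 + 1 : ℕ)) * θ y - θ y = _
      rw [e]; ring

/-! ### Polynomial approximation of smooth functions -/

theorem contDiff_polynomial_ofReal (P : Polynomial ℂ) :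
    ContDiff ℝ (⊤ : ℕ∞) (fun y : ℝ => P.eval (y : ℂ)) := by
  induction P using Polynomial.induction_on' with
  | add p q hp hq => simpa using hp.add hq
  | monomial n a => simpa using contDiff_const.mul (Complex.ofRealCLM.contDiff.pow n)

theorem hasDerivAt_polynomial_ofReal (P : Polynomial ℂ) (y : ℝ) :
    HasDerivAt (fun y : ℝ => P.eval (y : ℂ)) (P.derivative.eval (y : ℂ)) y :=
  (P.hasDerivAt (y : ℂ)).comp_ofReal

theorem exists_derivative_eq (P : Polynomial ℂ) : ∃ Q : Polynomial ℂ, Q.derivative = P := by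
  induction P using Polynomial.induction_on' with
  | add p q hp hq =>
    obtain ⟨a, rfl⟩ := hp
    obtain ⟨b, rfl⟩ := hq
    exact ⟨a + b, by simp⟩
  | monomial n a =>
    refine ⟨Polynomial.monomial (n + 1) (a / (n + 1)), ?_⟩
    rw [Polynomial.derivative_monomial]
    have : (n + 1 : ℂ) ≠ 0 := by exact_mod_cast n.succ_ne_zero
    simp [this]

/-- Weierstrass approximation of the highest derivative, integrated back up; each constant of
integration is chosen so that the error vanishes at `0`. -/
theorem exists_polynomial_near_contDiff {R : ℝ} (hR : 0 ≤ R) (N : ℕ) :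
    ∀ f : ℝ → ℂ, ContDiff ℝ (⊤ : ℕ∞) f → ∀ ε > 0, ∃ P : Polynomial ℂ, ∀ i ≤ N,
      ∀ y ∈ Icc 0 R, ‖iteratedDeriv i (fun y : ℝ => f y - P.eval (y : ℂ)) y‖ ≤ ε := by
  induction N with
  | zero =>
    intro f hf ε hε
    obtain ⟨p, hp⟩ := exists_polynomial_near_of_continuousOn 0 R (fun y => (f y).re)
      (Complex.continuous_re.comp hf.continuous).continuousOn (ε / 2) (by positivity)
    obtain ⟨q, hq⟩ := exists_polynomial_near_of_continuousOn 0 R (fun y => (f y).im)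
      (Complex.continuous_im.comp hf.continuous).continuousOn (ε / 2) (by positivity)
    refine ⟨p.map Complex.ofRealHom + Polynomial.C Complex.I * q.map Complex.ofRealHom,
      fun i hi y hy => ?_⟩
    obtain rfl : i = 0 := by omega
    have h1 : ∀ r : Polynomial ℝ, (r.map Complex.ofRealHom).eval (y : ℂ) = (r.eval y : ℝ) :=
      fun r => by
        have := Polynomial.eval_map_apply (p := r) Complex.ofRealHom y
        simpa using this
    simp only [iteratedDeriv_zero, Polynomial.eval_add, Polynomial.eval_mul, Polynomial.eval_C, h1]
    refine (Complex.norm_le_abs_re_add_abs_im _).trans ?_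
    have a1 := hp y hy
    have a2 := hq y hy
    rw [abs_sub_comm] at a1 a2
    simp only [Complex.sub_re, Complex.add_re, Complex.ofReal_re, Complex.mul_re, Complex.I_re,
      Complex.I_im, Complex.ofReal_im, Complex.sub_im, Complex.add_im, Complex.mul_im]
    ring_nf at a1 a2 ⊢
    linarith
  | succ N ih =>
    intro f hf ε hε
    -- Integration over `[0, R]` multiplies the error by at most `R`; the tolerance `ε / (R + 1)`
    -- allows for this and is itself at most `ε`.
    obtain ⟨P, hP⟩ := ih (deriv f) (contDiff_deriv hf) (ε / (R + 1)) (by positivity)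
    obtain ⟨Q, rfl⟩ := exists_derivative_eq P
    have hder : ∀ c : ℂ, deriv (fun y : ℝ => f y - (Polynomial.C c + Q).eval (y : ℂ)) =
        fun y : ℝ => deriv f y - Q.derivative.eval (y : ℂ) := fun c => by
      funext y
      have h1 : HasDerivAt f (deriv f y) y := ((hf.differentiable (by simp)) _).hasDerivAt
      refine (h1.fun_sub (hasDerivAt_polynomial_ofReal (Polynomial.C c + Q) y)).deriv.trans ?_
      simp
    have hle : ε / (R + 1) ≤ ε := by rw [div_le_iff₀ (by positivity)]; nlinarith
    refine ⟨Polynomial.C (f 0 - Q.eval 0) + Q, fun i hi y hy => ?_⟩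
    rcases i with _ | i
    · have hd : ∀ z ∈ Icc 0 R, DifferentiableAt ℝ
          (fun y : ℝ => f y - (Polynomial.C (f 0 - Q.eval 0) + Q).eval (y : ℂ)) z := fun z _ =>
        ((hf.sub (contDiff_polynomial_ofReal _)).differentiable (by simp)) z
      have := (convex_Icc (0 : ℝ) R).norm_image_sub_le_of_norm_deriv_le (C := ε / (R + 1)) hd
        (fun z hz => by rw [hder]; simpa using hP 0 (Nat.zero_le _) z hz)
        (left_mem_Icc.mpr hR) hy
      simp only [iteratedDeriv_zero]
      refine le_trans ?_ (this.trans ?_)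
      · simp
      · simp only [sub_zero, Real.norm_eq_abs, abs_of_nonneg hy.1]
        calc ε / (R + 1) * y ≤ ε / (R + 1) * (R + 1) := by gcongr; linarith [hy.2]
          _ = ε := by field_simp
    · rw [iteratedDeriv_succ', hder]
      exact (hP i (by omega) y hy).trans hle

/-! ### Uniqueness of a causal tempered distribution with given Laplace transform -/

/-- The smooth function equal to `e^{-x}` for `x ≥ -1` and to `0` for `x ≤ -2`. -/
def cutExpFun (x : ℝ) : ℝ := Real.smoothTransition (x + 2) * Real.exp (-x)

theorem cutExpFun_eq {x : ℝ} (hx : -1 ≤ x) : cutExpFun x = Real.exp (-x) := by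
  rw [cutExpFun, Real.smoothTransition.one_of_one_le (by linarith), one_mul]

theorem cutExpFun_zero {x : ℝ} (hx : x ≤ -2) : cutExpFun x = 0 := by
  rw [cutExpFun, Real.smoothTransition.zero_of_nonpos (by linarith), zero_mul]

theorem contDiff_cutExpFun : ContDiff ℝ (⊤ : ℕ∞) cutExpFun :=
  (Real.smoothTransition.contDiff.comp (contDiff_id.add contDiff_const)).mul
    (Real.contDiff_exp.comp contDiff_neg)

/-- `cutExpFun` as a Schwartz function. -/
def cutExp : 𝓢(ℝ, ℝ) where
  toFun := cutExpFun
  smooth' := contDiff_cutExpFun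
  decay' := by
    intro k n
    have hcont : Continuous fun x : ℝ => |x| ^ k * ‖iteratedDeriv n cutExpFun x‖ :=
      (continuous_abs.pow k).mul
        (contDiff_cutExpFun.continuous_iteratedDeriv n (by exact_mod_cast le_top)).norm
    -- Left of `-2` the function is zero, and right of `0` its derivatives are `±e^{-x}` with `x^k
    -- e^{-x} ≤ k!`; only the compact interval in between needs a bound by continuity.
    obtain ⟨C, hC⟩ := (isCompact_Icc (a := (-2 : ℝ)) (b := 0)).exists_bound_of_continuousOn
      hcont.continuousOn
    refine ⟨max C k.factorial, fun x => ?_⟩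
    rw [norm_iteratedFDeriv_eq_norm_iteratedDeriv, Real.norm_eq_abs]
    by_cases h1 : x < -2
    · have : cutExpFun =ᶠ[𝓝 x] fun _ => 0 := by
        filter_upwards [Iio_mem_nhds h1] with y hy using cutExpFun_zero (le_of_lt hy)
      rw [this.iteratedDeriv_eq]
      simp
    by_cases h2 : 0 < x
    · have : cutExpFun =ᶠ[𝓝 x] fun y => Real.exp (-y) := by
        filter_upwards [Ioi_mem_nhds h2] with y hy
        exact cutExpFun_eq (by linarith [mem_Ioi.mp hy])
      have e : iteratedDeriv n (fun y : ℝ => Real.exp (-y)) x = (-1) ^ n * Real.exp (-x) := by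
        have := congrFun (iteratedDeriv_exp_const_mul n (-1)) x
        simpa using this
      rw [this.iteratedDeriv_eq, e]
      simp only [norm_mul, norm_pow, norm_neg, norm_one, one_pow, one_mul, Real.norm_eq_abs,
        Real.abs_exp, abs_of_pos h2]
      have := Real.pow_div_factorial_le_exp x h2.le k
      rw [div_le_iff₀ (by positivity)] at this
      refine le_max_of_le_right ?_
      rw [Real.exp_neg, ← div_eq_mul_inv, div_le_iff₀ (Real.exp_pos x), mul_comm]
      exact this
    · refine le_max_of_le_left ((le_abs_self _).trans (hC x ⟨by linarith, by linarith⟩))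

theorem cutExp_apply (x : ℝ) : cutExp x = cutExpFun x := rfl

theorem cutExp_mem (x : ℝ) : cutExp x ∈ Icc 0 (Real.exp 2) := by
  rw [cutExp_apply]
  refine ⟨mul_nonneg (Real.smoothTransition.nonneg _) (Real.exp_pos _).le, ?_⟩
  by_cases h : x ≤ -2
  · rw [cutExpFun_zero h]; positivity
  · calc cutExpFun x ≤ 1 * Real.exp (-x) := by
          unfold cutExpFun; gcongr; exact Real.smoothTransition.le_one _
      _ ≤ Real.exp 2 := by rw [one_mul]; exact Real.exp_le_exp.mpr (by linarith)

/-- `cutExp` with complex values. -/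
def cutExpC : 𝓢(ℝ, ℂ) := SchwartzMap.postcompCLM (𝕜 := ℝ) Complex.ofRealCLM cutExp

theorem cutExpC_apply (x : ℝ) : cutExpC x = (cutExp x : ℂ) := by
  simp [cutExpC]

/-- The Schwartz function `x ↦ f(e^{-x}) e^{-x}`, cut off on the left. -/
def expComp (f : ℝ → ℂ) (hf : ContDiff ℝ (⊤ : ℕ∞) f) : 𝓢(ℝ, ℂ) where
  toFun x := f (cutExp x) * cutExpC x
  smooth' := contDiff_comp_mul _ _ hf
  decay' := by
    intro k j
    obtain ⟨C, hC, h⟩ := exists_decay_comp_mul cutExp cutExp_mem k j cutExpC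
    have hb : ∀ i : ℕ, ∃ B, ∀ y ∈ Icc 0 (Real.exp 2), ‖iteratedDeriv i f y‖ ≤ B := fun i =>
      isCompact_Icc.exists_bound_of_continuousOn
        (hf.continuous_iteratedDeriv i (by exact_mod_cast le_top)).continuousOn
    choose B hB using hb
    refine ⟨C * ∑ i ∈ Finset.range (j + 1), |B i|, fun x => ?_⟩
    rw [norm_iteratedFDeriv_eq_norm_iteratedDeriv, Real.norm_eq_abs]
    refine h f hf _ (fun i hi y hy => ((hB i y hy).trans (le_abs_self _)).trans ?_) x
    exact Finset.single_le_sum (f := fun i => |B i|) (fun i _ => abs_nonneg _)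
      (Finset.mem_range.mpr (by omega))

theorem expComp_apply (f : ℝ → ℂ) (hf : ContDiff ℝ (⊤ : ℕ∞) f) (x : ℝ) :
    expComp f hf x = f (cutExp x) * (cutExp x : ℂ) := by
  rw [← cutExpC_apply]; rfl

/-- On `x ≥ 0` the monomial `y^n` becomes `e^{-(n+1)x}`: the factor `e^{-x}` that provides the
Schwartz decay shifts the exponent by one. -/
theorem apply_expComp_polynomial {D : 𝓢'(ℝ, ℂ)}
    (h : ∀ n : ℕ, ∀ θ : 𝓢(ℝ, ℂ),
      (∀ x : ℝ, 0 ≤ x → θ x = Complex.exp (-(n + 1) * x)) → D θ = 0) (P : Polynomial ℂ) :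
    D (expComp _ (contDiff_polynomial_ofReal P)) = 0 := by
  induction P using Polynomial.induction_on' with
  | add p q hp hq =>
    have : expComp _ (contDiff_polynomial_ofReal (p + q)) =
        expComp _ (contDiff_polynomial_ofReal p) + expComp _ (contDiff_polynomial_ofReal q) := by
      ext x
      simp [expComp_apply, add_mul]
    rw [this, map_add, hp, hq, add_zero]
  | monomial n a =>
    have : expComp _ (contDiff_polynomial_ofReal (Polynomial.monomial n a)) =
        a • expComp _ (contDiff_polynomial_ofReal (Polynomial.monomial n 1)) := by
      ext x
      simp [expComp_apply, mul_assoc]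
    rw [this, map_smul, h n, smul_zero]
    intro x hx
    rw [expComp_apply, cutExp_apply, cutExpFun_eq (by linarith)]
    simp only [Polynomial.eval_monomial, one_mul, Complex.ofReal_exp]
    rw [← pow_succ, ← Complex.exp_nat_mul]
    congr 1
    push_cast
    ring

theorem apply_expComp {D : 𝓢'(ℝ, ℂ)}
    (h : ∀ n : ℕ, ∀ θ : 𝓢(ℝ, ℂ),
      (∀ x : ℝ, 0 ≤ x → θ x = Complex.exp (-(n + 1) * x)) → D θ = 0)
    (f : ℝ → ℂ) (hf : ContDiff ℝ (⊤ : ℕ∞) f) : D (expComp f hf) = 0 := by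
  -- The number of derivatives approximated and the accuracy both increase with `n`, so that every
  -- fixed Schwartz seminorm of the error is eventually controlled and tends to `0`.
  choose P hP using fun n : ℕ => exists_polynomial_near_contDiff (Real.exp_pos 2).le n f hf
    (1 / (n + 1 : ℝ)) (by positivity)
  have ht : Tendsto (fun n => expComp _ (contDiff_polynomial_ofReal (P n))) atTop
      (𝓝 (expComp f hf)) := by
    refine tendsto_schwartz_of_decay fun k j => ?_
    obtain ⟨C, hC, hb⟩ := exists_decay_comp_mul cutExp cutExp_mem k j cutExpC
    refine ⟨C, hC, ?_⟩
    filter_upwards [eventually_ge_atTop j, eventually_ge_atTop 1] with n hn hn1 x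
    have := hb _ (hf.sub (contDiff_polynomial_ofReal (P n))) (1 / (n + 1 : ℝ))
      (fun i hi y hy => hP n i (hi.trans hn) y hy) x
    have hn0 : (0 : ℝ) < n := by exact_mod_cast hn1
    calc _ = |x| ^ k * ‖iteratedDeriv j (fun x => (f (cutExp x) - (P n).eval (cutExp x : ℂ)) *
          cutExpC x) x‖ := by
          rw [← norm_neg (iteratedDeriv j _ x), ← iteratedDeriv_fun_neg]
          congr 4
          funext y
          rw [expComp_apply, expComp_apply, cutExpC_apply]
          ring
      _ ≤ C * (1 / (n + 1)) := this
      _ ≤ C / n := by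
          rw [mul_one_div]
          gcongr
          linarith
  have h1 := ((map_continuous D).tendsto _).comp ht
  refine tendsto_nhds_unique h1 ?_
  simp only [Function.comp_def, apply_expComp_polynomial h]
  exact tendsto_const_nhds

/-- A causal tempered distribution that vanishes on exponentials is zero. -/
theorem eq_zero_of_apply_exp {D : 𝓢'(ℝ, ℂ)} (hD : Distribution.IsVanishingOn D (Iio (0 : ℝ)))
    (h : ∀ n : ℕ, ∀ θ : 𝓢(ℝ, ℂ),
      (∀ x : ℝ, 0 ≤ x → θ x = Complex.exp (-(n + 1) * x)) → D θ = 0) : D = 0 := by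
  have hcs : ∀ θ : 𝓢(ℝ, ℂ), HasCompactSupport θ → D θ = 0 := by
    intro θ hθ
    obtain ⟨M, hM⟩ := hθ.isCompact.isBounded.exists_norm_le
    have hM' : ∀ x, M < x → θ x = 0 := fun x hx => by
      by_contra hne
      have := hM x (subset_tsupport _ hne)
      rw [Real.norm_eq_abs] at this
      linarith [le_abs_self x]
    -- This is `θ(x) e^x` in the variable `y = e^{-x}`. As `θ` vanishes for `x > M`, `f` vanishes
    -- for `y < e^{-M}` and is smooth across `y = 0`.
    let f : ℝ → ℂ := fun y => if 0 < y then θ (-Real.log y) / y else 0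
    have hf : ContDiff ℝ (⊤ : ℕ∞) f := by
      rw [contDiff_iff_contDiffAt]
      intro y
      by_cases hy : 0 < y
      · have : f =ᶠ[𝓝 y] fun y => θ (-Real.log y) / y := by
          filter_upwards [Ioi_mem_nhds hy] with z hz
          simp only [f, if_pos (mem_Ioi.mp hz)]
        refine ContDiffAt.congr_of_eventuallyEq ?_ this
        simp only [div_eq_mul_inv]
        refine ContDiffAt.mul ((θ.contDiffAt _).comp y (Real.contDiffAt_log.mpr hy.ne').neg) ?_
        exact (Complex.ofRealCLM.contDiff.contDiffAt (x := y)).inv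
          (Complex.ofReal_ne_zero.mpr hy.ne')
      · have : f =ᶠ[𝓝 y] fun y => 0 := by
          filter_upwards [Iio_mem_nhds (lt_of_le_of_lt (not_lt.mp hy) (Real.exp_pos (-M)))]
            with z hz
          simp only [f]
          split_ifs with h0
          · rw [hM', zero_div]
            have := Real.log_lt_log h0 (mem_Iio.mp hz)
            rw [Real.log_exp] at this
            linarith
          · rfl
        exact contDiffAt_const.congr_of_eventuallyEq this
    -- The two functions agree to the right of `-1`. The margin keeps the closed support of the
    -- difference inside the open half line on which `D` vanishes.
    have h0 : D (θ - expComp f hf) = 0 := by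
      apply hD
      have : tsupport (θ - expComp f hf) ⊆ Iic (-1) := by
        refine closure_minimal (fun x hx => ?_) isClosed_Iic
        by_contra hlt
        rw [mem_Iic, not_le] at hlt
        apply hx
        rw [sub_apply, expComp_apply, cutExp_apply, cutExpFun_eq hlt.le]
        simp only [f, if_pos (Real.exp_pos _), Real.log_exp, neg_neg]
        rw [div_mul_cancel₀, sub_self]
        simp
      exact this.trans fun x hx => by
        have := mem_Iic.mp hx
        exact mem_Iio.mpr (by linarith)
    rw [map_sub, apply_expComp h, sub_zero] at h0
    exact h0
  ext θ
  obtain ⟨φ, hφ, ht⟩ := exists_tendsto_hasCompactSupport θ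
  have h1 := ((map_continuous D).tendsto _).comp ht
  refine tendsto_nhds_unique h1 ?_
  simp only [Function.comp_def, hcs _ (hφ _)]
  exact tendsto_const_nhds

/-- Only the values of the transform at the integers `n + 1` are needed. -/
theorem HasLaplaceTransform.unique {K L : 𝓢'(ℝ, ℂ)} {F : ℂ → ℂ} (hK : HasLaplaceTransform K F)
    (hL : HasLaplaceTransform L F) : K = L := by
  rw [← sub_eq_zero]
  refine eq_zero_of_apply_exp (fun θ hθ => ?_) fun n θ hθ => ?_
  · change K θ - L θ = 0
    rw [hK.causal θ hθ, hL.causal θ hθ, sub_zero]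
  · change K θ - L θ = 0
    have hre : 0 < ((n : ℂ) + 1).re := by simp; positivity
    rw [hK.transform _ hre θ hθ, hL.transform _ hre θ hθ, sub_self]

/-! ### Convolution of causal nonnegative functions -/

/-- `f` vanishes on the negative half line. -/
def Causal (f : ℝ → ℝ≥0∞) : Prop := ∀ x < 0, f x = 0

/-- The Heaviside function. -/
def heaviside : ℝ → ℝ≥0∞ := indicator (Ici 0) 1

/-- The weight `e^{-σ x}`. -/
def expWeight (σ x : ℝ) : ℝ≥0∞ := ENNReal.ofReal (Real.exp (-σ * x))

/-- The Laplace transform, at the real number `σ`, of a nonnegative function. -/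
def lLaplace (σ : ℝ) (f : ℝ → ℝ≥0∞) : ℝ≥0∞ := ∫⁻ x, expWeight σ x * f x

/-- `p` is a measurable probability density on `(0, ∞)`, extended by zero. -/
structure IsPosDensity (p : ℝ → ℝ≥0∞) : Prop where
  measurable : Measurable p
  zero : ∀ x ≤ 0, p x = 0
  lintegral : ∫⁻ x, p x = 1

/-- The survival function of the density `p`. -/
def tail (p : ℝ → ℝ≥0∞) : ℝ → ℝ≥0∞ := indicator (Ici 0) fun a => ∫⁻ r in Ioi a, p r

theorem IsPosDensity.causal {p : ℝ → ℝ≥0∞} (hp : IsPosDensity p) : Causal p :=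
  fun x hx => hp.zero x hx.le

@[fun_prop]
theorem measurable_heaviside : Measurable heaviside :=
  measurable_one.indicator measurableSet_Ici

@[fun_prop]
theorem measurable_expWeight (σ : ℝ) : Measurable (expWeight σ) := by
  unfold expWeight; fun_prop

theorem expWeight_add (σ x y : ℝ) : expWeight σ (x + y) = expWeight σ x * expWeight σ y := by
  rw [expWeight, expWeight, expWeight, ← ENNReal.ofReal_mul (Real.exp_pos _).le, ← Real.exp_add]
  congr 2; ring

theorem expWeight_ne_top (σ x : ℝ) : expWeight σ x ≠ ∞ := ENNReal.ofReal_ne_top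

theorem expWeight_ne_zero (σ x : ℝ) : expWeight σ x ≠ 0 := by
  simp [expWeight, Real.exp_pos]

theorem measurable_tail (p : ℝ → ℝ≥0∞) : Measurable (tail p) := by
  refine Measurable.indicator ?_ measurableSet_Ici
  refine Antitone.measurable fun a b hab => ?_
  exact lintegral_mono_set (Ioi_subset_Ioi hab)

theorem causal_tail (p : ℝ → ℝ≥0∞) : Causal (tail p) := fun x hx =>
  indicator_of_notMem (by simpa using hx) _

theorem lconvolution_add_right {f g h : ℝ → ℝ≥0∞} (hf : Measurable f) (hg : Measurable g) :
    f ⋆ₗ (g + h) = f ⋆ₗ g + f ⋆ₗ h := by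
  ext x
  simp only [lconvolution_def, Pi.add_apply, mul_add]
  rw [lintegral_add_left (by fun_prop)]

theorem lconvolution_tsum_right {f : ℝ → ℝ≥0∞} {g : ℕ → ℝ → ℝ≥0∞} (hf : Measurable f)
    (hg : ∀ n, Measurable (g n)) (x : ℝ) :
    (f ⋆ₗ fun x => ∑' n, g n x) x = ∑' n, (f ⋆ₗ g n) x := by
  simp only [lconvolution_def, ← ENNReal.tsum_mul_left]
  rw [lintegral_tsum fun n => by have := hg n; fun_prop]

theorem lconvolution_heaviside (f : ℝ → ℝ≥0∞) (t : ℝ) :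
    (f ⋆ₗ heaviside) t = ∫⁻ s in Iic t, f s := by
  rw [lconvolution_def, ← lintegral_indicator measurableSet_Iic]
  congr 1
  ext y
  by_cases hy : y ≤ t
  · rw [heaviside, indicator_of_mem (by simpa using hy), indicator_of_mem (by simpa using hy)]
    simp
  · rw [heaviside, indicator_of_notMem (by simpa using hy),
      indicator_of_notMem (by simpa using hy), mul_zero]

/-- The relation `φ = 1 - ∫ψ` without subtraction, so that it can be used for extended nonnegative
functions: at `t ≥ 0` the total mass `1` is split at `t`. -/
theorem tail_add {p : ℝ → ℝ≥0∞} (hp : IsPosDensity p) : tail p + p ⋆ₗ heaviside = heaviside := by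
  ext t
  rw [Pi.add_apply, lconvolution_heaviside]
  by_cases ht : 0 ≤ t
  · rw [tail, indicator_of_mem (by simpa using ht), heaviside, indicator_of_mem (by simpa using ht),
      Pi.one_apply, ← hp.lintegral, add_comm, ← compl_Iic,
      lintegral_add_compl _ measurableSet_Iic]
  · rw [tail, indicator_of_notMem (by simpa using ht), heaviside,
      indicator_of_notMem (by simpa using ht), zero_add]
    rw [setLIntegral_eq_zero_iff measurableSet_Iic hp.measurable]
    exact ae_of_all _ fun x hx => hp.zero x (hx.trans (not_le.mp ht).le)

theorem lLaplace_lconvolution (σ : ℝ) {f g : ℝ → ℝ≥0∞} (hf : Measurable f) (hg : Measurable g) :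
    lLaplace σ (f ⋆ₗ g) = lLaplace σ f * lLaplace σ g := by
  simp only [lLaplace, lconvolution_def]
  calc ∫⁻ x, expWeight σ x * ∫⁻ y, f y * g (-y + x)
      = ∫⁻ x, ∫⁻ y, (expWeight σ y * f y) * (expWeight σ (-y + x) * g (-y + x)) := by
        refine lintegral_congr fun x => ?_
        rw [← lintegral_const_mul _ (by fun_prop)]
        refine lintegral_congr fun y => ?_
        rw [show expWeight σ x = expWeight σ y * expWeight σ (-y + x) by
          rw [← expWeight_add]; congr 1; ring]
        ring
    _ = ∫⁻ y, ∫⁻ x, (expWeight σ y * f y) * (expWeight σ (-y + x) * g (-y + x)) := by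
        rw [lintegral_lintegral_swap]
        have := measurable_expWeight σ
        fun_prop
    _ = ∫⁻ y, (expWeight σ y * f y) * ∫⁻ x, expWeight σ x * g x := by
        refine lintegral_congr fun y => ?_
        rw [lintegral_const_mul _ (by have := measurable_expWeight σ; fun_prop)]
        rw [lintegral_add_left_eq_self (fun x => expWeight σ x * g x)]
    _ = _ := by
        rw [lintegral_mul_const _ (by have := measurable_expWeight σ; fun_prop)]

theorem lLaplace_heaviside {σ : ℝ} (hσ : 0 < σ) :
    lLaplace σ heaviside = ENNReal.ofReal σ⁻¹ := by
  have h1 : lLaplace σ heaviside = ∫⁻ x in Ioi 0, ENNReal.ofReal (Real.exp (-σ * x)) := by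
    rw [setLIntegral_congr Ioi_ae_eq_Ici, ← lintegral_indicator measurableSet_Ici, lLaplace]
    congr 1
    ext x
    by_cases hx : 0 ≤ x <;> simp [heaviside, expWeight, indicator, hx]
  rw [h1, ← ofReal_integral_eq_lintegral_ofReal (integrableOn_exp_mul_Ioi (by linarith) 0)
    (ae_of_all _ fun x => (Real.exp_pos _).le), integral_exp_mul_Ioi (by linarith)]
  congr 1
  simp [neg_div_neg_eq]

theorem lLaplace_tsum (σ : ℝ) {g : ℕ → ℝ → ℝ≥0∞} (hg : ∀ n, Measurable (g n)) :
    lLaplace σ (fun x => ∑' n, g n x) = ∑' n, lLaplace σ (g n) := by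
  simp only [lLaplace, ← ENNReal.tsum_mul_left]
  rw [lintegral_tsum fun n => by have := hg n; have := measurable_expWeight σ; fun_prop]

theorem lLaplace_add (σ : ℝ) {f g : ℝ → ℝ≥0∞} (hf : Measurable f) :
    lLaplace σ (f + g) = lLaplace σ f + lLaplace σ g := by
  simp only [lLaplace, Pi.add_apply, mul_add]
  rw [lintegral_add_left (by have := measurable_expWeight σ; fun_prop)]

theorem expWeight_le_one {σ x : ℝ} (hσ : 0 ≤ σ) (hx : 0 ≤ x) : expWeight σ x ≤ 1 := by
  rw [expWeight, ← ENNReal.ofReal_one]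
  refine ENNReal.ofReal_le_ofReal (Real.exp_le_one_iff.mpr ?_)
  nlinarith [mul_nonneg hσ hx]

/-- The inequality is strict because all the mass of `p` lies on `(0, ∞)`, where the weight is less
than `1`. It makes the geometric series of the renewal density converge for every `σ > 0`. -/
theorem lLaplace_lt_one {p : ℝ → ℝ≥0∞} (hp : IsPosDensity p) {σ : ℝ} (hσ : 0 < σ) :
    lLaplace σ p < 1 := by
  have hle : ∀ x, expWeight σ x * p x ≤ p x := fun x => by
    rcases le_or_gt x 0 with hx | hx
    · simp [hp.zero x hx]
    · exact mul_le_of_le_one_left (zero_le) (expWeight_le_one hσ.le hx.le)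
  have hpt : ∀ᵐ x, p x < ∞ := ae_lt_top hp.measurable (by simp [hp.lintegral])
  rw [← hp.lintegral]
  have hs : (volume : Measure ℝ) {x | p x ≠ 0} ≠ 0 := by
    intro h0
    have : ∫⁻ x, p x = 0 := by
      rw [lintegral_eq_zero_iff hp.measurable]
      exact h0
    simp [hp.lintegral] at this
  refine lintegral_strict_mono_of_ae_le_of_ae_lt_on hp.measurable.aemeasurable
    ?_ (ae_of_all _ hle) hs ?_
  · exact ((lintegral_mono hle).trans_lt (by simp [hp.lintegral])).ne
  · filter_upwards [hpt] with x hx h0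
    have hx0 : 0 < x := by
      by_contra h
      exact h0 (hp.zero x (not_lt.mp h))
    have h1 : expWeight σ x < 1 := by
      rw [expWeight, ← ENNReal.ofReal_one]
      refine (ENNReal.ofReal_lt_ofReal_iff one_pos).mpr (Real.exp_lt_one_iff.mpr ?_)
      nlinarith
    calc _ < 1 * p x := ENNReal.mul_lt_mul_left h0 hx.ne h1
      _ = _ := one_mul _

/-- Dominated convergence; `p` has no atom at `0`. For large `σ` a single waiting time therefore
contracts the norm with weight `e^{-σx}` as strongly as desired. -/
theorem tendsto_lLaplace_atTop {p : ℝ → ℝ≥0∞} (hp : IsPosDensity p) :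
    Tendsto (fun σ => lLaplace σ p) atTop (𝓝 0) := by
  have h := tendsto_lintegral_filter_of_dominated_convergence (μ := volume) (l := atTop)
    (F := fun σ x => expWeight σ x * p x) (f := fun _ => 0) p
    (Eventually.of_forall fun σ => by have := hp.measurable; fun_prop)
    (by
      filter_upwards [eventually_ge_atTop 0] with σ hσ
      refine ae_of_all _ fun x => ?_
      rcases le_or_gt x 0 with hx | hx
      · simp [hp.zero x hx]
      · exact mul_le_of_le_one_left (zero_le) (expWeight_le_one hσ hx.le))
    (by simp [hp.lintegral])
    (by
      have hpt : ∀ᵐ x, p x < ∞ := ae_lt_top hp.measurable (by simp [hp.lintegral])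
      filter_upwards [hpt] with x hx
      rcases le_or_gt x 0 with hx0 | hx0
      · simp [hp.zero x hx0]
      · have : Tendsto (fun σ : ℝ => expWeight σ x) atTop (𝓝 0) := by
          rw [← ENNReal.ofReal_zero]
          refine ENNReal.tendsto_ofReal (Real.tendsto_exp_atBot.comp ?_)
          exact (tendsto_neg_atTop_atBot).atBot_mul_const hx0
        simpa using ENNReal.Tendsto.mul_const this (Or.inr hx.ne))
  simpa [lLaplace] using h

theorem causal_lconvolution {f g : ℝ → ℝ≥0∞} (hf : Causal f) (hg : Causal g) : Causal (f ⋆ₗ g) := by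
  intro x hx
  rw [lconvolution_def]
  refine (lintegral_congr fun y => ?_).trans lintegral_zero
  rcases lt_or_ge y 0 with hy | hy
  · rw [hf y hy, zero_mul]
  · rw [hg _ (by linarith), mul_zero]

/-- Integrals of `f` over `(-∞, t]` are controlled by the Laplace transform. -/
theorem setLIntegral_Iic_le {σ : ℝ} (hσ : 0 ≤ σ) (f : ℝ → ℝ≥0∞) (t : ℝ) :
    ∫⁻ s in Iic t, f s ≤ expWeight (-σ) t * lLaplace σ f := by
  rw [lLaplace, ← lintegral_const_mul' _ _ (expWeight_ne_top _ _)]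
  refine (setLIntegral_mono' measurableSet_Iic fun s hs => ?_).trans (setLIntegral_le_lintegral _ _)
  rw [← mul_assoc]
  refine le_mul_of_one_le_left (zero_le) ?_
  rw [expWeight, expWeight, ← ENNReal.ofReal_mul (Real.exp_pos _).le, ← Real.exp_add,
    ← ENNReal.ofReal_one]
  refine ENNReal.ofReal_le_ofReal (Real.one_le_exp ?_)
  have : s ≤ t := hs
  nlinarith

/-- An exponential is an eigenfunction of convolution with `p`, with the Laplace transform as
eigenvalue; causality of `p` confines the comparison to arguments up to `T`. -/
theorem lconvolution_le_of_le {σ T : ℝ} {p f : ℝ → ℝ≥0∞} (hpm : Measurable p) (hp : Causal p) {C : ℝ≥0∞}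
    (h : ∀ x ≤ T, f x ≤ C * expWeight (-σ) x) :
    ∀ x ≤ T, (p ⋆ₗ f) x ≤ lLaplace σ p * C * expWeight (-σ) x := by
  intro x hx
  rw [lconvolution_def, lLaplace, mul_assoc, ← lintegral_mul_const _ (by fun_prop)]
  refine lintegral_mono fun y => ?_
  rcases lt_or_ge y 0 with hy | hy
  · simp [hp y hy]
  · calc p y * f (-y + x) ≤ p y * (C * expWeight (-σ) (-y + x)) := by
          gcongr; exact h _ (by linarith)
      _ = _ := by
          rw [expWeight_add, show expWeight (-σ) (-y) = expWeight σ y by simp [expWeight]]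
          ring

theorem indicator_lconvolution_le {p f : ℝ → ℝ≥0∞} (hp : Causal p) (T : ℝ) :
    indicator (Iic T) (p ⋆ₗ f) ≤ p ⋆ₗ indicator (Iic T) f := by
  intro x
  by_cases hx : x ≤ T
  · rw [indicator_of_mem (by simpa using hx)]
    refine lintegral_mono fun y => ?_
    rcases lt_or_ge y 0 with hy | hy
    · simp [hp y hy]
    · rw [indicator_of_mem (by simp; linarith)]
  · rw [indicator_of_notMem (by simpa using hx)]
    exact zero_le

/-! ### The renewal density -/

/-- The iterated convolution `p ⋆ ⋯ ⋆ p` with `n + 1` factors. -/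
def convPow (p : ℝ → ℝ≥0∞) : ℕ → ℝ → ℝ≥0∞
  | 0 => p
  | n + 1 => p ⋆ₗ convPow p n

/-- The renewal density, the sum of all iterated convolutions of `p`. -/
def renewal (p : ℝ → ℝ≥0∞) (x : ℝ) : ℝ≥0∞ := ∑' n, convPow p n x

theorem measurable_convPow {p : ℝ → ℝ≥0∞} (hp : Measurable p) (n : ℕ) :
    Measurable (convPow p n) := by
  induction n with
  | zero => exact hp
  | succ n ih => exact measurable_lconvolution _ hp ih

theorem measurable_renewal {p : ℝ → ℝ≥0∞} (hp : Measurable p) : Measurable (renewal p) :=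
  Measurable.tsum (measurable_convPow hp)

theorem causal_renewal {p : ℝ → ℝ≥0∞} (hp : Causal p) : Causal (renewal p) := by
  have h : ∀ n, Causal (convPow p n) := fun n => by
    induction n with
    | zero => exact hp
    | succ n ih => exact causal_lconvolution hp ih
  intro x hx
  simp [renewal, h _ x hx]

theorem renewal_eq {p : ℝ → ℝ≥0∞} (hp : Measurable p) :
    renewal p = p + p ⋆ₗ renewal p := by
  ext x
  have : (p ⋆ₗ renewal p) x = ∑' n, (p ⋆ₗ convPow p n) x :=
    lconvolution_tsum_right hp (measurable_convPow hp) x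
  rw [Pi.add_apply, this, renewal, ENNReal.tsum_eq_add_tsum_ite 0, tsum_eq_zero_add' (by simp)]
  simp [convPow]

/-- The transform of the `n`-th term is a power of `lLaplace σ p < 1`, so the sum is a convergent
geometric series. -/
theorem lLaplace_renewal_lt_top {p : ℝ → ℝ≥0∞} (hp : IsPosDensity p) {σ : ℝ} (hσ : 0 < σ) :
    lLaplace σ (renewal p) < ∞ := by
  have h : ∀ n, lLaplace σ (convPow p n) = lLaplace σ p ^ (n + 1) := fun n => by
    induction n with
    | zero => simp [convPow]
    | succ n ih =>
      rw [convPow, lLaplace_lconvolution _ hp.measurable (measurable_convPow hp.measurable n), ih,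
        pow_succ' _ (n + 1)]
  have h1 : lLaplace σ (renewal p) = ∑' n, lLaplace σ p ^ (n + 1) := by
    simp only [← h]
    exact lLaplace_tsum _ (measurable_convPow hp.measurable)
  rw [h1, ENNReal.tsum_geometric_add_one]
  have h2 := lLaplace_lt_one hp hσ
  refine ENNReal.mul_lt_top (h2.trans ENNReal.one_lt_top) ?_
  rw [ENNReal.inv_lt_top]
  exact tsub_pos_of_lt h2

/-- Convolve `M` with `H = φ + p ⋆ H`, and `H` with `M = p + p ⋆ M`. Both give `M ⋆ H`, and the
common term `M ⋆ p ⋆ H` cancels because it is finite. This is the time-domain form of `s M̄ = p̄ /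
φ̄`. -/
theorem renewal_lconvolution_tail {p : ℝ → ℝ≥0∞} (hp : IsPosDensity p) :
    renewal p ⋆ₗ tail p = p ⋆ₗ heaviside := by
  have hm := measurable_renewal hp.measurable
  have hpm := hp.measurable
  have h1 : renewal p ⋆ₗ heaviside = renewal p ⋆ₗ tail p + renewal p ⋆ₗ (p ⋆ₗ heaviside) := by
    rw [← lconvolution_add_right hm (measurable_tail p), tail_add hp]
  have h2 : renewal p ⋆ₗ heaviside = p ⋆ₗ heaviside + renewal p ⋆ₗ (p ⋆ₗ heaviside) := by
    conv_lhs => rw [renewal_eq hpm]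
    rw [lconvolution_comm, lconvolution_add_right measurable_heaviside hpm,
      lconvolution_comm (f := heaviside) (g := p), lconvolution_comm (f := heaviside),
      lconvolution_comm (f := p) (g := renewal p),
      ← lconvolution_assoc hm hpm measurable_heaviside]
  ext x
  have h3 : (renewal p ⋆ₗ (p ⋆ₗ heaviside)) x ≠ ∞ := by
    rw [lconvolution_assoc hm hpm measurable_heaviside, lconvolution_heaviside]
    refine ((setLIntegral_Iic_le zero_le_one _ x).trans_lt ?_).ne
    rw [lLaplace_lconvolution _ hm hpm]
    exact ENNReal.mul_lt_top ENNReal.ofReal_lt_top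
      (ENNReal.mul_lt_top (lLaplace_renewal_lt_top hp one_pos)
        ((lLaplace_lt_one hp one_pos).trans ENNReal.one_lt_top))
  have := congrFun (h1.symm.trans h2) x
  exact (ENNReal.add_left_inj h3).mp this

/-- The transform of `M ⋆ φ = p ⋆ H` gives `M̄(σ) φ̄(σ) ≤ 1/σ`, and for `σ ≤ 1` the factor `φ̄(σ)`
is at least `φ̄(1) > 0`. The growth as `σ → 0` is what temperedness of `M` depends on. -/
theorem exists_lLaplace_renewal_le {p : ℝ → ℝ≥0∞} (hp : IsPosDensity p) :
    ∃ C : ℝ≥0∞, C ≠ ∞ ∧ ∀ σ, 0 < σ → σ ≤ 1 →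
      lLaplace σ (renewal p) ≤ C * ENNReal.ofReal σ⁻¹ := by
  have hm := measurable_renewal hp.measurable
  have hpm := hp.measurable
  have h0 : lLaplace 1 (tail p) ≠ 0 := by
    intro h0
    have h1 := congrArg (lLaplace 1) (tail_add hp)
    rw [lLaplace_add _ (measurable_tail p), h0, lLaplace_lconvolution _ hpm measurable_heaviside,
      lLaplace_heaviside one_pos] at h1
    simp at h1
    exact (lLaplace_lt_one hp one_pos).ne h1
  refine ⟨(lLaplace 1 (tail p))⁻¹, by simpa using h0, fun σ hσ hσ1 => ?_⟩
  have h1 := congrArg (lLaplace σ) (renewal_lconvolution_tail hp)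
  rw [lLaplace_lconvolution _ hm (measurable_tail p),
    lLaplace_lconvolution _ hpm measurable_heaviside, lLaplace_heaviside hσ] at h1
  have h2 : lLaplace 1 (tail p) ≤ lLaplace σ (tail p) := by
    refine lintegral_mono fun x => ?_
    rcases lt_or_ge x 0 with hx | hx
    · simp [causal_tail p x hx]
    · gcongr
      refine ENNReal.ofReal_le_ofReal (Real.exp_le_exp.mpr ?_)
      nlinarith
  have ht : lLaplace 1 (tail p) ≠ ∞ := by
    have : lLaplace 1 (tail p) ≤ lLaplace 1 heaviside := by
      rw [← tail_add hp, lLaplace_add _ (measurable_tail p)]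
      exact le_self_add
    rw [lLaplace_heaviside one_pos] at this
    exact (this.trans_lt ENNReal.ofReal_lt_top).ne
  rw [mul_comm, ← div_eq_mul_inv, ENNReal.le_div_iff_mul_le (Or.inl h0) (Or.inl ht)]
  calc _ ≤ lLaplace σ (renewal p) * lLaplace σ (tail p) := by gcongr
    _ ≤ 1 * ENNReal.ofReal σ⁻¹ := by
      rw [h1]; gcongr; exact (lLaplace_lt_one hp hσ).le
    _ = _ := one_mul _

/-! ### Complex Laplace transforms of nonnegative densities -/

/-- The complex Laplace transform of the measure with density `f`. -/
def cLaplace (f : ℝ → ℝ≥0∞) (s : ℂ) : ℂ := ∫ x, Complex.exp (-s * x) ∂(volume.withDensity f)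

theorem enorm_cexp (s : ℂ) (x : ℝ) : ‖Complex.exp (-s * x)‖ₑ = expWeight s.re x := by
  rw [← ofReal_norm, Complex.norm_exp, expWeight]
  simp

theorem integrable_cexp {f : ℝ → ℝ≥0∞} (hf : Measurable f) {s : ℂ} (h : lLaplace s.re f < ∞) :
    Integrable (fun x : ℝ => Complex.exp (-s * x)) (volume.withDensity f) := by
  refine ⟨by fun_prop, ?_⟩
  rw [HasFiniteIntegral, lintegral_withDensity_eq_lintegral_mul _ hf (by fun_prop)]
  refine lt_of_eq_of_lt (lintegral_congr fun x => ?_) h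
  rw [Pi.mul_apply, enorm_cexp, mul_comm]

theorem ae_lt_top_of_lLaplace {f : ℝ → ℝ≥0∞} (hf : Measurable f) {σ : ℝ}
    (h : lLaplace σ f < ∞) : ∀ᵐ x, f x < ∞ := by
  have := ae_lt_top (by have := measurable_expWeight σ; fun_prop) h.ne
  filter_upwards [this] with x hx
  by_contra h'
  rw [not_lt, top_le_iff] at h'
  rw [h', ENNReal.mul_top (expWeight_ne_zero _ _)] at hx
  exact hx.ne rfl

theorem cLaplace_lconvolution {f g : ℝ → ℝ≥0∞} (hf : Measurable f) (hg : Measurable g) {s : ℂ}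
    (h1 : lLaplace s.re f < ∞) (h2 : lLaplace s.re g < ∞) :
    cLaplace (f ⋆ₗ g) s = cLaplace f s * cLaplace g s := by
  have hi : Integrable (fun x : ℝ => Complex.exp (-s * x)) (volume.withDensity (f ⋆ₗ g)) :=
    integrable_cexp (measurable_lconvolution _ hf hg) (by
      rw [lLaplace_lconvolution _ hf hg]; exact ENNReal.mul_lt_top h1 h2)
  rw [cLaplace, ← conv_withDensity_eq_lconvolution hf hg] at *
  rw [integral_conv hi, cLaplace, cLaplace, ← integral_mul_const]
  congr 1
  ext x
  rw [← integral_const_mul]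
  congr 1
  ext y
  rw [← Complex.exp_add]
  push_cast
  ring_nf

theorem cLaplace_add {f g : ℝ → ℝ≥0∞} (hf : Measurable f) (hg : Measurable g) {s : ℂ}
    (h1 : lLaplace s.re f < ∞) (h2 : lLaplace s.re g < ∞) :
    cLaplace (f + g) s = cLaplace f s + cLaplace g s := by
  rw [cLaplace, withDensity_add_left hf, integral_add_measure (integrable_cexp hf h1)
    (integrable_cexp hg h2)]
  rfl

theorem cLaplace_eq_setIntegral {f : ℝ → ℝ≥0∞} (hf : Measurable f) (hc : Causal f) {s : ℂ}
    (h : lLaplace s.re f < ∞) :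
    cLaplace f s = ∫ x in Ioi (0 : ℝ), Complex.exp (-s * x) * ((f x).toReal : ℂ) := by
  rw [cLaplace, integral_withDensity_eq_integral_toReal_smul hf (ae_lt_top_of_lLaplace hf h),
    setIntegral_congr_set Ioi_ae_eq_Ici, setIntegral_eq_integral_of_forall_compl_eq_zero]
  · congr 1
    ext x
    rw [Complex.real_smul, mul_comm]
  · intro x hx
    rw [hc x (by simpa using hx)]
    simp

theorem cLaplace_heaviside {s : ℂ} (hs : 0 < s.re) : cLaplace heaviside s = 1 / s := by
  rw [cLaplace_eq_setIntegral measurable_heaviside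
    (fun x hx => indicator_of_notMem (by simpa using hx) _)
    (by rw [lLaplace_heaviside hs]; exact ENNReal.ofReal_lt_top)]
  have : ∫ x in Ioi (0 : ℝ), Complex.exp (-s * x) * ((heaviside x).toReal : ℂ) =
      ∫ x in Ioi (0 : ℝ), Complex.exp (-s * x) := by
    refine setIntegral_congr_fun measurableSet_Ioi fun x hx => ?_
    have hx' : x ∈ Ici (0 : ℝ) := mem_Ici.mpr (le_of_lt hx)
    simp [heaviside, indicator_of_mem hx']
  rw [this, integral_exp_mul_complex_Ioi (by simpa using hs)]
  simp [neg_div_neg_eq]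

/-! ### Representing waiting time densities -/

/-- `p` is a measurable version of the waiting time density `ψ`. -/
structure Represents (ψ : ℝ → ℝ) (p : ℝ → ℝ≥0∞) : Prop extends IsPosDensity p where
  ae_eq : ∀ᵐ t ∂(volume.restrict (Ioi (0 : ℝ))), p t = ENNReal.ofReal (ψ t)
  ae_eq_toReal : ∀ᵐ t ∂(volume.restrict (Ioi (0 : ℝ))), ψ t = (p t).toReal

theorem IsWaitingDensity.exists_represents {ψ : ℝ → ℝ} (h : IsWaitingDensity ψ) :
    ∃ p, Represents ψ p := by
  have hm := h.integrable.aestronglyMeasurable.aemeasurable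
  have hnn : ∀ᵐ t ∂(volume.restrict (Ioi (0 : ℝ))), 0 ≤ ψ t :=
    (ae_restrict_mem measurableSet_Ioi).mono fun t ht => h.nonneg t ht
  have hae : ∀ᵐ t ∂(volume.restrict (Ioi (0 : ℝ))),
      indicator (Ioi 0) (fun t => ENNReal.ofReal (hm.mk ψ t)) t = ENNReal.ofReal (ψ t) := by
    filter_upwards [hm.ae_eq_mk, ae_restrict_mem measurableSet_Ioi] with t ht ht0
    rw [indicator_of_mem ht0, ht]
  refine ⟨indicator (Ioi 0) fun t => ENNReal.ofReal (hm.mk ψ t), ⟨?_, ?_, ?_⟩, hae, ?_⟩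
  · exact (ENNReal.measurable_ofReal.comp hm.measurable_mk).indicator measurableSet_Ioi
  · exact fun x hx => indicator_of_notMem (by simpa using hx) _
  · have h1 := ofReal_integral_eq_lintegral_ofReal h.integrable hnn
    rw [h.integral_eq_one, ENNReal.ofReal_one, ← lintegral_congr_ae hae] at h1
    rw [h1, setLIntegral_indicator measurableSet_Ioi, inter_self,
      lintegral_indicator measurableSet_Ioi]
  · filter_upwards [hae, hnn] with t ht h0
    rw [ht, ENNReal.toReal_ofReal h0]

theorem Represents.survival_eq {ψ : ℝ → ℝ} {p : ℝ → ℝ≥0∞} (hp : Represents ψ p) {t : ℝ}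
    (ht : 0 ≤ t) : survival ψ t = (tail p t).toReal := by
  have h1 := congrFun (tail_add hp.toIsPosDensity) t
  rw [Pi.add_apply, lconvolution_heaviside, heaviside, indicator_of_mem (by simpa using ht),
    Pi.one_apply] at h1
  have hfin : ∫⁻ s in Iic t, p s ≠ ∞ := by
    intro h; rw [h] at h1; simp at h1
  have hfin' : tail p t ≠ ∞ := by
    intro h; rw [h] at h1; simp at h1
  have h2 := congrArg ENNReal.toReal h1
  rw [ENNReal.toReal_add hfin' hfin, ENNReal.toReal_one] at h2
  have h3 : ∫ r in (0 : ℝ)..t, ψ r = (∫⁻ s in Iic t, p s).toReal := by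
    rw [intervalIntegral.integral_of_le ht]
    have e1 : ∫ r in Ioc 0 t, ψ r = ∫ r in Ioc 0 t, (p r).toReal :=
      integral_congr_ae (ae_restrict_of_ae_restrict_of_subset Ioc_subset_Ioi_self hp.ae_eq_toReal)
    rw [e1, integral_toReal hp.measurable.aemeasurable]
    · congr 1
      rw [← lintegral_indicator measurableSet_Ioc, ← lintegral_indicator measurableSet_Iic]
      congr 1
      ext x
      by_cases hx : 0 < x
      · by_cases hxt : x ≤ t <;> simp [indicator, hx, hxt]
      · simp [indicator, hp.zero x (not_lt.mp hx)]
    · have : ∀ᵐ x, p x < ∞ := ae_lt_top hp.measurable (by simp [hp.lintegral])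
      exact ae_restrict_of_ae this
  rw [survival, h3]
  linarith

theorem Represents.laplace_eq {ψ : ℝ → ℝ} {p : ℝ → ℝ≥0∞} (hp : Represents ψ p) {s : ℂ}
    (hs : 0 < s.re) : laplace ψ s = cLaplace p s := by
  rw [cLaplace_eq_setIntegral hp.measurable hp.causal
    ((lLaplace_lt_one hp.toIsPosDensity hs).trans ENNReal.one_lt_top), laplace]
  refine integral_congr_ae ?_
  filter_upwards [hp.ae_eq_toReal] with t ht
  rw [ht]

theorem lLaplace_tail_lt_top {p : ℝ → ℝ≥0∞} (hp : IsPosDensity p) {σ : ℝ} (hσ : 0 < σ) :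
    lLaplace σ (tail p) < ∞ := by
  have : lLaplace σ (tail p) ≤ lLaplace σ heaviside := by
    rw [← tail_add hp, lLaplace_add _ (measurable_tail p)]
    exact le_self_add
  rw [lLaplace_heaviside hσ] at this
  exact this.trans_lt ENNReal.ofReal_lt_top

theorem Represents.laplace_survival_eq {ψ : ℝ → ℝ} {p : ℝ → ℝ≥0∞} (hp : Represents ψ p) {s : ℂ}
    (hs : 0 < s.re) : laplace (survival ψ) s = cLaplace (tail p) s := by
  rw [cLaplace_eq_setIntegral (measurable_tail p) (causal_tail p)
    (lLaplace_tail_lt_top hp.toIsPosDensity hs), laplace]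
  refine setIntegral_congr_fun measurableSet_Ioi fun t ht => ?_
  rw [hp.survival_eq (le_of_lt ht)]

/-! ### Existence of the memory kernel -/

/-- The renewal measure. -/
def renewalMeasure (p : ℝ → ℝ≥0∞) : Measure ℝ := volume.withDensity (renewal p)

/-- Take `k = ⌊x⌋`: then `x / (k + 1) ≤ 1`, and the factor `e` makes up for the exponential. A
polynomial weight is thus dominated by Laplace weights at the parameters `σ = 1/(k+1)`. -/
theorem exp_neg_div_le {x : ℝ} (hx : 0 ≤ x) :
    ∃ k : ℕ, (1 + x) ^ (-3 : ℝ) ≤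
      Real.exp 1 * (((k : ℝ) + 1) ^ (-3 : ℝ) * Real.exp (-(1 / ((k : ℝ) + 1)) * x)) := by
  refine ⟨⌊x⌋₊, ?_⟩
  have h1 := Nat.floor_le hx
  have h2 := Nat.lt_floor_add_one x
  have hk : (0 : ℝ) < (⌊x⌋₊ : ℝ) + 1 := by positivity
  calc (1 + x) ^ (-3 : ℝ) ≤ ((⌊x⌋₊ : ℝ) + 1) ^ (-3 : ℝ) :=
        Real.rpow_le_rpow_of_nonpos hk (by linarith) (by norm_num)
    _ = ((⌊x⌋₊ : ℝ) + 1) ^ (-3 : ℝ) * 1 := (mul_one _).symm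
    _ ≤ ((⌊x⌋₊ : ℝ) + 1) ^ (-3 : ℝ) * Real.exp (1 + -(1 / ((⌊x⌋₊ : ℝ) + 1)) * x) := by
        gcongr
        refine Real.one_le_exp ?_
        have : 1 / ((⌊x⌋₊ : ℝ) + 1) * x ≤ 1 := by
          rw [one_div_mul_eq_div, div_le_one hk]; linarith
        linarith
    _ = _ := by rw [Real.exp_add]; ring

/-- Under the weight `(1 + x)^{-3}` the `k`-th Laplace weight contributes at most a constant times
`(k+1)^{-3} · (k+1)`, where `k + 1` is the bound `1/σ`. The exponent `3` leaves the summable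
`(k+1)^{-2}`. -/
theorem hasTemperateGrowth_renewalMeasure {p : ℝ → ℝ≥0∞} (hp : IsPosDensity p) :
    (renewalMeasure p).HasTemperateGrowth := by
  have hm := measurable_renewal hp.measurable
  refine ⟨3, ?_, ?_⟩
  · refine (Continuous.rpow_const (by fun_prop) fun x => Or.inl ?_).aestronglyMeasurable
    positivity
  rw [HasFiniteIntegral, renewalMeasure, lintegral_withDensity_eq_lintegral_mul _ hm
    (by fun_prop)]
  obtain ⟨C, hC, hC'⟩ := exists_lLaplace_renewal_le hp
  let w : ℕ → ℝ → ℝ≥0∞ := fun k x => ENNReal.ofReal (Real.exp 1) *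
    (ENNReal.ofReal (((k : ℝ) + 1) ^ (-3 : ℝ)) * (expWeight (1 / ((k : ℝ) + 1)) x * renewal p x))
  have hle : ∀ x, renewal p x * ‖(1 + ‖x‖) ^ (-((3 : ℕ) : ℝ))‖ₑ ≤ ∑' k, w k x := by
    intro x
    rcases lt_or_ge x 0 with hx | hx
    · simp [causal_renewal hp.causal x hx]
    · obtain ⟨k, hk⟩ := exp_neg_div_le hx
      refine le_trans ?_ (ENNReal.le_tsum k)
      rw [mul_comm]
      simp only [w]
      rw [← mul_assoc, ← mul_assoc]
      gcongr
      rw [Real.norm_eq_abs, abs_of_nonneg hx, expWeight, ← ENNReal.ofReal_mul (by positivity),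
        ← ENNReal.ofReal_mul (by positivity), Real.enorm_of_nonneg (by positivity), mul_assoc]
      exact ENNReal.ofReal_le_ofReal (by exact_mod_cast hk)
  have hw : ∀ k, ∫⁻ x, w k x ≤ ENNReal.ofReal (Real.exp 1) *
      (C * ENNReal.ofReal (((k : ℝ) + 1) ^ (-2 : ℝ))) := by
    intro k
    have hmw : Measurable fun x => expWeight (1 / ((k : ℝ) + 1)) x * renewal p x := by
      have := measurable_expWeight (1 / ((k : ℝ) + 1)); fun_prop
    simp only [w]
    rw [lintegral_const_mul _ (by fun_prop), lintegral_const_mul _ (by fun_prop)]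
    refine mul_le_mul_right ?_ _
    have hk : (0 : ℝ) < (k : ℝ) + 1 := by positivity
    calc _ ≤ ENNReal.ofReal (((k : ℝ) + 1) ^ (-3 : ℝ)) *
          (C * ENNReal.ofReal (1 / ((k : ℝ) + 1))⁻¹) := by
          refine mul_le_mul_right ?_ _
          exact hC' _ (by positivity) (by rw [div_le_one hk]; linarith [k.cast_nonneg (α := ℝ)])
      _ = _ := by
          rw [mul_left_comm, ← ENNReal.ofReal_mul (by positivity)]
          congr 2
          rw [one_div, inv_inv, show (-2 : ℝ) = -3 + 1 by norm_num, Real.rpow_add hk,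
            Real.rpow_one]
  calc _ ≤ ∫⁻ x, ∑' k, w k x := lintegral_mono fun x => hle x
    _ = ∑' k, ∫⁻ x, w k x := lintegral_tsum fun k => by
        have := measurable_expWeight (1 / ((k : ℝ) + 1)); fun_prop
    _ ≤ ∑' k : ℕ, ENNReal.ofReal (Real.exp 1) *
        (C * ENNReal.ofReal (((k : ℝ) + 1) ^ (-2 : ℝ))) := ENNReal.tsum_le_tsum hw
    _ < ∞ := by
        rw [ENNReal.tsum_mul_left, ENNReal.tsum_mul_left]
        refine ENNReal.mul_lt_top ENNReal.ofReal_lt_top (ENNReal.mul_lt_top hC.lt_top ?_)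
        rw [← ENNReal.ofReal_tsum_of_nonneg (fun k => by positivity)]
        · exact ENNReal.ofReal_lt_top
        · have := (summable_nat_add_iff 1).mpr (Real.summable_nat_rpow.mpr
            (show (-2 : ℝ) < -1 by norm_num))
          exact_mod_cast this

/-- The distributional derivative of the renewal measure. -/
def renewalKernel (p : ℝ → ℝ≥0∞) (hp : IsPosDensity p) : 𝓢'(ℝ, ℂ) :=
  haveI := hasTemperateGrowth_renewalMeasure hp
  TemperedDistribution.derivCLM ℂ (renewalMeasure p).toTemperedDistribution

theorem renewalKernel_apply {p : ℝ → ℝ≥0∞} (hp : IsPosDensity p) (θ : 𝓢(ℝ, ℂ)) :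
    renewalKernel p hp θ = ∫ x, -deriv θ x ∂(renewalMeasure p) := rfl

theorem ae_renewalMeasure_pos {p : ℝ → ℝ≥0∞} (hp : IsPosDensity p) :
    ∀ᵐ x ∂(renewalMeasure p), 0 < x := by
  rw [renewalMeasure, ae_withDensity_iff (measurable_renewal hp.measurable)]
  have : ∀ᵐ x : ℝ, x ≠ 0 := by simp [ae_iff]
  filter_upwards [this] with x hx0 hx
  by_contra h
  exact hx (causal_renewal hp.causal x (lt_of_le_of_ne (not_lt.mp h) hx0))

/-- The transform of `M ⋆ φ = p ⋆ H` reads `M̄ φ̄ = p̄ / s`, and the derivative of `M` has transform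
`s M̄`. Causality holds because `M` is carried by `(0, ∞)`. -/
theorem Represents.isMemoryKernel {ψ : ℝ → ℝ} {p : ℝ → ℝ≥0∞} (hp : Represents ψ p) :
    IsMemoryKernel ψ (renewalKernel p hp.toIsPosDensity) := by
  have hp' := hp.toIsPosDensity
  have hpm := hp.measurable
  refine ⟨fun θ hθ => ?_, fun s hs θ hθ => ?_⟩
  · rw [renewalKernel_apply]
    refine integral_eq_zero_of_ae ?_
    filter_upwards [ae_renewalMeasure_pos hp'] with x hx
    have : x ∉ tsupport (deriv θ) := fun h => by
      have := hθ (tsupport_deriv_subset h)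
      exact absurd (mem_Iio.mp this) (not_lt.mpr hx.le)
    simp [image_eq_zero_of_notMem_tsupport this]
  · have hs0 : s ≠ 0 := by rintro rfl; simp at hs
    have hMl := lLaplace_renewal_lt_top hp' hs
    have hPl : lLaplace s.re p < ∞ := (lLaplace_lt_one hp' hs).trans ENNReal.one_lt_top
    have hTl := lLaplace_tail_lt_top hp' hs
    have hHl : lLaplace s.re heaviside < ∞ := by
      rw [lLaplace_heaviside hs]; exact ENNReal.ofReal_lt_top
    -- On `(0, ∞)`, which carries the renewal measure, `-θ'(x) = s e^{-sx}`.
    have h1 : renewalKernel p hp' θ = s * cLaplace (renewal p) s := by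
      rw [renewalKernel_apply, cLaplace, ← integral_const_mul]
      refine integral_congr_ae ?_
      filter_upwards [ae_renewalMeasure_pos hp'] with x hx
      have he : θ =ᶠ[𝓝 x] fun x : ℝ => Complex.exp (-s * x) := by
        filter_upwards [Ioi_mem_nhds hx] with y hy using hθ y (le_of_lt hy)
      have hd : HasDerivAt (fun x : ℝ => Complex.exp (-s * x))
          (Complex.exp (-s * x) * (-s * 1)) x :=
        ((hasDerivAt_id (x : ℂ)).const_mul (-s)).cexp.comp_ofReal
      rw [he.deriv_eq, hd.deriv]
      ring
    have h2 : cLaplace (renewal p) s * cLaplace (tail p) s = cLaplace p s * (1 / s) := by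
      rw [← cLaplace_lconvolution (measurable_renewal hpm) (measurable_tail p) hMl hTl,
        renewal_lconvolution_tail hp', cLaplace_lconvolution hpm measurable_heaviside hPl hHl,
        cLaplace_heaviside hs]
    have h3 : cLaplace (tail p) s + cLaplace p s * (1 / s) = 1 / s := by
      rw [← cLaplace_heaviside hs, ← cLaplace_lconvolution hpm measurable_heaviside hPl hHl,
        ← cLaplace_add (measurable_tail p) (measurable_lconvolution _ hpm measurable_heaviside)
          hTl (by rw [lLaplace_lconvolution _ hpm measurable_heaviside]
                  exact ENNReal.mul_lt_top hPl hHl), tail_add hp']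
    -- If `φ̄(s) = 0`, then `h2` gives `p̄ / s = 0`, while `h3` gives `p̄ / s = 1 / s`.
    have h4 : cLaplace (tail p) s ≠ 0 := by
      intro h0
      rw [h0, mul_zero] at h2
      rw [h0, ← h2, zero_add] at h3
      exact one_div_ne_zero hs0 h3.symm
    rw [hp.laplace_eq hs, hp.laplace_survival_eq hs, h1, eq_div_iff h4, mul_assoc, h2]
    field_simp

theorem IsWaitingDensity.existsUnique_isMemoryKernel {ψ : ℝ → ℝ} (h : IsWaitingDensity ψ) :
    ∃! K : 𝓢'(ℝ, ℂ), IsMemoryKernel ψ K := by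
  obtain ⟨p, hp⟩ := h.exists_represents
  exact ⟨_, hp.isMemoryKernel, fun K hK => HasLaplaceTransform.unique hK hp.isMemoryKernel⟩

/-! ### Locally integrable causal densities -/

/-- A measurable causal density with finite mass on bounded intervals. -/
structure IsLocDensity (f : ℝ → ℝ≥0∞) : Prop where
  measurable : Measurable f
  causal : Causal f
  lintegral_lt_top : ∀ T : ℝ, ∫⁻ x in Iic T, f x < ∞

theorem isLocDensity_of_lLaplace {f : ℝ → ℝ≥0∞} (hf : Measurable f) (hc : Causal f)
    (h : lLaplace 1 f < ∞) : IsLocDensity f :=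
  ⟨hf, hc, fun T => (setLIntegral_Iic_le zero_le_one f T).trans_lt
    (ENNReal.mul_lt_top ENNReal.ofReal_lt_top h)⟩

theorem causal_heaviside : Causal heaviside :=
  fun _ hx => indicator_of_notMem (by simpa using hx) _

theorem isLocDensity_heaviside : IsLocDensity heaviside :=
  isLocDensity_of_lLaplace measurable_heaviside causal_heaviside
    (by rw [lLaplace_heaviside one_pos]; exact ENNReal.ofReal_lt_top)

theorem IsPosDensity.isLocDensity {p : ℝ → ℝ≥0∞} (hp : IsPosDensity p) : IsLocDensity p :=
  isLocDensity_of_lLaplace hp.measurable hp.causal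
    ((lLaplace_lt_one hp one_pos).trans ENNReal.one_lt_top)

theorem IsPosDensity.isLocDensity_renewal {p : ℝ → ℝ≥0∞} (hp : IsPosDensity p) :
    IsLocDensity (renewal p) :=
  isLocDensity_of_lLaplace (measurable_renewal hp.measurable) (causal_renewal hp.causal)
    (lLaplace_renewal_lt_top hp one_pos)

theorem IsPosDensity.isLocDensity_tail {p : ℝ → ℝ≥0∞} (hp : IsPosDensity p) :
    IsLocDensity (tail p) :=
  isLocDensity_of_lLaplace (measurable_tail p) (causal_tail p) (lLaplace_tail_lt_top hp one_pos)

theorem lintegral_lconvolution {f g : ℝ → ℝ≥0∞} (hf : Measurable f) (hg : Measurable g) :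
    ∫⁻ x, (f ⋆ₗ g) x = (∫⁻ x, f x) * ∫⁻ x, g x := by
  simpa [lLaplace, expWeight] using lLaplace_lconvolution 0 hf hg

/-- Up to time `T` the convolution of causal functions sees both factors only up to `T`. Local
finiteness of a convolution thereby reduces to the product formula for total masses. -/
theorem indicator_lconvolution_le' {f g : ℝ → ℝ≥0∞} (hf : Causal f) (hg : Causal g) (T : ℝ) :
    indicator (Iic T) (f ⋆ₗ g) ≤ indicator (Iic T) f ⋆ₗ indicator (Iic T) g := by
  have h1 := indicator_lconvolution_le (f := g) hf T
  have hg' : Causal (indicator (Iic T) g) := fun x hx =>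
    le_antisymm ((indicator_le_self _ _ _).trans (hg x hx).le) (zero_le)
  have h2 := indicator_lconvolution_le (p := indicator (Iic T) g) (f := f) hg' T
  rw [lconvolution_comm (f := indicator (Iic T) f)]
  refine le_trans ?_ h2
  rw [lconvolution_comm (g := f)]
  intro x
  by_cases hx : x ∈ Iic T
  · rw [indicator_of_mem hx]
    simpa [indicator_of_mem hx] using h1 x
  · simp [indicator_of_notMem hx]

theorem IsLocDensity.lconvolution {f g : ℝ → ℝ≥0∞} (hf : IsLocDensity f) (hg : IsLocDensity g) :
    IsLocDensity (f ⋆ₗ g) := by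
  refine ⟨measurable_lconvolution _ hf.measurable hg.measurable,
    causal_lconvolution hf.causal hg.causal, fun T => ?_⟩
  rw [← lintegral_indicator measurableSet_Iic]
  refine (lintegral_mono (indicator_lconvolution_le' hf.causal hg.causal T)).trans_lt ?_
  rw [lintegral_lconvolution (hf.measurable.indicator measurableSet_Iic)
    (hg.measurable.indicator measurableSet_Iic), lintegral_indicator measurableSet_Iic,
    lintegral_indicator measurableSet_Iic]
  exact ENNReal.mul_lt_top (hf.lintegral_lt_top T) (hg.lintegral_lt_top T)

theorem IsLocDensity.ae_lt_top {f : ℝ → ℝ≥0∞} (hf : IsLocDensity f) : ∀ᵐ x, f x < ∞ := by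
  have h : ∀ n : ℕ, ∀ᵐ x, x ∈ Iic (n : ℝ) → f x < ∞ := fun n => by
    rw [← ae_restrict_iff' measurableSet_Iic]
    exact MeasureTheory.ae_lt_top hf.measurable (hf.lintegral_lt_top n).ne
  filter_upwards [ae_all_iff.mpr h] with x hx
  obtain ⟨n, hn⟩ := exists_nat_ge x
  exact hx n hn

theorem IsLocDensity.integrable {f : ℝ → ℝ≥0∞} (hf : IsLocDensity f) {θ : ℝ → ℂ}
    (hc : Continuous θ) {M : ℝ} (hM : ∀ x, M < x → θ x = 0) :
    Integrable θ (volume.withDensity f) := by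
  obtain ⟨C, hC⟩ := (isCompact_Icc (a := (0 : ℝ)) (b := M)).exists_bound_of_continuousOn
    hc.continuousOn
  refine ⟨hc.aestronglyMeasurable, ?_⟩
  rw [HasFiniteIntegral, lintegral_withDensity_eq_lintegral_mul _ hf.measurable
    hc.enorm.measurable]
  have hle : ∀ x, (f * fun x => ‖θ x‖ₑ) x ≤ indicator (Iic M) f x * ENNReal.ofReal C := by
    intro x
    rw [Pi.mul_apply]
    by_cases hx : x ≤ M
    · rw [indicator_of_mem (by simpa using hx)]
      rcases lt_or_ge x 0 with h0 | h0
      · simp [hf.causal x h0]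
      · gcongr
        rw [← ofReal_norm]
        exact ENNReal.ofReal_le_ofReal (hC x ⟨h0, hx⟩)
    · simp [hM x (not_le.mp hx)]
  refine (lintegral_mono hle).trans_lt ?_
  rw [lintegral_mul_const _ (hf.measurable.indicator measurableSet_Iic),
    lintegral_indicator measurableSet_Iic]
  exact ENNReal.mul_lt_top (hf.lintegral_lt_top M) ENNReal.ofReal_lt_top

theorem IsLocDensity.integral_eq {f : ℝ → ℝ≥0∞} (hf : IsLocDensity f) (θ : ℝ → ℂ) :
    ∫ x, θ x ∂(volume.withDensity f) = ∫ x in Ioi (0 : ℝ), ((f x).toReal : ℂ) * θ x := by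
  rw [integral_withDensity_eq_integral_toReal_smul hf.measurable hf.ae_lt_top,
    setIntegral_congr_set Ioi_ae_eq_Ici, setIntegral_eq_integral_of_forall_compl_eq_zero]
  · simp
  · intro x hx
    rw [hf.causal x (by simpa using hx)]
    simp

theorem IsLocDensity.integrableOn_toReal {f : ℝ → ℝ≥0∞} (hf : IsLocDensity f) (T : ℝ) :
    IntegrableOn (fun x => (f x).toReal) (Iic T) :=
  integrable_toReal_of_lintegral_ne_top hf.measurable.aemeasurable (hf.lintegral_lt_top T).ne

theorem IsLocDensity.locallyIntegrable_toReal {f : ℝ → ℝ≥0∞} (hf : IsLocDensity f) :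
    LocallyIntegrable (fun x => (f x).toReal) := fun x =>
  ⟨Iic (x + 1), Iic_mem_nhds (by linarith), hf.integrableOn_toReal _⟩

/-! ### The memory kernel as a convolution operator -/

theorem integral_heaviside_deriv {θ : 𝓢(ℝ, ℂ)} (t : ℝ) :
    ∫ x, deriv θ (t + x) ∂(volume.withDensity heaviside) = -θ t := by
  rw [isLocDensity_heaviside.integral_eq]
  have h1 : ∫ x in Ioi (0 : ℝ), ((heaviside x).toReal : ℂ) * deriv θ (t + x) =
      ∫ x in Ioi (0 : ℝ), deriv θ (t + x) := by
    refine setIntegral_congr_fun measurableSet_Ioi fun x hx => ?_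
    have hx' : x ∈ Ici (0 : ℝ) := mem_Ici.mpr (le_of_lt hx)
    simp [heaviside, indicator_of_mem hx']
  rw [h1]
  have h2 : ∀ x ∈ Ici (0 : ℝ), HasDerivAt (fun x => θ (t + x)) (deriv θ (t + x)) x := fun x _ => by
    simpa using (θ.hasDerivAt (t + x)).comp_const_add t x
  have h3 : IntegrableOn (fun x => deriv θ (t + x)) (Ioi 0) :=
    ((SchwartzMap.derivCLM ℝ ℂ θ).integrable.comp_add_left t).integrableOn
  have h4 : Tendsto (fun x => θ (t + x)) atTop (𝓝 0) :=
    (θ.tendsto_cocompact.mono_left atTop_le_cocompact).comp (tendsto_atTop_add_const_left _ t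
      tendsto_id)
  rw [integral_Ioi_of_hasDerivAt_of_tendsto' h2 h3 h4]
  simp

/-- Differentiation under the integral sign. For positive arguments the points `t > M` contribute
nothing, so a constant on `(-∞, M]` dominates. Positive `x` suffice, since the renewal measure
charges only those. -/
theorem deriv_integral_translate {f : ℝ → ℝ≥0∞} (hf : IsLocDensity f) {θ : 𝓢(ℝ, ℂ)} {M : ℝ}
    (hM : ∀ x, M < x → θ x = 0) {x : ℝ} (hx : 0 < x) :
    HasDerivAt (fun x => ∫ t, θ (x + t) ∂(volume.withDensity f))
      (∫ t, deriv θ (x + t) ∂(volume.withDensity f)) x := by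
  have hM' : ∀ x, M < x → deriv θ x = 0 := fun x hx => by
    have : θ =ᶠ[𝓝 x] fun _ => 0 := by
      filter_upwards [Ioi_mem_nhds hx] with y hy using hM y hy
    rw [this.deriv_eq]; simp
  have hdc : Continuous (deriv θ) := (SchwartzMap.derivCLM ℝ ℂ θ).continuous
  let C : ℝ := SchwartzMap.seminorm ℝ 0 0 (SchwartzMap.derivCLM ℝ ℂ θ)
  have hC : ∀ y, ‖deriv θ y‖ ≤ C := fun y =>
    SchwartzMap.norm_le_seminorm ℝ (SchwartzMap.derivCLM ℝ ℂ θ) y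
  have hb : Integrable (indicator (Iic M) fun _ => C) (volume.withDensity f) := by
    refine (integrable_indicator_iff measurableSet_Iic).mpr (integrableOn_const ?_)
    rw [withDensity_apply _ measurableSet_Iic]
    exact (hf.lintegral_lt_top M).ne
  refine (hasDerivAt_integral_of_dominated_loc_of_deriv_le (Ioi_mem_nhds hx)
    (bound := indicator (Iic M) fun _ => C) (F := fun x t => θ (x + t)) (F' := fun x t => deriv θ (x + t)) ?_ ?_ ?_ ?_ hb ?_).2
  · exact Eventually.of_forall fun y =>
      (θ.continuous.comp (continuous_const.add continuous_id)).aestronglyMeasurable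
  · exact hf.integrable (M := M - x) (θ.continuous.comp (continuous_const.add continuous_id))
      fun y hy => hM _ (by linarith)
  · exact (hdc.comp (continuous_const.add continuous_id)).aestronglyMeasurable
  · rw [ae_withDensity_iff hf.measurable]
    refine ae_of_all _ fun t ht y hy => ?_
    have hy0 : 0 < y := hy
    by_cases htM : t ≤ M
    · rw [indicator_of_mem (by simpa using htM)]; exact hC _
    · rw [hM' _ (by linarith), norm_zero, indicator_of_notMem (by simpa using htM)]
  · refine ae_of_all _ fun t y _ => ?_
    simpa using (θ.hasDerivAt (y + t)).comp_add_const y t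

theorem renewal_lconvolution_tail_lconvolution {p J : ℝ → ℝ≥0∞} (hp : IsPosDensity p)
    (hJ : Measurable J) : renewal p ⋆ₗ (tail p ⋆ₗ J) = (p ⋆ₗ J) ⋆ₗ heaviside := by
  rw [lconvolution_assoc (measurable_renewal hp.measurable) (measurable_tail p) hJ,
    renewal_lconvolution_tail hp, ← lconvolution_assoc hp.measurable measurable_heaviside hJ,
    lconvolution_comm (f := heaviside), lconvolution_assoc hp.measurable hJ measurable_heaviside]

/-- Put the derivative on the test function: the left side is `-∫ θ'` against `M ⋆ φ ⋆ J`, which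
equals `(p ⋆ J) ⋆ H`. Integrating `θ'` against the translates of `H` gives `-θ` back and leaves `p ⋆
J`. -/
theorem renewalKernel_apply_convolution {p J : ℝ → ℝ≥0∞} (hp : IsPosDensity p)
    (hJ : IsLocDensity J) {θ Θ : 𝓢(ℝ, ℂ)} (hθ : HasCompactSupport θ)
    (hΘ : ∀ x : ℝ, 0 ≤ x → Θ x = ∫ t, θ (x + t) ∂(volume.withDensity (tail p ⋆ₗ J))) :
    renewalKernel p hp Θ = ∫ t, θ t ∂(volume.withDensity (p ⋆ₗ J)) := by
  obtain ⟨M, hM⟩ : ∃ M, ∀ x, M < x → θ x = 0 := by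
    obtain ⟨M, hM⟩ := hθ.isCompact.isBounded.exists_norm_le
    refine ⟨M, fun x hx => ?_⟩
    by_contra hne
    have := hM x (subset_tsupport _ hne)
    rw [Real.norm_eq_abs] at this
    linarith [le_abs_self x]
  have hM' : ∀ x, M < x → deriv θ x = 0 := fun x hx => by
    have : θ =ᶠ[𝓝 x] fun _ => 0 := by
      filter_upwards [Ioi_mem_nhds hx] with y hy using hM y hy
    rw [this.deriv_eq]; simp
  have hdc : Continuous (deriv θ) := (SchwartzMap.derivCLM ℝ ℂ θ).continuous
  have hU := hp.isLocDensity_tail.lconvolution hJ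
  have hI := hp.isLocDensity.lconvolution hJ
  have hR := hp.isLocDensity_renewal
  have e1 : renewalKernel p hp Θ =
      ∫ x, -∫ t, deriv θ (x + t) ∂(volume.withDensity (tail p ⋆ₗ J)) ∂(renewalMeasure p) := by
    rw [renewalKernel_apply]
    refine integral_congr_ae ?_
    filter_upwards [ae_renewalMeasure_pos hp] with x hx
    have : Θ =ᶠ[𝓝 x] fun x => ∫ t, θ (x + t) ∂(volume.withDensity (tail p ⋆ₗ J)) := by
      filter_upwards [Ioi_mem_nhds hx] with y hy using hΘ y (le_of_lt hy)
    rw [this.deriv_eq, (deriv_integral_translate hU hM hx).deriv]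
  have hi1 := (hR.lconvolution hU).integrable hdc hM'
  have hi2 := (hI.lconvolution isLocDensity_heaviside).integrable hdc hM'
  rw [← conv_withDensity_eq_lconvolution hR.measurable hU.measurable] at hi1
  have e2 := integral_conv hi1
  rw [conv_withDensity_eq_lconvolution hR.measurable hU.measurable,
    renewal_lconvolution_tail_lconvolution hp hJ.measurable] at e2
  rw [← conv_withDensity_eq_lconvolution hI.measurable measurable_heaviside] at hi2
  have e3 := integral_conv hi2
  rw [conv_withDensity_eq_lconvolution hI.measurable measurable_heaviside] at e3
  rw [e1, integral_neg, renewalMeasure, ← e2, e3]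
  simp only [integral_heaviside_deriv]
  rw [integral_neg, neg_neg]

/-- By uniqueness `K` is the renewal kernel, so the identity `K * (φ ⋆ J) = p ⋆ J` applies. -/
theorem Represents.isCausalConvolution {ψ : ℝ → ℝ} {p J : ℝ → ℝ≥0∞} (hp : Represents ψ p)
    (hJ : IsLocDensity J) {K : 𝓢'(ℝ, ℂ)} (hK : IsMemoryKernel ψ K) {f g : ℝ → ℝ}
    (hf : ∀ t, 0 ≤ t → f t = ((tail p ⋆ₗ J) t).toReal)
    (hg : ∀ t, 0 ≤ t → g t = ((p ⋆ₗ J) t).toReal) : IsCausalConvolution K f g := by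
  have hp' := hp.toIsPosDensity
  have hU := hp'.isLocDensity_tail.lconvolution hJ
  have hI := hp'.isLocDensity.lconvolution hJ
  obtain rfl := HasLaplaceTransform.unique hK hp.isMemoryKernel
  refine ⟨?_, fun θ hθ Θ hΘ => ?_⟩
  · have h1 : LocallyIntegrableOn (fun t => ((p ⋆ₗ J) t).toReal) (Ici 0) :=
      hI.locallyIntegrable_toReal.locallyIntegrableOn _
    intro x hx
    obtain ⟨s, hs, hs'⟩ := h1 x hx
    refine ⟨s ∩ Ici 0, inter_mem hs self_mem_nhdsWithin, ?_⟩
    have : IntegrableOn (fun t => ((p ⋆ₗ J) t).toReal) (s ∩ Ici 0) :=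
      hs'.mono_set inter_subset_left
    refine this.congr_fun_ae ?_
    refine ae_restrict_of_ae_restrict_of_subset inter_subset_right ?_
    filter_upwards [ae_restrict_mem measurableSet_Ici] with t ht
    rw [hg t ht]
  · rw [renewalKernel_apply_convolution hp' hJ hθ, hI.integral_eq]
    · refine setIntegral_congr_fun measurableSet_Ioi fun t ht => ?_
      simp only [hg t (le_of_lt ht)]
    · intro x hx
      rw [hΘ x hx, hU.integral_eq]
      refine setIntegral_congr_fun measurableSet_Ioi fun t ht => ?_
      simp only [hf t (le_of_lt ht)]

section

/-! ### Flux of arriving particles -/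

/-- `e^{B}` as an extended nonnegative real. -/
def growth (B : ℝ → ℝ) (x : ℝ) : ℝ≥0∞ := ENNReal.ofReal (Real.exp (B x))

/-- `e^{-B}` as an extended nonnegative real. -/
def decayFactor (B : ℝ → ℝ) (x : ℝ) : ℝ≥0∞ := ENNReal.ofReal (Real.exp (-B x))

section

variable {B : ℝ → ℝ}

theorem measurable_growth (hB : Measurable B) : Measurable (growth B) := by
  unfold growth; fun_prop

theorem measurable_decayFactor (hB : Measurable B) : Measurable (decayFactor B) := by
  unfold decayFactor; fun_prop

theorem growth_mul_decayFactor_le_one (hB : Monotone B) {x y : ℝ} (h : x ≤ y) :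
    growth B x * decayFactor B y ≤ 1 := by
  rw [growth, decayFactor, ← ENNReal.ofReal_mul (Real.exp_pos _).le, ← Real.exp_add,
    ← ENNReal.ofReal_one]
  exact ENNReal.ofReal_le_ofReal (Real.exp_le_one_iff.mpr (by linarith [hB h]))

/-- For increasing `B` the factor `e^{B(x - y) - B(x)}` is at most `1` when `y ≥ 0`: death only
lowers the density. Every estimate of the flux thus reduces to the walk without death. -/
theorem decayFactor_mul_lconvolution_le (hB : Monotone B) {p f : ℝ → ℝ≥0∞} (hp : Causal p)
    (x : ℝ) : decayFactor B x * (p ⋆ₗ (growth B * f)) x ≤ (p ⋆ₗ f) x := by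
  rw [lconvolution_def, lconvolution_def,
    ← lintegral_const_mul' _ _ (show decayFactor B x ≠ ∞ from ENNReal.ofReal_ne_top)]
  refine lintegral_mono fun y => ?_
  rcases lt_or_ge y 0 with hy | hy
  · simp [hp y hy]
  · calc _ = (growth B (-y + x) * decayFactor B x) * (p y * f (-y + x)) := by
          rw [Pi.mul_apply]; ring
      _ ≤ 1 * (p y * f (-y + x)) := by
          gcongr; exact growth_mul_decayFactor_le_one hB (by linarith)
      _ = _ := one_mul _

end

variable {W : Type*} [Fintype W]

/-- The density of particles arriving at `w` after one jump, when `f i t` is the density of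
particles arriving at `i` at time `t`. -/
def fluxStep (lam : W → W → ℝ) (p : W → ℝ → ℝ≥0∞) (B : W → ℝ → ℝ) (f : W → ℝ → ℝ≥0∞)
    (w : W) (x : ℝ) : ℝ≥0∞ :=
  ∑ i, ENNReal.ofReal (lam w i) *
    (decayFactor (B i) x * (p i ⋆ₗ (growth (B i) * f i)) x)

/-- The density of particles that are created on or jump to `w`. -/
def flux (lam : W → W → ℝ) (p : W → ℝ → ℝ≥0∞) (B : W → ℝ → ℝ) (η : W → ℝ → ℝ≥0∞)
    (w : W) (x : ℝ) : ℝ≥0∞ :=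
  ∑' n, (fluxStep lam p B)^[n] η w x

variable {lam : W → W → ℝ} {p : W → ℝ → ℝ≥0∞} {B : W → ℝ → ℝ} {η : W → ℝ → ℝ≥0∞}

theorem measurable_fluxStep (hp : ∀ w, Measurable (p w)) (hB : ∀ w, Measurable (B w))
    (hη : ∀ w, Measurable (η w)) (w : W) : Measurable (fluxStep lam p B η w) := by
  refine Finset.measurable_fun_sum _ fun i _ => Measurable.const_mul ?_ _
  exact (measurable_decayFactor (hB i)).mul
    (measurable_lconvolution _ (hp i) ((measurable_growth (hB i)).mul (hη i)))

theorem measurable_fluxStep_iterate (hp : ∀ w, Measurable (p w)) (hB : ∀ w, Measurable (B w))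
    (hη : ∀ w, Measurable (η w)) (n : ℕ) (w : W) :
    Measurable ((fluxStep lam p B)^[n] η w) := by
  induction n generalizing w with
  | zero => exact hη w
  | succ n ih =>
    rw [Function.iterate_succ_apply']
    exact measurable_fluxStep hp hB ih w

theorem measurable_flux (hp : ∀ w, Measurable (p w)) (hB : ∀ w, Measurable (B w))
    (hη : ∀ w, Measurable (η w)) (w : W) : Measurable (flux lam p B η w) :=
  Measurable.tsum fun n => measurable_fluxStep_iterate hp hB hη n w

theorem causal_fluxStep_iterate (hp : ∀ w, Causal (p w)) (hη : ∀ w, Causal (η w)) (n : ℕ) (w : W) :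
    Causal ((fluxStep lam p B)^[n] η w) := by
  induction n generalizing w with
  | zero => exact hη w
  | succ n ih =>
    rw [Function.iterate_succ_apply']
    intro x hx
    refine Finset.sum_eq_zero fun i _ => ?_
    rw [causal_lconvolution (hp i) _ x hx]
    · simp
    · intro y hy
      rw [Pi.mul_apply, ih i y hy, mul_zero]

theorem causal_flux (hp : ∀ w, Causal (p w)) (hη : ∀ w, Causal (η w)) (w : W) :
    Causal (flux lam p B η w) := fun x hx => by
  simp [flux, causal_fluxStep_iterate hp hη _ w x hx]

/-- The Neumann series solves its fixed point equation, since one step commutes with countable sums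
of nonnegative functions. -/
theorem flux_eq (hp : ∀ w, Measurable (p w)) (hB : ∀ w, Measurable (B w))
    (hη : ∀ w, Measurable (η w)) (w : W) (x : ℝ) :
    flux lam p B η w x = η w x + fluxStep lam p B (flux lam p B η) w x := by
  have hm := measurable_fluxStep_iterate (lam := lam) hp hB hη
  have h1 : fluxStep lam p B (flux lam p B η) w x =
      ∑' n, fluxStep lam p B ((fluxStep lam p B)^[n] η) w x := by
    unfold fluxStep
    rw [Summable.tsum_finsetSum fun i _ => ENNReal.summable]
    refine Finset.sum_congr rfl fun i _ => ?_
    rw [ENNReal.tsum_mul_left, ENNReal.tsum_mul_left]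
    congr 2
    have h2 : growth (B i) * flux lam p B η i =
        fun x => ∑' n, (growth (B i) * (fluxStep lam p B)^[n] η i) x := by
      ext y
      simp only [Pi.mul_apply, flux, ENNReal.tsum_mul_left]
    change (p i ⋆ₗ (growth (B i) * flux lam p B η i)) x = _
    rw [h2, lconvolution_tsum_right (hp i) fun n => (measurable_growth (hB i)).mul (hm n i)]
    rfl
  rw [h1, flux, tsum_eq_zero_add' ENNReal.summable]
  simp only [Function.iterate_zero, id, Function.iterate_succ_apply']

theorem exists_lLaplace_le (hp : ∀ w, IsPosDensity (p w)) {δ : ℝ≥0∞} (hδ : δ ≠ 0) :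
    ∃ σ : ℝ, 0 < σ ∧ ∀ w, lLaplace σ (p w) ≤ δ := by
  have h : ∀ᶠ σ : ℝ in atTop, ∀ w, lLaplace σ (p w) ≤ δ := by
    rw [eventually_all]
    intro w
    exact (tendsto_lLaplace_atTop (hp w)).eventually_le_const hδ.bot_lt
  obtain ⟨σ, h1, h2⟩ := (h.and (eventually_gt_atTop 0)).exists
  exact ⟨σ, h2, h1⟩

theorem IsJumpDensity.le_one (hlam : IsJumpDensity lam) (w i : W) : lam w i ≤ 1 := by
  rw [← hlam.sum_eq_one i]
  exact Finset.single_le_sum (f := fun j => lam j i) (fun j _ => hlam.nonneg j i)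
    (Finset.mem_univ w)

theorem IsJumpDensity.sum_ofReal (hlam : IsJumpDensity lam) (i : W) :
    ∑ j, ENNReal.ofReal (lam j i) = 1 := by
  rw [← ENNReal.ofReal_sum_of_nonneg fun j _ => hlam.nonneg j i, hlam.sum_eq_one,
    ENNReal.ofReal_one]

theorem lLaplace_mono {σ : ℝ} {f g : ℝ → ℝ≥0∞} (h : f ≤ g) : lLaplace σ f ≤ lLaplace σ g :=
  lintegral_mono fun x => by gcongr; exact h x

/-- For each `i` the jump probabilities `lam w i` sum to one over `w`, so jumps preserve the total
mass, and the waiting time costs a factor at most `δ`. Truncation at `T` is needed because creation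
is only locally integrable, without a growth bound. -/
theorem sum_lLaplace_fluxStep_le (hlam : IsJumpDensity lam) (hp : ∀ w, IsPosDensity (p w))
    (hB : ∀ w, Monotone (B w)) (hη : ∀ w, Measurable (η w)) {σ T : ℝ} {δ : ℝ≥0∞}
    (hσ : ∀ w, lLaplace σ (p w) ≤ δ) :
    ∑ w, lLaplace σ (indicator (Iic T) (fluxStep lam p B η w)) ≤
      δ * ∑ w, lLaplace σ (indicator (Iic T) (η w)) := by
  have h1 : ∀ w, indicator (Iic T) (fluxStep lam p B η w) ≤
      fun x => ∑ i, ENNReal.ofReal (lam w i) * (p i ⋆ₗ indicator (Iic T) (η i)) x := by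
    intro w x
    by_cases hx : x ∈ Iic T
    · rw [indicator_of_mem hx]
      refine Finset.sum_le_sum fun i _ => ?_
      gcongr
      refine (decayFactor_mul_lconvolution_le (hB i) (hp i).causal x).trans ?_
      have := indicator_lconvolution_le (f := η i) (hp i).causal T x
      rwa [indicator_of_mem hx] at this
    · rw [indicator_of_notMem hx]; exact zero_le
  have hm : ∀ i, Measurable (p i ⋆ₗ indicator (Iic T) (η i)) := fun i =>
    measurable_lconvolution _ (hp i).measurable ((hη i).indicator measurableSet_Iic)
  have h2 : ∀ w, lLaplace σ (fun x => ∑ i, ENNReal.ofReal (lam w i) *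
      (p i ⋆ₗ indicator (Iic T) (η i)) x) = ∑ i, ENNReal.ofReal (lam w i) *
        (lLaplace σ (p i) * lLaplace σ (indicator (Iic T) (η i))) := by
    intro w
    simp only [lLaplace, Finset.mul_sum]
    rw [lintegral_finsetSum _ fun i _ => by
      have := hm i; have := measurable_expWeight σ; fun_prop]
    refine Finset.sum_congr rfl fun i _ => ?_
    have h3 := lLaplace_lconvolution σ (hp i).measurable ((hη i).indicator (s := Iic T) measurableSet_Iic)
    simp only [lLaplace] at h3
    rw [← h3, ← lintegral_const_mul _ (by
      have := hm i; have := measurable_expWeight σ; fun_prop)]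
    refine lintegral_congr fun x => ?_
    ring
  calc _ ≤ ∑ w, ∑ i, ENNReal.ofReal (lam w i) *
        (lLaplace σ (p i) * lLaplace σ (indicator (Iic T) (η i))) :=
        Finset.sum_le_sum fun w _ => (lLaplace_mono (h1 w)).trans (h2 w).le
    _ = ∑ i, lLaplace σ (p i) * lLaplace σ (indicator (Iic T) (η i)) := by
        rw [Finset.sum_comm]
        refine Finset.sum_congr rfl fun i _ => ?_
        rw [← Finset.sum_mul, hlam.sum_ofReal, one_mul]
    _ ≤ _ := by
        rw [Finset.mul_sum]
        refine Finset.sum_le_sum fun i _ => ?_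
        gcongr
        exact hσ i

/-- With `σ` so large that every waiting time costs a factor `1/2`, the weighted mass of the `n`-th
iterate up to `T` is at most `2^{-n}` times that of `η`. -/
theorem isLocDensity_flux (hlam : IsJumpDensity lam) (hp : ∀ w, IsPosDensity (p w))
    (hBm : ∀ w, Measurable (B w)) (hB : ∀ w, Monotone (B w)) (hη : ∀ w, IsLocDensity (η w))
    (w : W) : IsLocDensity (flux lam p B η w) := by
  have hpm := fun w => (hp w).measurable
  have hηm := fun w => (hη w).measurable
  refine ⟨measurable_flux hpm hBm hηm w,
    causal_flux (fun w => (hp w).causal) (fun w => (hη w).causal) w, fun T => ?_⟩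
  obtain ⟨σ, hσ0, hσ⟩ := exists_lLaplace_le hp (δ := 2⁻¹) (by simp)
  have hm := measurable_fluxStep_iterate (lam := lam) hpm hBm hηm
  have hn : ∀ n, ∑ w, lLaplace σ (indicator (Iic T) ((fluxStep lam p B)^[n] η w)) ≤
      2⁻¹ ^ n * ∑ w, lLaplace σ (indicator (Iic T) (η w)) := fun n => by
    induction n with
    | zero => simp
    | succ n ih =>
      rw [Function.iterate_succ_apply']
      refine (sum_lLaplace_fluxStep_le hlam hp hB (hm n) hσ).trans ?_
      rw [pow_succ', mul_assoc]
      gcongr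
  have h0 : ∑ w, lLaplace σ (indicator (Iic T) (η w)) < ∞ := by
    refine ENNReal.sum_lt_top.mpr fun w _ => lt_of_le_of_lt ?_ ((hη w).lintegral_lt_top T)
    rw [← lintegral_indicator measurableSet_Iic]
    refine lintegral_mono fun x => ?_
    rcases lt_or_ge x 0 with hx | hx
    · have : indicator (Iic T) (η w) x = 0 :=
        le_antisymm ((indicator_le_self _ _ _).trans ((hη w).causal x hx).le) zero_le
      rw [this, mul_zero]
    · exact mul_le_of_le_one_left zero_le (expWeight_le_one hσ0.le hx)
  have h1 : lLaplace σ (indicator (Iic T) (flux lam p B η w)) < ∞ := by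
    have e : indicator (Iic T) (flux lam p B η w) = fun x =>
        ∑' n, indicator (Iic T) ((fluxStep lam p B)^[n] η w) x := by
      ext x
      by_cases hx : x ∈ Iic T
      · simp only [indicator_of_mem hx]; rfl
      · simp only [indicator_of_notMem hx, tsum_zero]
    rw [e, lLaplace_tsum _ fun n => (hm n w).indicator measurableSet_Iic]
    calc _ ≤ ∑' n, 2⁻¹ ^ n * ∑ w, lLaplace σ (indicator (Iic T) (η w)) :=
          ENNReal.tsum_le_tsum fun n => le_trans (Finset.single_le_sum
            (f := fun w => lLaplace σ (indicator (Iic T) ((fluxStep lam p B)^[n] η w)))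
            (fun _ _ => zero_le) (Finset.mem_univ w)) (hn n)
      _ < ∞ := by
          rw [ENNReal.tsum_mul_right, ENNReal.tsum_geometric]
          refine ENNReal.mul_lt_top ?_ h0
          rw [ENNReal.one_sub_inv_two, inv_inv]
          exact ENNReal.ofNat_lt_top
  have h2 := setLIntegral_Iic_le hσ0.le (indicator (Iic T) (flux lam p B η w)) T
  rw [setLIntegral_indicator measurableSet_Iic, inter_self] at h2
  exact h2.trans_lt (ENNReal.mul_lt_top ENNReal.ofReal_lt_top h1)

/-- The contraction argument again, now for a sup norm with weight `e^{-σx}` on `(-∞, T]`. -/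
theorem exists_flux_le (hlam : IsJumpDensity lam) (hp : ∀ w, IsPosDensity (p w))
    (hB : ∀ w, Monotone (B w)) (hη : ∀ w, Causal (η w)) {T : ℝ} {C : ℝ≥0∞} (hC : C ≠ ∞)
    (h : ∀ w, ∀ x ≤ T, η w x ≤ C) :
    ∃ C' : ℝ≥0∞, C' ≠ ∞ ∧ ∀ w, ∀ x ≤ T, flux lam p B η w x ≤ C' := by
  -- At a fixed target `w` the sum of `lam w i` over the sources `i` is only bounded by the number
  -- of vertices, so `δ` must absorb that number to leave a ratio `1/2`.
  obtain ⟨σ, hσ0, hσ⟩ := exists_lLaplace_le hp (δ := (2 * (Fintype.card W + 1))⁻¹)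
    (by simp [ENNReal.mul_eq_top])
  have hn : ∀ n w, ∀ x ≤ T, (fluxStep lam p B)^[n] η w x ≤ 2⁻¹ ^ n * C * expWeight (-σ) x := by
    intro n
    induction n with
    | zero =>
      intro w x hx
      rw [Function.iterate_zero, id, pow_zero, one_mul]
      rcases lt_or_ge x 0 with h0 | h0
      · rw [hη w x h0]; exact zero_le
      · refine (h w x hx).trans (le_mul_of_one_le_right zero_le ?_)
        rw [expWeight, ← ENNReal.ofReal_one]
        refine ENNReal.ofReal_le_ofReal (Real.one_le_exp ?_)
        rw [neg_neg]; positivity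
    | succ n ih =>
      intro w x hx
      rw [Function.iterate_succ_apply']
      calc fluxStep lam p B ((fluxStep lam p B)^[n] η) w x
          ≤ ∑ i : W, (2 * ((Fintype.card W : ℝ≥0∞) + 1))⁻¹ *
              (2⁻¹ ^ n * C * expWeight (-σ) x) := by
            refine Finset.sum_le_sum fun i _ => ?_
            calc _ ≤ 1 * (p i ⋆ₗ (fluxStep lam p B)^[n] η i) x := by
                  gcongr
                  · rw [← ENNReal.ofReal_one]
                    exact ENNReal.ofReal_le_ofReal (hlam.le_one w i)
                  · exact decayFactor_mul_lconvolution_le (hB i) (hp i).causal x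
              _ ≤ lLaplace σ (p i) * (2⁻¹ ^ n * C) * expWeight (-σ) x := by
                  rw [one_mul]
                  exact lconvolution_le_of_le (hp i).measurable (hp i).causal (ih i) x hx
              _ ≤ _ := by
                  rw [mul_assoc]
                  gcongr
                  exact hσ i
        _ = (Fintype.card W * (2 * ((Fintype.card W : ℝ≥0∞) + 1))⁻¹) *
              (2⁻¹ ^ n * C * expWeight (-σ) x) := by
            rw [Finset.sum_const, Finset.card_univ, nsmul_eq_mul, ← mul_assoc]
        _ ≤ 2⁻¹ * (2⁻¹ ^ n * C * expWeight (-σ) x) := by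
            gcongr
            rw [ENNReal.mul_inv (by simp) (by simp), mul_left_comm]
            refine mul_le_of_le_one_right zero_le ?_
            rw [← div_eq_mul_inv]
            exact ENNReal.div_le_of_le_mul (by rw [one_mul]; exact le_self_add)
        _ = _ := by rw [pow_succ']; ring
  refine ⟨2 * C * expWeight (-σ) T, ENNReal.mul_ne_top (ENNReal.mul_ne_top (by simp) hC)
    ENNReal.ofReal_ne_top, fun w x hx => ?_⟩
  calc flux lam p B η w x ≤ ∑' n, 2⁻¹ ^ n * C * expWeight (-σ) x :=
        ENNReal.tsum_le_tsum fun n => hn n w x hx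
    _ = 2 * C * expWeight (-σ) x := by
        rw [ENNReal.tsum_mul_right, ENNReal.tsum_mul_right, ENNReal.tsum_geometric,
          ENNReal.one_sub_inv_two, inv_inv]
    _ ≤ _ := by
        gcongr
        refine ENNReal.ofReal_le_ofReal (Real.exp_le_exp.mpr ?_)
        nlinarith

/-! ### The backward operator -/

/-- The expected value of `g`, discounted by the survival probability, at the vertex and time of
arrival after the next jump of a walker that arrives at `i` at time `t`. -/
def backward (lam : W → W → ℝ) (p : W → ℝ → ℝ≥0∞) (B : W → ℝ → ℝ) (g : W → ℝ → ℝ≥0∞)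
    (i : W) (t : ℝ) : ℝ≥0∞ :=
  ∑ w, ENNReal.ofReal (lam w i) *
    ∫⁻ r, p i r * (growth (B i) t * decayFactor (B i) (t + r) * g w (t + r))

theorem measurable_backward (hp : ∀ w, Measurable (p w)) (hB : ∀ w, Measurable (B w))
    {g : W → ℝ → ℝ≥0∞} (hg : ∀ w, Measurable (g w)) (i : W) :
    Measurable (backward lam p B g i) := by
  refine Finset.measurable_fun_sum _ fun w _ => Measurable.const_mul ?_ _
  have h1 := hp i
  have h2 := measurable_growth (hB i)
  have h3 := measurable_decayFactor (hB i)
  have h4 := hg w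
  exact Measurable.lintegral_prod_right' (f := fun z : ℝ × ℝ =>
    p i z.2 * (growth (B i) z.1 * decayFactor (B i) (z.1 + z.2) * g w (z.1 + z.2))) (by fun_prop)

theorem measurable_backward_iterate (hp : ∀ w, Measurable (p w)) (hB : ∀ w, Measurable (B w))
    {g : W → ℝ → ℝ≥0∞} (hg : ∀ w, Measurable (g w)) (n : ℕ) (i : W) :
    Measurable ((backward lam p B)^[n] g i) := by
  induction n generalizing i with
  | zero => exact hg i
  | succ n ih => rw [Function.iterate_succ_apply']; exact measurable_backward hp hB ih i

/-- `backward` and `fluxStep` are adjoint: both sides integrate over an arrival at `i` at time `t`,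
a wait `r` and an arrival at `w` at time `t + r`. -/
theorem sum_lintegral_mul_backward (hp : ∀ w, Measurable (p w)) (hB : ∀ w, Measurable (B w))
    (hη : ∀ w, Measurable (η w)) {g : W → ℝ → ℝ≥0∞} (hg : ∀ w, Measurable (g w)) :
    ∑ i, ∫⁻ t, η i t * backward lam p B g i t = ∑ w, ∫⁻ x, fluxStep lam p B η w x * g w x := by
  have h3 : ∀ i, Measurable (decayFactor (B i)) := fun i => measurable_decayFactor (hB i)
  have h2 : ∀ i, Measurable (growth (B i)) := fun i => measurable_growth (hB i)
  have hl : ∀ i, ∫⁻ t, η i t * backward lam p B g i t = ∑ w, ENNReal.ofReal (lam w i) *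
      ∫⁻ t, ∫⁻ r, η i t *
        (p i r * (growth (B i) t * decayFactor (B i) (t + r) * g w (t + r))) := by
    intro i
    have := h2 i; have := h3 i; have := hp i; have := hη i
    have hm : ∀ w, Measurable fun t => ∫⁻ r, η i t *
        (p i r * (growth (B i) t * decayFactor (B i) (t + r) * g w (t + r))) := fun w => by
      have := hg w
      exact Measurable.lintegral_prod_right' (f := fun z : ℝ × ℝ => η i z.1 *
        (p i z.2 * (growth (B i) z.1 * decayFactor (B i) (z.1 + z.2) * g w (z.1 + z.2))))
        (by fun_prop)
    calc _ = ∫⁻ t, ∑ w, ENNReal.ofReal (lam w i) * ∫⁻ r, η i t *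
        (p i r * (growth (B i) t * decayFactor (B i) (t + r) * g w (t + r))) := by
          refine lintegral_congr fun t => ?_
          rw [backward, Finset.mul_sum]
          refine Finset.sum_congr rfl fun w _ => ?_
          have := hg w
          rw [lintegral_const_mul _ (by fun_prop), mul_left_comm]
      _ = _ := by
          rw [lintegral_finsetSum _ fun w _ => (hm w).const_mul _]
          exact Finset.sum_congr rfl fun w _ => lintegral_const_mul _ (hm w)
  have hr : ∀ w, ∫⁻ x, fluxStep lam p B η w x * g w x = ∑ i, ENNReal.ofReal (lam w i) *
      ∫⁻ x, ∫⁻ y, (p i y * (growth (B i) (-y + x) * η i (-y + x))) *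
        (decayFactor (B i) x * g w x) := by
    intro w
    have := hg w
    have hm : ∀ i, Measurable fun x =>
        ∫⁻ y, (p i y * (growth (B i) (-y + x) * η i (-y + x))) *
        (decayFactor (B i) x * g w x) := fun i => by
      have := h2 i; have := h3 i; have := hp i; have := hη i
      exact Measurable.lintegral_prod_right' (f := fun z : ℝ × ℝ =>
        (p i z.2 * (growth (B i) (-z.2 + z.1) * η i (-z.2 + z.1))) *
        (decayFactor (B i) z.1 * g w z.1)) (by fun_prop)
    calc _ = ∫⁻ x, ∑ i, ENNReal.ofReal (lam w i) *
        ∫⁻ y, (p i y * (growth (B i) (-y + x) * η i (-y + x))) *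
          (decayFactor (B i) x * g w x) := by
          refine lintegral_congr fun x => ?_
          rw [fluxStep, Finset.sum_mul]
          refine Finset.sum_congr rfl fun i _ => ?_
          have := h2 i; have := h3 i; have := hp i; have := hη i
          rw [lintegral_mul_const _ (by fun_prop), lconvolution_def]
          simp only [Pi.mul_apply]
          ring
      _ = _ := by
          rw [lintegral_finsetSum _ fun i _ => (hm i).const_mul _]
          exact Finset.sum_congr rfl fun i _ => lintegral_const_mul _ (hm i)
  simp only [hl, hr]
  rw [Finset.sum_comm]
  refine Finset.sum_congr rfl fun w _ => Finset.sum_congr rfl fun i _ => ?_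
  congr 1
  have := h2 i; have := h3 i; have := hp i; have := hη i; have := hg w
  rw [lintegral_lintegral_swap (by fun_prop), lintegral_lintegral_swap
    (f := fun x y => (p i y * (growth (B i) (-y + x) * η i (-y + x))) *
        (decayFactor (B i) x * g w x)) (by fun_prop)]
  refine lintegral_congr fun r => ?_
  -- Substitution `x = r + t`, for a fixed waiting time `r`.
  rw [← lintegral_add_left_eq_self (fun x => p i r * (growth (B i) (-r + x) * η i (-r + x)) *
    (decayFactor (B i) x * g w x)) r]
  refine lintegral_congr fun t => ?_
  rw [show -r + (r + t) = t by ring, add_comm r t]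
  ring

/-- The left side is what the law of the walk yields, as a function of the starting point; the right
side contains the terms of the series `flux`. -/
theorem sum_lintegral_mul_backward_iterate (hp : ∀ w, Measurable (p w))
    (hB : ∀ w, Measurable (B w)) {g : W → ℝ → ℝ≥0∞} (hg : ∀ w, Measurable (g w)) (n : ℕ)
    (hη : ∀ w, Measurable (η w)) :
    ∑ i, ∫⁻ t, η i t * (backward lam p B)^[n] g i t =
      ∑ w, ∫⁻ x, (fluxStep lam p B)^[n] η w x * g w x := by
  induction n generalizing η with
  | zero => rfl
  | succ n ih =>
    rw [Function.iterate_succ_apply', Function.iterate_succ_apply,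
      sum_lintegral_mul_backward hp hB hη (measurable_backward_iterate hp hB hg n)]
    exact ih (measurable_fluxStep hp hB hη)

/-- Waiting times are nonnegative, so a walker that starts after `t` never meets a time at which `g`
is nonzero. -/
theorem backward_iterate_eq_zero (hp : ∀ w, Causal (p w)) {g : W → ℝ → ℝ≥0∞} {t : ℝ}
    (hg : ∀ w s, t < s → g w s = 0) (n : ℕ) (i : W) {s : ℝ} (hs : t < s) :
    (backward lam p B)^[n] g i s = 0 := by
  induction n generalizing i s with
  | zero => exact hg i s hs
  | succ n ih =>
    rw [Function.iterate_succ_apply']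
    refine Finset.sum_eq_zero fun w _ => ?_
    rw [(lintegral_congr fun r => ?_).trans lintegral_zero, mul_zero]
    rcases lt_or_ge r 0 with hr | hr
    · rw [hp i r hr, zero_mul]
    · rw [ih w (by linarith)]; simp

/-- The probability, for a walker that arrives at `i` at time `s`, to be alive at time `t` and on
`w` without having jumped again. -/
def occupation [DecidableEq W] (p : W → ℝ → ℝ≥0∞) (B : W → ℝ → ℝ) (w : W) (t : ℝ) (i : W) (s : ℝ) :
    ℝ≥0∞ :=
  if i = w then decayFactor (B w) t * (growth (B w) s * tail (p w) (t - s)) else 0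

theorem measurable_occupation {V : Type*} [DecidableEq V] {p : V → ℝ → ℝ≥0∞} {B : V → ℝ → ℝ}
    (hB : ∀ w, Measurable (B w)) (w : V) (t : ℝ) (i : V) :
    Measurable (occupation p B w t i) := by
  unfold occupation
  split_ifs
  · have := measurable_growth (hB w)
    have := measurable_tail (p w)
    fun_prop
  · exact measurable_const

theorem sum_lintegral_mul_occupation [DecidableEq W] {f : W → ℝ → ℝ≥0∞}
    (hB : ∀ w, Measurable (B w)) (hf : ∀ w, Measurable (f w)) (w : W) (t : ℝ) :
    ∑ i, ∫⁻ x, f i x * occupation p B w t i x =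
      decayFactor (B w) t * (tail (p w) ⋆ₗ (growth (B w) * f w)) t := by
  rw [Finset.sum_eq_single w]
  · rw [lconvolution_comm, lconvolution_def, ← lintegral_const_mul]
    · refine lintegral_congr fun x => ?_
      rw [occupation, if_pos rfl, Pi.mul_apply, show t - x = -x + t by ring]
      ring
    · have := measurable_growth (hB w)
      have := measurable_tail (p w)
      have := hf w
      fun_prop
  · intro i _ hi
    simp [occupation, hi]
  · simp

/-- Summing the adjointness relation over the number of jumps: the particles on `w` at time `t` are
those that arrived at some earlier time, have not jumped since and have survived the stay. -/
theorem tsum_sum_lintegral_backward_occupation [DecidableEq W] (hp : ∀ w, Measurable (p w))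
    (hB : ∀ w, Measurable (B w)) (hη : ∀ w, Measurable (η w)) (w : W) (t : ℝ) :
    ∑ i, ∫⁻ s, η i s * ∑' n, (backward lam p B)^[n] (occupation p B w t) i s =
      decayFactor (B w) t * (tail (p w) ⋆ₗ (growth (B w) * flux lam p B η w)) t := by
  have hm := fun n i => measurable_backward_iterate (lam := lam) hp hB
    (measurable_occupation (p := p) hB w t) n i
  calc _ = ∑ i, ∑' n, ∫⁻ s, η i s * (backward lam p B)^[n] (occupation p B w t) i s := by
        refine Finset.sum_congr rfl fun i _ => ?_
        simp only [← ENNReal.tsum_mul_left]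
        exact lintegral_tsum fun n => ((hη i).mul (hm n i)).aemeasurable
    _ = ∑' n, decayFactor (B w) t *
        (tail (p w) ⋆ₗ (growth (B w) * (fluxStep lam p B)^[n] η w)) t := by
        rw [← Summable.tsum_finsetSum fun i _ => ENNReal.summable]
        refine tsum_congr fun n => ?_
        rw [sum_lintegral_mul_backward_iterate hp hB (measurable_occupation hB w t) n hη,
          sum_lintegral_mul_occupation hB (measurable_fluxStep_iterate hp hB hη n)]
    _ = _ := by
        rw [ENNReal.tsum_mul_left]
        congr 1
        rw [← lconvolution_tsum_right (measurable_tail _) fun n =>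
          (measurable_growth (hB w)).mul (measurable_fluxStep_iterate hp hB hη n w)]
        congr 2
        ext x
        simp only [Pi.mul_apply, ENNReal.tsum_mul_left, flux]

end

/-! ### The law of the random walk -/

/-- The preimage of a set under one coordinate is a box whose other sides are `univ`. This is the
generator needed to identify a product measure on boxes. -/
theorem generateFrom_pi_nat :
    MeasurableSpace.generateFrom
      (pi univ '' pi univ fun _ : ℕ => { s : Set ℝ | MeasurableSet s }) = MeasurableSpace.pi := by
  refine le_antisymm (MeasurableSpace.generateFrom_le ?_) ?_
  · rintro _ ⟨A, hA, rfl⟩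
    exact MeasurableSet.univ_pi fun k => hA k (mem_univ k)
  · refine iSup_le fun k => ?_
    rintro _ ⟨s, hs, rfl⟩
    refine MeasurableSpace.measurableSet_generateFrom ⟨Function.update (fun _ => univ) k s, ?_, ?_⟩
    · intro j _
      by_cases h : j = k
      · subst h; simpa using hs
      · simp [Function.update_of_ne h]
    · ext x
      simp only [Set.mem_pi, mem_univ, true_implies, mem_preimage]
      refine ⟨fun h => by simpa using h k, fun h j => ?_⟩
      by_cases hj : j = k
      · subst hj; simpa using h
      · simp [Function.update_of_ne hj]

/-- The first `n` terms of a sequence of random variables, continued by zero. -/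
def past {Ω : Type*} (S : ℕ → Ω → ℝ) (n : ℕ) (ω : Ω) (k : ℕ) : ℝ := if k < n then S k ω else 0

section

variable {W Ω : Type*} [MeasurableSpace W] [MeasurableSingletonClass W] [MeasurableSpace Ω]
  {X : ℕ → Ω → W} {P : Measure Ω}

/-- The event that the first vertices visited are `x 0, …, x n`. -/
def cylinder (X : ℕ → Ω → W) (x : ℕ → W) (n : ℕ) : Set Ω := {ω | ∀ k ≤ n, X k ω = x k}

theorem measurableSet_cylinder (hX : ∀ n, Measurable (X n)) (x : ℕ → W) (n : ℕ) :
    MeasurableSet (cylinder X x n) := by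
  have : cylinder X x n = ⋂ k ∈ Iic n, X k ⁻¹' {x k} := by
    ext ω; simp [cylinder]
  rw [this]
  exact MeasurableSet.biInter (to_countable _) fun k _ => hX k (measurableSet_singleton _)

theorem setLIntegral_eq_sum_fiber [Fintype W] {n : ℕ} (hX : ∀ n, Measurable (X n)) {D : Set Ω}
    (hD : MeasurableSet D) (f : Ω → ℝ≥0∞) :
    ∫⁻ ω in D, f ω ∂P = ∑ y : Fin n → W, ∫⁻ ω in D ∩ {ω | ∀ k : Fin n, X k ω = y k}, f ω ∂P := by
  have hm : ∀ y : Fin n → W, MeasurableSet (D ∩ {ω | ∀ k : Fin n, X k ω = y k}) := fun y => by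
    refine hD.inter ?_
    have : {ω | ∀ k : Fin n, X k ω = y k} = ⋂ k : Fin n, X k ⁻¹' {y k} := by ext; simp
    rw [this]
    exact MeasurableSet.iInter fun k => hX k (measurableSet_singleton _)
  have hd : Pairwise (Function.onFun Disjoint
      fun y : Fin n → W => D ∩ {ω | ∀ k : Fin n, X k ω = y k}) := by
    intro y z hyz
    refine Set.disjoint_left.mpr fun ω h1 h2 => hyz ?_
    ext k
    rw [← h1.2 k, ← h2.2 k]
  have hu : D = ⋃ y : Fin n → W, D ∩ {ω | ∀ k : Fin n, X k ω = y k} := by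
    ext ω
    simp only [mem_iUnion, mem_inter_iff, mem_ofPred_eq]
    exact ⟨fun h => ⟨fun k => X k ω, h, fun _ => rfl⟩, fun ⟨_, h, _⟩ => h⟩
  conv_lhs => rw [hu]
  rw [lintegral_iUnion hm hd, tsum_fintype]

theorem lintegral_eq_sum_vertex [Fintype W] (hX : ∀ n, Measurable (X n)) (n : ℕ) {D : Set Ω}
    (hD : MeasurableSet D) (f : Ω → ℝ≥0∞) :
    ∫⁻ ω in D, f ω ∂P = ∑ i, ∫⁻ ω in D ∩ {ω | X n ω = i}, f ω ∂P := by
  have hu : D = ⋃ i, D ∩ {ω | X n ω = i} := by ext ω; simp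
  have hm : ∀ i, MeasurableSet (D ∩ {ω | X n ω = i}) := fun i =>
    hD.inter (hX n (measurableSet_singleton i))
  conv_lhs => rw [hu]
  rw [lintegral_iUnion hm ?_, tsum_fintype]
  intro i j hij
  exact Set.disjoint_left.mpr fun ω h1 h2 => hij (h1.2.symm.trans h2.2)

end

section

variable {W Ω : Type*} [Fintype W] [DecidableEq W] [MeasurableSpace W] [MeasurableSpace Ω]
  {ψ : W → ℝ → ℝ} {lam : W → W → ℝ} {X : ℕ → Ω → W} {S : ℕ → Ω → ℝ} {E : Ω → ℝ} {w₀ : W}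
  {P : Measure Ω} {p : W → ℝ → ℝ≥0∞}

theorem measurable_past (hS : ∀ n, Measurable (S n)) (n : ℕ) : Measurable (past S n) := by
  refine measurable_pi_lambda _ fun k => ?_
  unfold past
  split_ifs
  · exact hS k
  · exact measurable_const

theorem IsCTRW.law_density (h : IsCTRW ψ lam X S E w₀ P) (hp : ∀ w, Represents (ψ w) (p w))
    (n : ℕ) (x : ℕ → W) (A : ℕ → Set ℝ) (hA : ∀ k, MeasurableSet (A k)) :
    P {ω | ∀ k ≤ n, X k ω = x k ∧ S k ω ∈ A k} =
      (if x 0 = w₀ then 1 else 0) *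
        (∏ k ∈ Finset.range n, ENNReal.ofReal (lam (x (k + 1)) (x k))) *
        ∏ k ∈ Finset.range (n + 1), ∫⁻ r in A k, p (x k) r := by
  rw [h.law n x A hA]
  congr 1
  refine Finset.prod_congr rfl fun k _ => ?_
  rw [← lintegral_congr_ae (ae_restrict_of_ae_restrict_of_subset inter_subset_right
    (hp (x k)).ae_eq), ← lintegral_indicator ((hA k).inter measurableSet_Ioi),
    ← lintegral_indicator (hA k)]
  congr 1
  ext r
  by_cases hr : 0 < r
  · by_cases hrA : r ∈ A k <;> simp [indicator, hr, hrA]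
  · simp [indicator, (hp (x k)).zero r (not_lt.mp hr)]

/-- Both events are instances of the law, with side `univ` for unconstrained waiting times, which
integrate to `1`. The two products differ by the last jump and the waiting time before it. -/
theorem IsCTRW.measure_box (h : IsCTRW ψ lam X S E w₀ P) (hp : ∀ w, Represents (ψ w) (p w))
    (n : ℕ) (x : ℕ → W) (A : ℕ → Set ℝ) (hA : ∀ k, MeasurableSet (A k)) {s : Set ℝ}
    (hs : MeasurableSet s) :
    P (cylinder X x (n + 1) ∩ {ω | (∀ k < n, S k ω ∈ A k) ∧ S n ω ∈ s}) =
      ENNReal.ofReal (lam (x (n + 1)) (x n)) *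
        P (cylinder X x n ∩ {ω | ∀ k < n, S k ω ∈ A k}) * ∫⁻ r in s, p (x n) r := by
  let A₁ : ℕ → Set ℝ := fun k => if k < n then A k else if k = n then s else univ
  let A₂ : ℕ → Set ℝ := fun k => if k < n then A k else univ
  have hA₁ : ∀ k, MeasurableSet (A₁ k) := fun k => by
    simp only [A₁]; split_ifs; exacts [hA k, hs, MeasurableSet.univ]
  have hA₂ : ∀ k, MeasurableSet (A₂ k) := fun k => by
    simp only [A₂]; split_ifs; exacts [hA k, MeasurableSet.univ]
  have e₁ : cylinder X x (n + 1) ∩ {ω | (∀ k < n, S k ω ∈ A k) ∧ S n ω ∈ s} =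
      {ω | ∀ k ≤ n + 1, X k ω = x k ∧ S k ω ∈ A₁ k} := by
    ext ω
    simp only [cylinder, mem_inter_iff, mem_ofPred_eq, A₁]
    constructor
    · rintro ⟨h1, h2, h3⟩ k hk
      refine ⟨h1 k hk, ?_⟩
      split_ifs with h4 h5
      · exact h2 k h4
      · rw [h5]; exact h3
      · exact mem_univ _
    · intro h1
      refine ⟨fun k hk => (h1 k hk).1, fun k hk => ?_, ?_⟩
      · simpa [hk] using (h1 k (by omega)).2
      · simpa using (h1 n (by omega)).2
  have e₂ : cylinder X x n ∩ {ω | ∀ k < n, S k ω ∈ A k} =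
      {ω | ∀ k ≤ n, X k ω = x k ∧ S k ω ∈ A₂ k} := by
    ext ω
    simp only [cylinder, mem_inter_iff, mem_ofPred_eq, A₂]
    constructor
    · rintro ⟨h1, h2⟩ k hk
      refine ⟨h1 k hk, ?_⟩
      split_ifs with h4
      · exact h2 k h4
      · exact mem_univ _
    · intro h1
      refine ⟨fun k hk => (h1 k hk).1, fun k hk => ?_⟩
      simpa [hk] using (h1 k (by omega)).2
  rw [e₁, e₂, h.law_density hp _ x A₁ hA₁, h.law_density hp _ x A₂ hA₂,
    Finset.prod_range_succ _ n, Finset.prod_range_succ _ (n + 1), Finset.prod_range_succ _ n,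
    Finset.prod_range_succ _ n]
  have e3 : ∏ k ∈ Finset.range n, ∫⁻ r in A₁ k, p (x k) r =
      ∏ k ∈ Finset.range n, ∫⁻ r in A₂ k, p (x k) r :=
    Finset.prod_congr rfl fun k hk => by simp [A₁, A₂, Finset.mem_range.mp hk]
  have e4 : A₁ n = s := by simp [A₁]
  have e5 : A₁ (n + 1) = univ := by simp [A₁]
  have e6 : A₂ n = univ := by simp [A₂]
  rw [e3, e4, e5, e6, Measure.restrict_univ, (hp _).lintegral, (hp _).lintegral]
  ring

/-- The two finite measures agree on boxes. Once the first vertices are fixed, the current waiting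
time is independent of the earlier ones, and the next jump enters only as a constant factor. -/
theorem IsCTRW.map_past [IsFiniteMeasure P] (h : IsCTRW ψ lam X S E w₀ P)
    (hp : ∀ w, Represents (ψ w) (p w)) (n : ℕ) (x : ℕ → W) :
    (P.restrict (cylinder X x (n + 1))).map (fun ω => (past S n ω, S n ω)) =
      (ENNReal.ofReal (lam (x (n + 1)) (x n)) •
        (P.restrict (cylinder X x n)).map (past S n)).prod (volume.withDensity (p (x n))) := by
  symm
  have hpm := measurable_past h.measurable_wait n
  have : IsFiniteMeasure (volume.withDensity (p (x n))) :=
    isFiniteMeasure_withDensity (by rw [(hp _).lintegral]; simp)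
  have : IsFiniteMeasure (ENNReal.ofReal (lam (x (n + 1)) (x n)) •
      (P.restrict (cylinder X x n)).map (past S n)) := by
    refine ⟨?_⟩
    rw [Measure.smul_apply, smul_eq_mul]
    exact ENNReal.mul_lt_top ENNReal.ofReal_lt_top (measure_lt_top _ _)
  refine Measure.prod_eq_generateFrom generateFrom_pi_nat
    MeasurableSpace.generateFrom_measurableSet isPiSystem_pi MeasurableSpace.isPiSystem_measurableSet
    ⟨fun _ => univ, fun _ => ⟨fun _ => univ, fun _ _ => mem_ofPred.mpr MeasurableSet.univ, by simp⟩,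
      fun _ => measure_lt_top _ _, iUnion_const _⟩
    ⟨fun _ => univ, fun _ => MeasurableSet.univ, fun _ => measure_lt_top _ _, iUnion_const _⟩ ?_
  rintro _ ⟨A, hA, rfl⟩ s hs
  have hA' : ∀ k, MeasurableSet (A k) := fun k => hA k (mem_univ k)
  have hs' : MeasurableSet s := hs
  have hbox : MeasurableSet (pi univ A) := MeasurableSet.univ_pi hA'
  rw [Measure.map_apply (hpm.prodMk (h.measurable_wait n)) (hbox.prod hs'), Measure.smul_apply,
    Measure.map_apply hpm hbox, withDensity_apply _ hs', smul_eq_mul,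
    Measure.restrict_apply (hpm.prodMk (h.measurable_wait n) (hbox.prod hs')),
    Measure.restrict_apply (hpm hbox)]
  -- `past S n` is zero from index `n` on; a box that excludes `0` in one of these coordinates is
  -- missed, and both sides vanish.
  by_cases h0 : ∀ k, n ≤ k → (0 : ℝ) ∈ A k
  · have e : ∀ ω, past S n ω ∈ pi univ A ↔ ∀ k < n, S k ω ∈ A k := fun ω => by
      simp only [Set.mem_pi, mem_univ, true_implies, past]
      constructor
      · intro h1 k hk
        simpa [hk] using h1 k
      · intro h1 k
        split_ifs with hk
        · exact h1 k hk
        · exact h0 k (not_lt.mp hk)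
    have e1 : (fun ω => (past S n ω, S n ω)) ⁻¹' (pi univ A ×ˢ s) =
        {ω | (∀ k < n, S k ω ∈ A k) ∧ S n ω ∈ s} := by
      ext ω
      rw [mem_preimage, mem_prod, e]
      rfl
    have e2 : past S n ⁻¹' pi univ A = {ω | ∀ k < n, S k ω ∈ A k} := by
      ext ω
      rw [mem_preimage, e]
      rfl
    rw [e1, e2, inter_comm, h.measure_box hp n x A hA' hs', inter_comm]
  · push Not at h0
    obtain ⟨k, hk, h0⟩ := h0
    have e : ∀ ω, past S n ω ∉ pi univ A := fun ω h1 => by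
      have := h1 k (mem_univ k)
      simp only [past, if_neg (not_lt.mpr hk)] at this
      exact h0 this
    have e1 : (fun ω => (past S n ω, S n ω)) ⁻¹' (pi univ A ×ˢ s) = ∅ := by
      ext ω
      simp only [mem_preimage, mem_prod, mem_empty_iff_false, iff_false, not_and]
      exact fun h1 => absurd h1 (e ω)
    have e2 : past S n ⁻¹' pi univ A = ∅ := by
      ext ω
      simpa using e ω
    rw [e1, e2]
    simp

theorem IsCTRW.lintegral_cylinder [IsFiniteMeasure P] (h : IsCTRW ψ lam X S E w₀ P)
    (hp : ∀ w, Represents (ψ w) (p w)) (n : ℕ) (x : ℕ → W) {F : (ℕ → ℝ) × ℝ → ℝ≥0∞}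
    (hF : Measurable F) :
    ∫⁻ ω in cylinder X x (n + 1), F (past S n ω, S n ω) ∂P =
      ENNReal.ofReal (lam (x (n + 1)) (x n)) *
        ∫⁻ ω in cylinder X x n, (∫⁻ r, p (x n) r * F (past S n ω, r)) ∂P := by
  have hpm := measurable_past h.measurable_wait n
  have : SFinite (volume.withDensity (p (x n))) := inferInstance
  rw [← lintegral_map hF (hpm.prodMk (h.measurable_wait n)), h.map_past hp,
    lintegral_prod _ hF.aemeasurable, lintegral_smul_measure, smul_eq_mul,
    lintegral_map hF.lintegral_prod_right' hpm]
  congr 1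
  refine lintegral_congr fun ω => ?_
  rw [lintegral_withDensity_eq_lintegral_mul _ (hp _).measurable (by fun_prop)]
  rfl

variable [MeasurableSingletonClass W]

/-- The waiting time at `X n` and the vertex `X (n + 1)` are independent of the past, given
`X n`. -/
theorem IsCTRW.lintegral_step [IsFiniteMeasure P] (h : IsCTRW ψ lam X S E w₀ P)
    (hp : ∀ w, Represents (ψ w) (p w)) (n : ℕ) (i w : W) {F : (ℕ → W) → (ℕ → ℝ) → ℝ → ℝ≥0∞}
    (hF : ∀ x, Measurable fun z : (ℕ → ℝ) × ℝ => F x z.1 z.2)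
    (hF' : ∀ x x' s s' r, (∀ k < n, x k = x' k ∧ s k = s' k) → F x s r = F x' s' r) :
    ∫⁻ ω in {ω | X n ω = i ∧ X (n + 1) ω = w}, F (X · ω) (S · ω) (S n ω) ∂P =
      ENNReal.ofReal (lam w i) *
        ∫⁻ ω in {ω | X n ω = i}, (∫⁻ r, p i r * F (X · ω) (S · ω) r) ∂P := by
  have hm1 : MeasurableSet {ω | X n ω = i} := h.measurable_vertex n (measurableSet_singleton _)
  have hm2 : MeasurableSet {ω | X n ω = i ∧ X (n + 1) ω = w} :=
    hm1.inter (h.measurable_vertex (n + 1) (measurableSet_singleton _))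
  rw [setLIntegral_eq_sum_fiber (n := n) h.measurable_vertex hm2,
    setLIntegral_eq_sum_fiber (n := n) h.measurable_vertex hm1, Finset.mul_sum]
  refine Finset.sum_congr rfl fun y _ => ?_
  -- The vertex sequence prescribed by the fiber: `y` before `n`, `i` at `n`, `w` at `n + 1`; later
  -- values play no role.
  let x : ℕ → W := fun k => if hk : k < n then y ⟨k, hk⟩ else if k = n then i else w
  have hxn : x n = i := by simp [x]
  have hxn' : x (n + 1) = w := by simp [x]
  have hxk : ∀ k : Fin n, x k = y k := fun k => by simp [x]
  have e1 : {ω | X n ω = i ∧ X (n + 1) ω = w} ∩ {ω | ∀ k : Fin n, X k ω = y k} =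
      cylinder X x (n + 1) := by
    ext ω
    simp only [cylinder, mem_inter_iff, mem_ofPred_eq]
    constructor
    · rintro ⟨⟨h1, h2⟩, h3⟩ k hk
      rcases lt_trichotomy k n with hlt | rfl | hgt
      · rw [h3 ⟨k, hlt⟩]; exact (hxk ⟨k, hlt⟩).symm
      · rw [h1, hxn]
      · obtain rfl : k = n + 1 := by omega
        rw [h2, hxn']
    · intro h1
      exact ⟨⟨by rw [h1 n (by omega), hxn], by rw [h1 (n + 1) le_rfl, hxn']⟩,
        fun k => by rw [h1 k (by omega), hxk]⟩
  have e2 : {ω | X n ω = i} ∩ {ω | ∀ k : Fin n, X k ω = y k} = cylinder X x n := by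
    ext ω
    simp only [cylinder, mem_inter_iff, mem_ofPred_eq]
    constructor
    · rintro ⟨h1, h3⟩ k hk
      rcases hk.lt_or_eq with hlt | rfl
      · rw [h3 ⟨k, hlt⟩]; exact (hxk ⟨k, hlt⟩).symm
      · rw [h1, hxn]
    · intro h1
      exact ⟨by rw [h1 n le_rfl, hxn], fun k => by rw [h1 k (by omega), hxk]⟩
  have key := h.lintegral_cylinder hp n x (hF x)
  rw [hxn, hxn'] at key
  have hcong : ∀ ω, (∀ k < n, X k ω = x k) → ∀ r, F (X · ω) (S · ω) r = F x (past S n ω) r :=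
    fun ω hω r => hF' _ _ _ _ _ fun k hk => ⟨hω k hk, by simp [past, hk]⟩
  rw [e1, e2]
  refine Eq.trans ?_ (key.trans ?_)
  · refine setLIntegral_congr_fun (measurableSet_cylinder h.measurable_vertex x _) fun ω hω => ?_
    exact hcong ω (fun k hk => hω k (by omega)) _
  · congr 1
    refine setLIntegral_congr_fun (measurableSet_cylinder h.measurable_vertex x _) fun ω hω => ?_
    refine lintegral_congr fun r => ?_
    rw [hcong ω (fun k hk => hω k (by omega))]

/-- Sum `IsCTRW.lintegral_step` over the next vertex; the jump probabilities add up to one. -/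
theorem IsCTRW.lintegral_wait [IsFiniteMeasure P] (h : IsCTRW ψ lam X S E w₀ P)
    (hlam : IsJumpDensity lam)
    (hp : ∀ w, Represents (ψ w) (p w)) (n : ℕ) (i : W) {F : (ℕ → W) → (ℕ → ℝ) → ℝ → ℝ≥0∞}
    (hF : ∀ x, Measurable fun z : (ℕ → ℝ) × ℝ => F x z.1 z.2)
    (hF' : ∀ x x' s s' r, (∀ k < n, x k = x' k ∧ s k = s' k) → F x s r = F x' s' r) :
    ∫⁻ ω in {ω | X n ω = i}, F (X · ω) (S · ω) (S n ω) ∂P =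
        ∫⁻ ω in {ω | X n ω = i}, (∫⁻ r, p i r * F (X · ω) (S · ω) r) ∂P := by
  have hm1 : MeasurableSet {ω | X n ω = i} := h.measurable_vertex n (measurableSet_singleton _)
  rw [lintegral_eq_sum_vertex h.measurable_vertex (n + 1) hm1]
  have : ∀ w, {ω | X n ω = i} ∩ {ω | X (n + 1) ω = w} = {ω | X n ω = i ∧ X (n + 1) ω = w} :=
    fun w => rfl
  simp only [this, h.lintegral_step hp n i _ hF hF']
  rw [← Finset.sum_mul, hlam.sum_ofReal, one_mul]

/-- The densities have no mass on `(-∞, 0]`. As a consequence arrival times almost surely increase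
strictly and stay in `[t₀, ∞)`. -/
theorem IsCTRW.ae_wait_pos [IsFiniteMeasure P] (h : IsCTRW ψ lam X S E w₀ P)
    (hlam : IsJumpDensity lam) (hp : ∀ w, Represents (ψ w) (p w)) :
    ∀ᵐ ω ∂P, ∀ n, 0 < S n ω := by
  rw [ae_all_iff]
  intro n
  have h1 : ∫⁻ ω in univ, indicator (Iic (0 : ℝ)) (1 : ℝ → ℝ≥0∞) (S n ω) ∂P = 0 := by
    rw [lintegral_eq_sum_vertex h.measurable_vertex n MeasurableSet.univ]
    refine Finset.sum_eq_zero fun i _ => ?_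
    rw [univ_inter, h.lintegral_wait hlam hp n i (F := fun _ _ r => indicator (Iic 0) 1 r)
      (fun x => (measurable_one.indicator measurableSet_Iic).comp measurable_snd)
      (fun _ _ _ _ _ _ => rfl)]
    refine (lintegral_congr fun ω => ?_).trans lintegral_zero
    refine (lintegral_congr fun r => ?_).trans lintegral_zero
    by_cases hr : r ≤ 0
    · rw [(hp i).zero r hr, zero_mul]
    · rw [indicator_of_notMem (by simpa using hr), mul_zero]
  have hm : Measurable fun ω => indicator (Iic (0 : ℝ)) (1 : ℝ → ℝ≥0∞) (S n ω) :=
    (measurable_one.indicator measurableSet_Iic).comp (h.measurable_wait n)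
  rw [Measure.restrict_univ, lintegral_eq_zero_iff hm] at h1
  filter_upwards [h1] with ω hω
  by_contra hn
  rw [indicator_of_mem (by simpa using hn)] at hω
  simp at hω

end

/-! ### The survival of the walker -/

theorem expMeasure_Ioi {x : ℝ} (hx : 0 ≤ x) :
    expMeasure 1 (Ioi x) = ENNReal.ofReal (Real.exp (-x)) := by
  have : IsProbabilityMeasure (expMeasure 1) := isProbabilityMeasure_expMeasure one_pos
  have h := cdf_expMeasure_eq one_pos x
  rw [cdf_eq_real, if_pos hx, one_mul] at h
  rw [← ofReal_measureReal, ← compl_Iic, probReal_compl_eq_one_sub measurableSet_Iic, h]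
  congr 1
  ring

/-- Fubini for the product law of clock and trajectory: given the trajectory, the clock exceeds a
level with the probability of the exponential tail. -/
theorem measure_lt_clock {Ω Z : Type*} [MeasurableSpace Ω] [MeasurableSpace Z] {P : Measure Ω}
    [IsProbabilityMeasure P] {E : Ω → ℝ} {Y : Ω → Z} (hE : Measurable E) (hY : Measurable Y)
    (hEl : P.map E = expMeasure 1) (hi : IndepFun E Y P) {D : Set Z} (hD : MeasurableSet D)
    {f : Z → ℝ} (hf : Measurable f) :
    P {ω | Y ω ∈ D ∧ f (Y ω) < E ω} = ∫⁻ ω in Y ⁻¹' D, expMeasure 1 (Ioi (f (Y ω))) ∂P := by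
  have : IsProbabilityMeasure (expMeasure 1) := isProbabilityMeasure_expMeasure one_pos
  have : IsProbabilityMeasure (P.map Y) := Measure.isProbabilityMeasure_map hY.aemeasurable
  have hQ : MeasurableSet {q : ℝ × Z | q.2 ∈ D ∧ f q.2 < q.1} :=
    (measurable_snd hD).inter (measurableSet_lt (hf.comp measurable_snd) measurable_fst)
  have h1 := (indepFun_iff_map_prod_eq_prod_map_map hE.aemeasurable hY.aemeasurable).mp hi
  have hm : Measurable fun z => expMeasure 1 (Ioi (f z)) :=
    measurable_measure_prodMk_left (ν := expMeasure 1) (s := {q : Z × ℝ | f q.1 < q.2})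
      (measurableSet_lt (hf.comp measurable_fst) measurable_snd)
  calc _ = P.map (fun ω => (E ω, Y ω)) {q : ℝ × Z | q.2 ∈ D ∧ f q.2 < q.1} := by
        rw [Measure.map_apply (hE.prodMk hY) hQ]; rfl
    _ = ∫⁻ z, indicator D (fun z => expMeasure 1 (Ioi (f z))) z ∂(P.map Y) := by
        rw [h1, hEl, Measure.prod_apply_symm hQ]
        refine lintegral_congr fun z => ?_
        by_cases hz : z ∈ D
        · rw [indicator_of_mem hz]
          congr 1
          ext e
          simp [hz]
        · rw [indicator_of_notMem hz]
          simp [hz]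
    _ = _ := by
        rw [lintegral_indicator hD, setLIntegral_map hD hm hY]

/-- The time of arrival after `n` steps, for the sequence `s` of waiting times. -/
def arrival (t₀ : ℝ) (s : ℕ → ℝ) (n : ℕ) : ℝ := t₀ + ∑ k ∈ Finset.range n, s k

/-- The hazard accumulated during the first `n` steps. -/
def pathHazard {W : Type*} (B : W → ℝ → ℝ) (t₀ : ℝ) (x : ℕ → W) (s : ℕ → ℝ) (n : ℕ) : ℝ :=
  ∑ k ∈ Finset.range n, (B (x k) (arrival t₀ s (k + 1)) - B (x k) (arrival t₀ s k))

/-- The probability of surviving the first `n` steps. -/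
def pathWeight {W : Type*} (B : W → ℝ → ℝ) (t₀ : ℝ) (x : ℕ → W) (s : ℕ → ℝ) (n : ℕ) : ℝ≥0∞ :=
  ENNReal.ofReal (Real.exp (-pathHazard B t₀ x s n))

theorem arrival_succ (t₀ : ℝ) (s : ℕ → ℝ) (n : ℕ) :
    arrival t₀ s (n + 1) = arrival t₀ s n + s n := by
  rw [arrival, arrival, Finset.sum_range_succ, add_assoc]

theorem arrival_congr {t₀ : ℝ} {s s' : ℕ → ℝ} {n : ℕ} (h : ∀ k < n, s k = s' k) :
    arrival t₀ s n = arrival t₀ s' n := by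
  rw [arrival, arrival, Finset.sum_congr rfl fun k hk => h k (Finset.mem_range.mp hk)]

section

variable {W : Type*} {B : W → ℝ → ℝ} {t₀ : ℝ}

theorem pathHazard_congr {x x' : ℕ → W} {s s' : ℕ → ℝ} {n : ℕ}
    (h : ∀ k < n, x k = x' k ∧ s k = s' k) :
    pathHazard B t₀ x s n = pathHazard B t₀ x' s' n := by
  refine Finset.sum_congr rfl fun k hk => ?_
  have hk := Finset.mem_range.mp hk
  rw [(h k hk).1, arrival_congr fun j hj => (h j (by omega)).2,
    arrival_congr (s := s) fun j hj => (h j (by omega)).2]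

theorem pathWeight_congr {x x' : ℕ → W} {s s' : ℕ → ℝ} {n : ℕ}
    (h : ∀ k < n, x k = x' k ∧ s k = s' k) :
    pathWeight B t₀ x s n = pathWeight B t₀ x' s' n := by
  rw [pathWeight, pathWeight, pathHazard_congr h]

theorem pathWeight_succ (x : ℕ → W) (s : ℕ → ℝ) (n : ℕ) :
    pathWeight B t₀ x s (n + 1) = pathWeight B t₀ x s n *
      (growth (B (x n)) (arrival t₀ s n) * decayFactor (B (x n)) (arrival t₀ s n + s n)) := by
  rw [pathWeight, pathWeight, growth, decayFactor, ← ENNReal.ofReal_mul (Real.exp_pos _).le,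
    ← ENNReal.ofReal_mul (Real.exp_pos _).le, ← Real.exp_add, ← Real.exp_add, pathHazard,
    Finset.sum_range_succ, ← pathHazard, arrival_succ]
  congr 2
  ring

theorem measurable_arrival (n : ℕ) : Measurable fun s => arrival t₀ s n := by
  unfold arrival; fun_prop

theorem measurable_pathWeight (hB : ∀ w, Measurable (B w)) (x : ℕ → W) (n : ℕ) :
    Measurable fun s => pathWeight B t₀ x s n := by
  have := fun k => measurable_arrival (t₀ := t₀) k
  unfold pathWeight pathHazard
  fun_prop

variable [Countable W] [MeasurableSpace W] [MeasurableSingletonClass W]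

theorem measurable_vertex_apply {α β : Type*} [MeasurableSpace α] [MeasurableSpace β]
    {f : W → ℝ → β} (hf : ∀ w, Measurable (f w)) {a : α → W} (ha : Measurable a) {b : α → ℝ}
    (hb : Measurable b) : Measurable fun z => f (a z) (b z) :=
  (measurable_from_prod_countable_right (f := fun q : W × ℝ => f q.1 q.2) hf).comp (ha.prodMk hb)

theorem measurable_pathHazard_comp {α : Type*} [MeasurableSpace α] (hB : ∀ w, Measurable (B w))
    {a : α → ℕ → W} (ha : Measurable a) {b : α → ℕ → ℝ} (hb : Measurable b) (n : ℕ) :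
    Measurable fun z => pathHazard B t₀ (a z) (b z) n := by
  refine Finset.measurable_fun_sum _ fun k _ => ?_
  have h1 : Measurable fun z => a z k := by fun_prop
  exact (measurable_vertex_apply hB h1 ((measurable_arrival _).comp hb)).sub
    (measurable_vertex_apply hB h1 ((measurable_arrival _).comp hb))

end

section

variable {W Ω : Type*} [Fintype W] [DecidableEq W] [MeasurableSpace W]
  [MeasurableSingletonClass W] [MeasurableSpace Ω]
  {ψ : W → ℝ → ℝ} {lam : W → W → ℝ} {X : ℕ → Ω → W} {S : ℕ → Ω → ℝ} {E : Ω → ℝ} {w₀ : W}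
  {P : Measure Ω} {p : W → ℝ → ℝ≥0∞} {B : W → ℝ → ℝ} {g : W → ℝ → ℝ≥0∞}

theorem IsCTRW.lintegral_vertex_zero [IsFiniteMeasure P] (h : IsCTRW ψ lam X S E w₀ P)
    (hp : ∀ w, Represents (ψ w) (p w)) (f : W → ℝ≥0∞) : ∫⁻ ω, f (X 0 ω) ∂P = f w₀ := by
  have h1 : ∀ i, P {ω | X 0 ω = i} = if i = w₀ then 1 else 0 := fun i => by
    have := h.law_density hp 0 (fun _ => i) (fun _ => univ) fun _ => MeasurableSet.univ
    simpa [(hp i).lintegral] using this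
  have h2 : ∀ i, ∫⁻ ω in univ ∩ {ω | X 0 ω = i}, f (X 0 ω) ∂P = f i * if i = w₀ then 1 else 0 := by
    intro i
    have hm : MeasurableSet {ω | X 0 ω = i} := h.measurable_vertex 0 (measurableSet_singleton i)
    rw [univ_inter, setLIntegral_congr_fun hm (g := fun _ => f i)
      (fun ω hω => congrArg f hω), setLIntegral_const, h1]
  rw [← Measure.restrict_univ (μ := P),
    lintegral_eq_sum_vertex h.measurable_vertex 0 MeasurableSet.univ]
  simp only [h2]
  simp

theorem IsCTRW.measurable_pathWeight (h : IsCTRW ψ lam X S E w₀ P) (hB : ∀ w, Measurable (B w))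
    (t₀ : ℝ) (n : ℕ) : Measurable fun ω => pathWeight B t₀ (X · ω) (S · ω) n :=
  (Real.measurable_exp.comp (measurable_pathHazard_comp hB (measurable_pi_lambda _
    h.measurable_vertex) (measurable_pi_lambda _ h.measurable_wait) n).neg).ennreal_ofReal

/-- The weight of step `n` depends on the past through the arrival at `X n` only; integrating out
the waiting time and the jump there turns `g` into `backward g`. -/
theorem IsCTRW.lintegral_pathWeight_succ [IsFiniteMeasure P] (h : IsCTRW ψ lam X S E w₀ P)
    (hp : ∀ w, Represents (ψ w) (p w)) (hB : ∀ w, Measurable (B w)) (hg : ∀ w, Measurable (g w))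
    (t₀ : ℝ) (n : ℕ) :
    ∫⁻ ω, pathWeight B t₀ (X · ω) (S · ω) (n + 1) *
        g (X (n + 1) ω) (arrival t₀ (S · ω) (n + 1)) ∂P =
      ∫⁻ ω, pathWeight B t₀ (X · ω) (S · ω) n *
        backward lam p B g (X n ω) (arrival t₀ (S · ω) n) ∂P := by
  have hpw := h.measurable_pathWeight hB t₀ n
  have har : Measurable fun ω => arrival t₀ (S · ω) n :=
    (measurable_arrival n).comp (measurable_pi_lambda _ h.measurable_wait)
  have hX : ∀ n i, MeasurableSet {ω | X n ω = i} := fun n i =>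
    h.measurable_vertex n (measurableSet_singleton i)
  -- The weight and the arrival time of index `n` involve only waiting times of index below `n`, as
  -- `IsCTRW.lintegral_step` requires; the current one is the separate variable `r`.
  let F : W → W → (ℕ → W) → (ℕ → ℝ) → ℝ → ℝ≥0∞ := fun i w x s r => pathWeight B t₀ x s n *
    (growth (B i) (arrival t₀ s n) * decayFactor (B i) (arrival t₀ s n + r) *
      g w (arrival t₀ s n + r))
  have hF : ∀ i w x, Measurable fun z : (ℕ → ℝ) × ℝ => F i w x z.1 z.2 := fun i w x => by
    have h1 := NetworkCTRW.measurable_pathWeight (t₀ := t₀) hB x n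
    have h2 := measurable_growth (hB i)
    have h3 := measurable_decayFactor (hB i)
    have h4 := hg w
    have h5 := measurable_arrival (t₀ := t₀) n
    simp only [F]
    fun_prop
  have hF' : ∀ i w x x' s s' r, (∀ k < n, x k = x' k ∧ s k = s' k) →
      F i w x s r = F i w x' s' r := fun i w x x' s s' r hk => by
    simp only [F]
    rw [pathWeight_congr hk, arrival_congr fun k hk' => (hk k hk').2]
  rw [← Measure.restrict_univ (μ := P),
    lintegral_eq_sum_vertex h.measurable_vertex n MeasurableSet.univ,
    lintegral_eq_sum_vertex h.measurable_vertex n MeasurableSet.univ]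
  refine Finset.sum_congr rfl fun i _ => ?_
  rw [univ_inter, lintegral_eq_sum_vertex h.measurable_vertex (n + 1) (hX n i)]
  calc _ = ∑ w, ∫⁻ ω in {ω | X n ω = i ∧ X (n + 1) ω = w}, F i w (X · ω) (S · ω) (S n ω) ∂P := by
        refine Finset.sum_congr rfl fun w _ => ?_
        refine setLIntegral_congr_fun ((hX n i).inter (hX (n + 1) w)) fun ω hω => ?_
        have h1 : X n ω = i := hω.1
        have h2 : X (n + 1) ω = w := hω.2
        simp only [F, pathWeight_succ, arrival_succ, h1, h2, mul_assoc]
    _ = ∑ w, ∫⁻ ω in {ω | X n ω = i}, ENNReal.ofReal (lam w i) *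
          (∫⁻ r, p i r * F i w (X · ω) (S · ω) r) ∂P := by
        refine Finset.sum_congr rfl fun w _ => ?_
        rw [h.lintegral_step hp n i w (hF i w) (hF' i w),
          lintegral_const_mul' _ _ ENNReal.ofReal_ne_top]
    _ = ∫⁻ ω in {ω | X n ω = i}, (∑ w, ENNReal.ofReal (lam w i) *
          ∫⁻ r, p i r * F i w (X · ω) (S · ω) r) ∂P := by
        refine (lintegral_finsetSum _ fun w _ => Measurable.const_mul ?_ _).symm
        have h1 := (hp i).measurable
        have h2 := measurable_growth (hB i)
        have h3 := measurable_decayFactor (hB i)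
        have h4 := hg w
        have h5 : Measurable fun z : Ω × ℝ => pathWeight B t₀ (X · z.1) (S · z.1) n :=
          hpw.comp measurable_fst
        have h6 : Measurable fun z : Ω × ℝ => arrival t₀ (S · z.1) n := har.comp measurable_fst
        have h7 : Measurable fun z : Ω × ℝ => arrival t₀ (S · z.1) n + z.2 :=
          h6.add measurable_snd
        exact Measurable.lintegral_prod_right' (f := fun z : Ω × ℝ => p i z.2 *
          F i w (X · z.1) (S · z.1) z.2) ((h1.comp measurable_snd).mul
            (h5.mul (((h2.comp h6).mul (h3.comp h7)).mul (h4.comp h7))))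
    _ = _ := by
        refine setLIntegral_congr_fun (hX n i) fun ω hω => ?_
        have h1 : X n ω = i := hω
        have h2 := measurable_growth (hB i)
        have h3 := measurable_decayFactor (hB i)
        have h5 := (hp i).measurable
        simp only [backward, h1, F, Finset.mul_sum]
        refine Finset.sum_congr rfl fun w _ => ?_
        have h4 := hg w
        rw [mul_left_comm (pathWeight B t₀ (X · ω) (S · ω) n), ← lintegral_const_mul _ (by fun_prop),
          ← lintegral_const_mul _ (by fun_prop), ← lintegral_const_mul _ (by fun_prop)]
        refine lintegral_congr fun r => ?_
        ring

/-- Each round integrates out the last jump, replaces `g` by `backward g` and lowers `n`, until only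
the starting vertex and time remain; hence the induction is over all `g`. -/
theorem IsCTRW.lintegral_pathWeight [IsFiniteMeasure P] (h : IsCTRW ψ lam X S E w₀ P)
    (hp : ∀ w, Represents (ψ w) (p w)) (hB : ∀ w, Measurable (B w)) (hg : ∀ w, Measurable (g w))
    (t₀ : ℝ) (n : ℕ) :
    ∫⁻ ω, pathWeight B t₀ (X · ω) (S · ω) n * g (X n ω) (arrival t₀ (S · ω) n) ∂P =
      (backward lam p B)^[n] g w₀ t₀ := by
  induction n generalizing g with
  | zero =>
    simpa [pathWeight, pathHazard, arrival] using h.lintegral_vertex_zero hp fun i => g i t₀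
  | succ n ih =>
    rw [h.lintegral_pathWeight_succ hp hB hg, Function.iterate_succ_apply]
    exact ih (measurable_backward (fun w => (hp w).measurable) hB hg)

/-- The event that the walker has made exactly `n` steps by time `t` and is then on `w`. -/
def stayEvent (X : ℕ → Ω → W) (S : ℕ → Ω → ℝ) (t₀ : ℝ) (w : W) (t : ℝ) (n : ℕ) : Set Ω :=
  {ω | X n ω = w ∧ arrival t₀ (S · ω) n ≤ t ∧ t < arrival t₀ (S · ω) (n + 1)}

/-- Beyond the `n`-th arrival at time `T ≤ t`, the event only requires the current waiting time to
exceed `t - T`. Integrating that waiting time out gives the survival function, hence `occupation`.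
-/
theorem IsCTRW.lintegral_stayEvent [IsFiniteMeasure P] (h : IsCTRW ψ lam X S E w₀ P)
    (hlam : IsJumpDensity lam) (hp : ∀ w, Represents (ψ w) (p w)) (hB : ∀ w, Measurable (B w))
    (t₀ : ℝ) (w : W) (t : ℝ) (n : ℕ) :
    ∫⁻ ω in stayEvent X S t₀ w t n, pathWeight B t₀ (X · ω) (S · ω) n *
        (growth (B w) (arrival t₀ (S · ω) n) * decayFactor (B w) t) ∂P =
      (backward lam p B)^[n] (occupation p B w t) w₀ t₀ := by
  rw [← h.lintegral_pathWeight hp hB (measurable_occupation hB w t)]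
  have hX : MeasurableSet {ω | X n ω = w} := h.measurable_vertex n (measurableSet_singleton w)
  have har : ∀ n, Measurable fun ω => arrival t₀ (S · ω) n := fun n =>
    (measurable_arrival n).comp (measurable_pi_lambda _ h.measurable_wait)
  have har' := measurable_arrival (t₀ := t₀) n
  let D : Set (ℝ × ℝ) := {q | q.1 ≤ t ∧ t < q.1 + q.2}
  have hD : MeasurableSet D := (measurableSet_le measurable_fst measurable_const).inter
    (measurableSet_lt measurable_const (measurable_fst.add measurable_snd))
  let F : (ℕ → W) → (ℕ → ℝ) → ℝ → ℝ≥0∞ := fun x s r => pathWeight B t₀ x s n *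
    (growth (B w) (arrival t₀ s n) * decayFactor (B w) t) *
      indicator D 1 (arrival t₀ s n, r)
  have hF : ∀ x, Measurable fun z : (ℕ → ℝ) × ℝ => F x z.1 z.2 := fun x => by
    have h1 := NetworkCTRW.measurable_pathWeight (t₀ := t₀) hB x n
    have h2 := measurable_growth (hB w)
    have h3 : Measurable (indicator D (1 : ℝ × ℝ → ℝ≥0∞)) := measurable_one.indicator hD
    simp only [F]
    fun_prop
  have hF' : ∀ x x' s s' r, (∀ k < n, x k = x' k ∧ s k = s' k) →
      F x s r = F x' s' r := fun x x' s s' r hk => by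
    simp only [F]
    rw [pathWeight_congr hk, arrival_congr fun k hk' => (hk k hk').2]
  have hm : MeasurableSet {ω | arrival t₀ (S · ω) n ≤ t ∧ t < arrival t₀ (S · ω) (n + 1)} :=
    (measurableSet_le (har n) measurable_const).inter (measurableSet_lt measurable_const (har _))
  have hst : MeasurableSet (stayEvent X S t₀ w t n) := hX.inter hm
  calc _ = ∫⁻ ω in {ω | X n ω = w}, F (X · ω) (S · ω) (S n ω) ∂P := by
        rw [← lintegral_indicator hst, ← lintegral_indicator hX]
        refine lintegral_congr fun ω => ?_
        by_cases h1 : X n ω = w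
        · by_cases h2 : arrival t₀ (S · ω) n ≤ t ∧ t < arrival t₀ (S · ω) n + S n ω
          · have h3 : ω ∈ stayEvent X S t₀ w t n := ⟨h1, h2.1, by rw [arrival_succ]; exact h2.2⟩
            have h4 : (arrival t₀ (S · ω) n, S n ω) ∈ D := h2
            have h5 : ω ∈ {ω | X n ω = w} := h1
            rw [indicator_of_mem h5]
            simp only [F]
            rw [indicator_of_mem h4, Pi.one_apply, mul_one]
            exact indicator_of_mem h3 _
          · have h3 : ω ∉ stayEvent X S t₀ w t n := fun h3 =>
              h2 ⟨h3.2.1, by rw [← arrival_succ]; exact h3.2.2⟩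
            have h4 : (arrival t₀ (S · ω) n, S n ω) ∉ D := h2
            have h5 : ω ∈ {ω | X n ω = w} := h1
            rw [indicator_of_mem h5]
            simp only [F]
            rw [indicator_of_notMem h4, mul_zero]
            exact indicator_of_notMem h3 _
        · have h3 : ω ∉ stayEvent X S t₀ w t n := fun h3 => h1 h3.1
          have h5 : ω ∉ {ω | X n ω = w} := h1
          rw [indicator_of_notMem h5]
          exact indicator_of_notMem h3 _
    _ = ∫⁻ ω in {ω | X n ω = w}, (∫⁻ r, p w r * F (X · ω) (S · ω) r) ∂P :=
        h.lintegral_wait hlam hp n w hF hF'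
    _ = ∫⁻ ω in {ω | X n ω = w}, pathWeight B t₀ (X · ω) (S · ω) n *
          occupation p B w t (X n ω) (arrival t₀ (S · ω) n) ∂P := by
        refine setLIntegral_congr_fun hX fun ω hω => ?_
        have h1 : X n ω = w := hω
        simp only [occupation, h1, if_true, F]
        set T := arrival t₀ (S · ω) n
        have h2 : ∫⁻ r, p w r * indicator D 1 (T, r) = tail (p w) (t - T) := by
          by_cases hT : T ≤ t
          · rw [tail, indicator_of_mem (by simpa using hT), ← lintegral_indicator measurableSet_Ioi]
            refine lintegral_congr fun r => ?_
            by_cases hr : t < T + r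
            · have h4 : (T, r) ∈ D := ⟨hT, hr⟩
              have h5 : r ∈ Ioi (t - T) := by rw [mem_Ioi]; linarith
              rw [indicator_of_mem h4, indicator_of_mem h5, Pi.one_apply, mul_one]
            · have h4 : (T, r) ∉ D := fun h => hr h.2
              have h5 : r ∉ Ioi (t - T) := by rw [mem_Ioi]; linarith
              rw [indicator_of_notMem h4, indicator_of_notMem h5, mul_zero]
          · rw [tail, indicator_of_notMem (by simpa using hT)]
            refine (lintegral_congr fun r => ?_).trans lintegral_zero
            have h4 : (T, r) ∉ D := fun h => hT h.1
            rw [indicator_of_notMem h4, mul_zero]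
        have h3 : Measurable (indicator D (1 : ℝ × ℝ → ℝ≥0∞)) := measurable_one.indicator hD
        have h6 := (hp w).measurable
        rw [← h2, mul_comm (decayFactor (B w) t), mul_right_comm (growth (B w) T), ← mul_assoc,
          ← lintegral_const_mul _ (by fun_prop), ← lintegral_const_mul _ (by fun_prop)]
        refine lintegral_congr fun r => ?_
        ring
    _ = _ := by
        rw [← lintegral_indicator hX]
        refine lintegral_congr fun ω => ?_
        by_cases h1 : ω ∈ {ω | X n ω = w}
        · rw [indicator_of_mem h1]
        · rw [indicator_of_notMem h1]
          have h1 : X n ω ≠ w := h1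
          simp [occupation, h1]

end

/-! ### The accumulated death rate -/

/-- The death rate `β` on a vertex, integrated from `0` to `t`. -/
def cumHazard (β : ℝ → ℝ) (t : ℝ) : ℝ := ∫ s in (0 : ℝ)..t, indicator (Ici 0) β s

section

variable {β : ℝ → ℝ}

theorem locallyIntegrable_indicator_Ici (hβ : LocallyIntegrableOn β (Ici 0)) :
    LocallyIntegrable (indicator (Ici 0) β) := by
  refine (locallyIntegrable_iff).mpr fun k hk => ?_
  rw [integrableOn_indicator_iff measurableSet_Ici]
  rw [inter_comm]
  exact hβ.integrableOn_compact_subset inter_subset_right (hk.inter_right isClosed_Ici)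

theorem intervalIntegrable_indicator_Ici (hβ : LocallyIntegrableOn β (Ici 0)) (a b : ℝ) :
    IntervalIntegrable (indicator (Ici 0) β) volume a b :=
  ((locallyIntegrable_indicator_Ici hβ).integrableOn_isCompact isCompact_uIcc).intervalIntegrable

theorem integral_eq_cumHazard_sub (hβ : LocallyIntegrableOn β (Ici 0)) {a b : ℝ} (ha : 0 ≤ a)
    (hb : 0 ≤ b) : ∫ s in a..b, β s = cumHazard β b - cumHazard β a := by
  rw [cumHazard, cumHazard, intervalIntegral.integral_interval_sub_left
    (intervalIntegrable_indicator_Ici hβ _ _) (intervalIntegrable_indicator_Ici hβ _ _)]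
  refine intervalIntegral.integral_congr fun s hs => ?_
  have : (0 : ℝ) ≤ s := le_trans (le_min ha hb) hs.1
  exact (indicator_of_mem (show s ∈ Ici 0 from this) β).symm

theorem integral_eq_cumHazard (hβ : LocallyIntegrableOn β (Ici 0)) {t : ℝ} (ht : 0 ≤ t) :
    ∫ s in (0 : ℝ)..t, β s = cumHazard β t := by
  rw [integral_eq_cumHazard_sub hβ le_rfl ht, sub_eq_self, cumHazard,
    intervalIntegral.integral_same]

theorem continuous_cumHazard (hβ : LocallyIntegrableOn β (Ici 0)) : Continuous (cumHazard β) :=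
  intervalIntegral.continuous_primitive (intervalIntegrable_indicator_Ici hβ) 0

theorem monotone_cumHazard (hβ : LocallyIntegrableOn β (Ici 0)) (h0 : ∀ t, 0 ≤ t → 0 ≤ β t) :
    Monotone (cumHazard β) := fun a b hab => by
  rw [← sub_nonneg, cumHazard, cumHazard, intervalIntegral.integral_interval_sub_left
    (intervalIntegrable_indicator_Ici hβ _ _) (intervalIntegrable_indicator_Ici hβ _ _)]
  exact intervalIntegral.integral_nonneg hab fun s _ => indicator_nonneg (fun s hs => h0 s hs) s

end

theorem strictMono_arrival {t₀ : ℝ} {s : ℕ → ℝ} (hs : ∀ n, 0 < s n) :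
    StrictMono (arrival t₀ s) :=
  strictMono_nat_of_lt_succ fun n => by rw [arrival_succ]; linarith [hs n]

theorem le_arrival {t₀ : ℝ} {s : ℕ → ℝ} (hs : ∀ n, 0 < s n) (n : ℕ) : t₀ ≤ arrival t₀ s n := by
  have h := (strictMono_arrival (t₀ := t₀) hs).monotone (Nat.zero_le n)
  simpa [arrival] using h

theorem hazard_eq {W Ω : Type*} {β : W → ℝ → ℝ} {X : ℕ → Ω → W} {S : ℕ → Ω → ℝ}
    (hβ_int : ∀ w, LocallyIntegrableOn (β w) (Ici 0)) {t₀ t : ℝ} (ht₀ : 0 ≤ t₀)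
    {ω : Ω} (hS : ∀ n, 0 < S n ω) {n : ℕ} (ht : arrival t₀ (S · ω) n ≤ t) :
    hazard β X S t₀ t n ω = pathHazard (fun w => cumHazard (β w)) t₀ (X · ω) (S · ω) n +
      (cumHazard (β (X n ω)) t - cumHazard (β (X n ω)) (arrival t₀ (S · ω) n)) := by
  have h0 : ∀ k, 0 ≤ arrival t₀ (S · ω) k := fun k =>
    ht₀.trans (le_arrival (s := (S · ω)) hS k)
  have e : ∀ k, arrivalTime S t₀ k ω = arrival t₀ (S · ω) k := fun k => rfl
  simp only [hazard, e, pathHazard]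
  rw [integral_eq_cumHazard_sub (hβ_int _) (h0 n) ((h0 n).trans ht)]
  congr 1
  exact Finset.sum_congr rfl fun k _ => integral_eq_cumHazard_sub (hβ_int _) (h0 _) (h0 _)

theorem pathHazard_nonneg {W : Type*} {B : W → ℝ → ℝ} (hB : ∀ w, Monotone (B w)) {t₀ : ℝ} {x : ℕ → W}
    {s : ℕ → ℝ} (hs : ∀ n, 0 < s n) (n : ℕ) : 0 ≤ pathHazard B t₀ x s n :=
  Finset.sum_nonneg fun k _ => sub_nonneg.mpr
    (hB _ ((strictMono_arrival hs).monotone (Nat.le_succ k)))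

theorem measurableSet_stayEvent {W Ω : Type*} [MeasurableSpace W] [MeasurableSingletonClass W]
    [MeasurableSpace Ω] {X : ℕ → Ω → W} {S : ℕ → Ω → ℝ} (hX : ∀ n, Measurable (X n)) (hS : ∀ n, Measurable (S n))
    (t₀ : ℝ) (w : W) (t : ℝ) (n : ℕ) : MeasurableSet (stayEvent X S t₀ w t n) := by
  have har : ∀ n, Measurable fun ω => arrival t₀ (S · ω) n := fun n =>
    (measurable_arrival n).comp (measurable_pi_lambda _ hS)
  exact (hX n (measurableSet_singleton w)).inter ((measurableSet_le (har n) measurable_const).inter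
    (measurableSet_lt measurable_const (har _)))

section

variable {W Ω : Type*} [Fintype W] [DecidableEq W] [MeasurableSpace W]
  [MeasurableSingletonClass W] [MeasurableSpace Ω]
  {ψ : W → ℝ → ℝ} {lam : W → W → ℝ} {X : ℕ → Ω → W} {S : ℕ → Ω → ℝ} {E : Ω → ℝ} {w₀ : W}
  {P : Measure Ω} {p : W → ℝ → ℝ≥0∞} {β : W → ℝ → ℝ}

/-- Split by the number `n` of jumps. Given the trajectory, the walker is alive with probability
`e^{-hazard}`, which is the weight of the completed steps times the survival factor of the current
stay. -/
theorem IsCTRW.measure_aliveAt [IsProbabilityMeasure P] (h : IsCTRW ψ lam X S E w₀ P)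
    (hlam : IsJumpDensity lam) (hp : ∀ w, Represents (ψ w) (p w))
    (hβ : ∀ w t, 0 ≤ t → 0 ≤ β w t) (hβ_int : ∀ w, LocallyIntegrableOn (β w) (Ici 0))
    {t₀ : ℝ} (ht₀ : 0 ≤ t₀) (w : W) (t : ℝ) :
    P (aliveAt β X S E t₀ w t) = ∑' n, (backward lam p fun w => cumHazard (β w))^[n]
      (occupation p (fun w => cumHazard (β w)) w t) w₀ t₀ := by
  set B : W → ℝ → ℝ := fun w => cumHazard (β w)
  have hBm : ∀ w, Measurable (B w) := fun w => (continuous_cumHazard (hβ_int w)).measurable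
  have hBmono : ∀ w, Monotone (B w) := fun w => monotone_cumHazard (hβ_int w) (hβ w)
  let Y : Ω → ℕ → W × ℝ := fun ω k => (X k ω, S k ω)
  have hY : Measurable Y := measurable_pi_lambda _ fun k =>
    (h.measurable_vertex k).prodMk (h.measurable_wait k)
  let f : ℕ → (ℕ → W × ℝ) → ℝ := fun n z =>
    pathHazard B t₀ (fun k => (z k).1) (fun k => (z k).2) n +
      (B w t - B w (arrival t₀ (fun k => (z k).2) n))
  have hz1 : Measurable fun (z : ℕ → W × ℝ) k => (z k).1 := by fun_prop
  have hz2 : Measurable fun (z : ℕ → W × ℝ) k => (z k).2 := by fun_prop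
  have hf : ∀ n, Measurable (f n) := fun n =>
    (measurable_pathHazard_comp hBm hz1 hz2 n).add
      (measurable_const.sub ((hBm w).comp ((measurable_arrival n).comp hz2)))
  let D : ℕ → Set (ℕ → W × ℝ) := fun n =>
    stayEvent (fun k z => (z k).1) (fun k z => (z k).2) t₀ w t n
  have hD : ∀ n, MeasurableSet (D n) := fun n =>
    measurableSet_stayEvent (fun k => by fun_prop) (fun k => by fun_prop) t₀ w t n
  have hpos := h.ae_wait_pos hlam hp
  -- The identity is almost sure only: positive waiting times keep all arrival times in `[0, ∞)`,
  -- where `cumHazard` computes the integrals of `β`.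
  have hA : aliveAt β X S E t₀ w t =ᵐ[P] ⋃ n, {ω | Y ω ∈ D n ∧ f n (Y ω) < E ω} := by
    filter_upwards [hpos] with ω hω
    refine propext ?_
    change ω ∈ aliveAt β X S E t₀ w t ↔ ω ∈ ⋃ n, {ω | Y ω ∈ D n ∧ f n (Y ω) < E ω}
    rw [mem_iUnion]
    refine exists_congr fun n => ?_
    constructor
    · rintro ⟨h1, h2, h3, h4⟩
      rw [hazard_eq hβ_int ht₀ hω h2, h1] at h4
      exact ⟨⟨h1, h2, h3⟩, h4⟩
    · rintro ⟨⟨h1, h2, h3⟩, h4⟩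
      have h1 : X n ω = w := h1
      refine ⟨h1, h2, h3, ?_⟩
      rw [hazard_eq hβ_int ht₀ hω h2, h1]
      exact h4
  rw [measure_congr hA, measure_iUnion₀]
  · refine tsum_congr fun n => ?_
    rw [measure_lt_clock h.measurable_clock hY h.clock_law h.clock_indep (hD n) (hf n),
      ← h.lintegral_stayEvent hlam hp hBm]
    refine setLIntegral_congr_fun_ae (hY (hD n)) ?_
    filter_upwards [hpos] with ω hω hωD
    have h0 : 0 ≤ f n (Y ω) := add_nonneg (pathHazard_nonneg hBmono hω n)
      (sub_nonneg.mpr (hBmono w hωD.2.1))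
    rw [expMeasure_Ioi h0, pathWeight, growth, decayFactor,
      ← ENNReal.ofReal_mul (Real.exp_pos _).le, ← ENNReal.ofReal_mul (Real.exp_pos _).le,
      ← Real.exp_add, ← Real.exp_add]
    congr 2
    simp only [f, Y]
    ring
  · intro m n hmn
    -- When arrival times increase strictly, `t` lies in at most one of the intervals between
    -- consecutive arrivals.
    refine measure_mono_null (t := {ω | ¬ ∀ n, 0 < S n ω}) ?_ hpos
    rintro ω ⟨⟨⟨-, h1, h2⟩, -⟩, ⟨⟨-, h3, h4⟩, -⟩⟩ hω
    have hmono := strictMono_arrival (t₀ := t₀) (s := (S · ω)) hω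
    have h5 : arrival t₀ (S · ω) m < arrival t₀ (S · ω) (n + 1) := lt_of_le_of_lt h1 h4
    have h6 : arrival t₀ (S · ω) n < arrival t₀ (S · ω) (m + 1) := lt_of_le_of_lt h3 h2
    rw [hmono.lt_iff_lt] at h5 h6
    omega
  · intro n
    exact ((hY (hD n)).inter (measurableSet_lt ((hf n).comp hY) h.measurable_clock)).nullMeasurableSet

end

/-! ### The density of particles -/

/-- An almost everywhere version of `η` would do for the equation at almost every `t`. The equation
at every `t ≥ 0` needs a version that is equal to a continuous `η` everywhere on `[0, ∞)`. -/
theorem exists_isLocDensity {η : ℝ → ℝ} (hη : LocallyIntegrableOn η (Ici 0)) :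
    ∃ e : ℝ → ℝ≥0∞, IsLocDensity e ∧
      (∀ᵐ t ∂(volume.restrict (Ici 0)), e t = ENNReal.ofReal (η t)) ∧
      (ContinuousOn η (Ici 0) → ∀ t, 0 ≤ t → e t = ENNReal.ofReal (η t)) := by
  have hloc : ∀ e : ℝ → ℝ≥0∞, (∀ᵐ t ∂(volume.restrict (Ici 0)), e t = ENNReal.ofReal (η t)) →
      Causal e → ∀ T, ∫⁻ x in Iic T, e x < ∞ := fun e he hc T => by
    have h1 : ∫⁻ x in Iic T, e x = ∫⁻ x in Icc 0 T, ENNReal.ofReal (η x) := by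
      rw [← lintegral_congr_ae (ae_restrict_of_ae_restrict_of_subset Icc_subset_Ici_self he),
        ← lintegral_indicator measurableSet_Iic, ← lintegral_indicator measurableSet_Icc]
      refine lintegral_congr fun x => ?_
      rcases lt_or_ge x 0 with hx | hx
      · simp [indicator, hc x hx]
      · simp [indicator, hx]
    rw [h1]
    exact (hη.integrableOn_compact_subset Icc_subset_Ici_self isCompact_Icc).lintegral_lt_top
  by_cases hc : ContinuousOn η (Ici 0)
  · have hcont : Continuous fun t => η (max t 0) :=
      hc.comp_continuous (by fun_prop) fun t => mem_Ici.mpr (le_max_right _ _)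
    let e : ℝ → ℝ≥0∞ := indicator (Ici 0) fun t => ENNReal.ofReal (η (max t 0))
    have he : ∀ t, 0 ≤ t → e t = ENNReal.ofReal (η t) := fun t ht => by
      simp only [e]
      rw [indicator_of_mem (show t ∈ Ici 0 from ht), max_eq_left ht]
    have hcaus : Causal e := fun x hx => indicator_of_notMem (by simpa using hx) _
    have hae : ∀ᵐ t ∂(volume.restrict (Ici 0)), e t = ENNReal.ofReal (η t) := by
      filter_upwards [ae_restrict_mem measurableSet_Ici] with t ht using he t ht
    exact ⟨e, ⟨hcont.measurable.ennreal_ofReal.indicator measurableSet_Ici, hcaus,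
      hloc e hae hcaus⟩, hae, fun _ => he⟩
  · have hm : AEMeasurable (fun t => ENNReal.ofReal (η t)) (volume.restrict (Ici 0)) :=
      (hη.aestronglyMeasurable).aemeasurable.ennreal_ofReal
    let e : ℝ → ℝ≥0∞ := indicator (Ici 0) (hm.mk _)
    have hcaus : Causal e := fun x hx => indicator_of_notMem (by simpa using hx) _
    have hae : ∀ᵐ t ∂(volume.restrict (Ici 0)), e t = ENNReal.ofReal (η t) := by
      filter_upwards [ae_restrict_mem measurableSet_Ici, hm.ae_eq_mk] with t ht h
      simp only [e]
      rw [indicator_of_mem ht, h]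
    exact ⟨e, ⟨hm.measurable_mk.indicator measurableSet_Ici, hcaus, hloc e hae hcaus⟩, hae,
      fun h => absurd h hc⟩

section

variable {W Ω : Type*} [Fintype W] [DecidableEq W] [MeasurableSpace W]
  [MeasurableSingletonClass W] [MeasurableSpace Ω]
  {ψ : W → ℝ → ℝ} {lam : W → W → ℝ} {X : ℕ → Ω → W} {S : ℕ → Ω → ℝ} {E : Ω → ℝ}
  {P : W → Measure Ω} {p : W → ℝ → ℝ≥0∞} {β η : W → ℝ → ℝ} {e : W → ℝ → ℝ≥0∞}

/-- Integrate `IsCTRW.measure_aliveAt` against creation and pass to the arrival flux by adjointness.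
The sums are finite because they are probabilities, although this is not visible from the series. -/
theorem particleDensity_eq [∀ w₀, IsProbabilityMeasure (P w₀)]
    (hP : ∀ w₀, IsCTRW ψ lam X S E w₀ (P w₀))
    (hlam : IsJumpDensity lam) (hp : ∀ w, Represents (ψ w) (p w))
    (hβ : ∀ w t, 0 ≤ t → 0 ≤ β w t) (hβ_int : ∀ w, LocallyIntegrableOn (β w) (Ici 0))
    (hη : ∀ w t, 0 ≤ t → 0 ≤ η w t) (he : ∀ w, IsLocDensity (e w))
    (hηe : ∀ w, ∀ᵐ t ∂(volume.restrict (Ici 0)), e w t = ENNReal.ofReal (η w t))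
    (w : W) {t : ℝ} (ht : 0 ≤ t) :
    particleDensity β η X S E P w t = (decayFactor (cumHazard (β w)) t *
      (tail (p w) ⋆ₗ (growth (cumHazard (β w)) *
        flux lam p (fun w => cumHazard (β w)) e w)) t).toReal := by
  set B : W → ℝ → ℝ := fun w => cumHazard (β w)
  have hBm : ∀ w, Measurable (B w) := fun w => (continuous_cumHazard (hβ_int w)).measurable
  have hpm := fun w => (hp w).measurable
  let g : W → ℝ → ℝ≥0∞ := fun i s => ∑' n, (backward lam p B)^[n] (occupation p B w t) i s
  have hg : ∀ i, Measurable (g i) := fun i => Measurable.tsum fun n =>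
    measurable_backward_iterate hpm hBm (measurable_occupation hBm w t) n i
  have hgP : ∀ i s, 0 ≤ s → (P i) (aliveAt β X S E s w t) = g i s := fun i s hs =>
    (hP i).measure_aliveAt hlam hp hβ hβ_int hs w t
  have hg1 : ∀ i s, 0 ≤ s → g i s ≤ 1 := fun i s hs => by
    rw [← hgP i s hs]; exact prob_le_one
  have hg0 : ∀ i s, t < s → g i s = 0 := fun i s hs => by
    refine ENNReal.tsum_eq_zero.mpr fun n =>
      backward_iterate_eq_zero (fun w => (hp w).causal) (fun v r hr => ?_) n i hs
    unfold occupation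
    split_ifs
    · rw [causal_tail _ _ (by linarith), mul_zero, mul_zero]
    · rfl
  -- Creation vanishes before `0`, and a walker created after `t` is not yet there at `t`, so the
  -- integral may run over all of `ℝ`.
  have hsupp : ∀ i, ∫⁻ s in Icc 0 t, e i s * g i s = ∫⁻ s, e i s * g i s := fun i => by
    rw [← lintegral_indicator measurableSet_Icc]
    refine lintegral_congr fun s => ?_
    rcases lt_or_ge s 0 with hs | hs
    · simp [indicator, (he i).causal s hs]
    · rcases lt_or_ge t s with hs' | hs'
      · simp [indicator, hg0 i s hs']
      · simp [indicator, hs, hs']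
  have hfin : ∀ i, ∫⁻ s, e i s * g i s ≠ ∞ := fun i => by
    rw [← hsupp i]
    refine ne_of_lt (lt_of_le_of_lt ?_ ((he i).lintegral_lt_top t))
    calc _ ≤ ∫⁻ s in Icc 0 t, e i s := setLIntegral_mono' measurableSet_Icc fun s hs =>
          mul_le_of_le_one_right zero_le (hg1 i s hs.1)
      _ ≤ _ := lintegral_mono_set Icc_subset_Iic_self
  have hterm : ∀ i, ∫ s in (0 : ℝ)..t, walkerDensity β X S E P w t i s * η i s =
      (∫⁻ s, e i s * g i s).toReal := fun i => by
    rw [intervalIntegral.integral_of_le ht, ← integral_Icc_eq_integral_Ioc, ← hsupp i,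
      ← integral_toReal]
    · refine integral_congr_ae ?_
      filter_upwards [ae_restrict_mem measurableSet_Icc,
        ae_restrict_of_ae_restrict_of_subset Icc_subset_Ici_self (hηe i)] with s hs h1
      rw [walkerDensity, measureReal_def, hgP i s hs.1, ENNReal.toReal_mul, h1,
        ENNReal.toReal_ofReal (hη i s hs.1), mul_comm]
    · exact ((he i).measurable.mul (hg i)).aemeasurable
    · filter_upwards [ae_restrict_mem measurableSet_Icc,
        ae_restrict_of_ae (he i).ae_lt_top] with s hs h1
      exact ENNReal.mul_lt_top h1 ((hg1 i s hs.1).trans_lt ENNReal.one_lt_top)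
  rw [particleDensity, ← tsum_sum_lintegral_backward_occupation hpm hBm
    (fun w => (he w).measurable), ENNReal.toReal_sum fun i _ => hfin i]
  exact Finset.sum_congr rfl fun i _ => hterm i

end

/-! ### Regularity of primitives and convolutions -/

theorem absolutelyContinuousOnInterval_congr {f g : ℝ → ℝ} {a b : ℝ}
    (hf : AbsolutelyContinuousOnInterval f a b) (h : ∀ x ∈ uIcc a b, g x = f x) :
    AbsolutelyContinuousOnInterval g a b := by
  refine Tendsto.congr' ?_ hf
  rw [EventuallyEq, eventually_inf_principal]
  refine Eventually.of_forall fun I hI => Finset.sum_congr rfl fun i hi => ?_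
  rw [h _ (hI.1 i hi).1, h _ (hI.1 i hi).2]

theorem dist_exp_neg_le {x y : ℝ} (hx : 0 ≤ x) (hy : 0 ≤ y) :
    dist (Real.exp (-x)) (Real.exp (-y)) ≤ dist x y := by
  wlog h : x ≤ y generalizing x y
  · rw [dist_comm, dist_comm x]
    exact this hy hx (le_of_not_ge h)
  rw [Real.dist_eq, Real.dist_eq, abs_sub_comm x, abs_of_nonneg (sub_nonneg.mpr h),
    abs_of_nonneg (sub_nonneg.mpr (Real.exp_le_exp.mpr (neg_le_neg h)))]
  have h1 : Real.exp (-y) = Real.exp (-x) * Real.exp (-(y - x)) := by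
    rw [← Real.exp_add]; congr 1; ring
  have h2 := Real.add_one_le_exp (-(y - x))
  have h3 : Real.exp (-x) ≤ 1 := Real.exp_le_one_iff.mpr (by linarith)
  have h4 := Real.exp_pos (-x)
  rw [h1]
  nlinarith

/-- `x ↦ e^{-x}` is 1-Lipschitz on `[0, ∞)`, so composition does not increase the sums of
oscillations. -/
theorem absolutelyContinuousOnInterval_exp_neg {f : ℝ → ℝ} {a b : ℝ}
    (hf : AbsolutelyContinuousOnInterval f a b) (h : ∀ x ∈ uIcc a b, 0 ≤ f x) :
    AbsolutelyContinuousOnInterval (fun x => Real.exp (-f x)) a b := by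
  refine squeeze_zero' (Eventually.of_forall fun _ => Finset.sum_nonneg fun _ _ => dist_nonneg)
    ?_ hf
  rw [eventually_inf_principal]
  exact Eventually.of_forall fun I hI => Finset.sum_le_sum fun i hi =>
    dist_exp_neg_le (h _ (hI.1 i hi).1) (h _ (hI.1 i hi).2)

theorem hasDerivWithinAt_integral_Ici {f : ℝ → ℝ} (hf : ContinuousOn f (Ici 0)) {t : ℝ}
    (ht : 0 ≤ t) : HasDerivWithinAt (fun x => ∫ s in (0 : ℝ)..x, f s) (f t) (Ici 0) t := by
  have hc : Continuous fun s => f (max s 0) :=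
    hf.comp_continuous (by fun_prop) fun t => mem_Ici.mpr (le_max_right _ _)
  have e : ∀ x ∈ Ici (0 : ℝ), ∫ s in (0 : ℝ)..x, f s = ∫ s in (0 : ℝ)..x, f (max s 0) :=
    fun x hx => intervalIntegral.integral_congr fun s hs => by
      rw [uIcc_of_le hx] at hs
      simp only [max_eq_left hs.1]
  have h := (hc.integral_hasStrictDerivAt 0 t).hasDerivAt.hasDerivWithinAt (s := Ici 0)
  rw [max_eq_left ht] at h
  exact h.congr e (e t ht)

/-- An integrable function convolved with a bounded one: approximate `p` in `L¹` by continuous `q`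
of compact support; the error is at most `C` times the `L¹` distance, uniformly in `t`. -/
theorem continuous_toReal_lconvolution {p g : ℝ → ℝ≥0∞} (hp : Measurable p)
    (hp' : ∫⁻ x, p x ≠ ∞) (hg : Measurable g) {C : ℝ≥0∞} (hC : C ≠ ∞) (h : ∀ x, g x ≤ C) :
    Continuous fun t => ((p ⋆ₗ g) t).toReal := by
  have hpfin : ∀ᵐ x, p x < ∞ := ae_lt_top hp hp'
  have hpi : Integrable fun x => (p x).toReal := integrable_toReal_of_lintegral_ne_top
    hp.aemeasurable hp'
  have hgb : ∀ x, ‖(g x).toReal‖ ≤ C.toReal := fun x => by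
    rw [Real.norm_of_nonneg ENNReal.toReal_nonneg]
    exact ENNReal.toReal_mono hC (h x)
  have hgm : AEStronglyMeasurable (fun x => (g x).toReal) :=
    hg.ennreal_toReal.aestronglyMeasurable
  have hgl : LocallyIntegrable fun x => (g x).toReal :=
    (locallyIntegrable_const C.toReal).mono hgm (Eventually.of_forall fun x => by
      rw [Real.norm_of_nonneg (r := C.toReal) ENNReal.toReal_nonneg]; exact hgb x)
  have hgm' : ∀ t : ℝ, AEStronglyMeasurable fun y => (g (t - y)).toReal := fun t =>
    (hg.comp (measurable_const.sub measurable_id)).ennreal_toReal.aestronglyMeasurable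
  have hint : ∀ (q : ℝ → ℝ) (_ : Integrable q) (t : ℝ),
      Integrable fun y => q y * (g (t - y)).toReal := fun q hq t =>
    hq.mul_bdd (hgm' t) (Eventually.of_forall fun y => hgb _)
  have he : ∀ t, ((p ⋆ₗ g) t).toReal = ∫ y, (p y).toReal * (g (t - y)).toReal := fun t => by
    rw [lconvolution_def, ← integral_toReal]
    · refine integral_congr_ae (Eventually.of_forall fun y => ?_)
      simp only [ENNReal.toReal_mul]
      rw [show -y + t = t - y by ring]
    · exact (hp.mul (hg.comp (measurable_neg.add_const t))).aemeasurable
    · filter_upwards [hpfin] with y hy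
      exact ENNReal.mul_lt_top hy ((h _).trans_lt hC.lt_top)
  simp only [he]
  refine continuous_of_uniform_approx_of_continuous fun u hu => ?_
  obtain ⟨ε, hε, hεu⟩ := Metric.mem_uniformity_dist.mp hu
  obtain ⟨q, hqs, hq, hqc, hqi⟩ := hpi.exists_hasCompactSupport_integral_sub_le
    (show 0 < ε / (C.toReal + 1) by positivity)
  refine ⟨fun t => ∫ y, q y * (g (t - y)).toReal,
    hqs.continuous_convolution_left (ContinuousLinearMap.mul ℝ ℝ) hqc hgl, fun t => hεu ?_⟩
  rw [dist_eq_norm, ← integral_sub (hint _ hpi t) (hint _ hqi t)]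
  calc _ ≤ ∫ y, ‖(p y).toReal - q y‖ * C.toReal := by
        refine norm_integral_le_of_norm_le ((hpi.sub hqi).norm.mul_const _)
          (Eventually.of_forall fun y => ?_)
        rw [← sub_mul, norm_mul]
        gcongr
        exact hgb _
    _ = (∫ y, ‖(p y).toReal - q y‖) * C.toReal := integral_mul_const _ _
    _ ≤ ε / (C.toReal + 1) * C.toReal := by gcongr
    _ < ε := by
        rw [div_mul_eq_mul_div, div_lt_iff₀ (by positivity)]
        nlinarith

/-- Near `t` only the values of `g` up to `t + 1` matter, so boundedness on left half lines
suffices. -/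
theorem continuous_toReal_lconvolution_of_causal {p g : ℝ → ℝ≥0∞} (hp : IsPosDensity p)
    (hg : Measurable g) (h : ∀ T, ∃ C : ℝ≥0∞, C ≠ ∞ ∧ ∀ x ≤ T, g x ≤ C) :
    Continuous fun t => ((p ⋆ₗ g) t).toReal := by
  refine continuous_iff_continuousAt.mpr fun t => ?_
  obtain ⟨C, hC, hgC⟩ := h (t + 1)
  have h1 := continuous_toReal_lconvolution hp.measurable (by rw [hp.lintegral]; simp)
    (hg.indicator (s := Iic (t + 1)) measurableSet_Iic) hC fun x => by
      by_cases hx : x ∈ Iic (t + 1)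
      · rw [indicator_of_mem hx]; exact hgC x hx
      · rw [indicator_of_notMem hx]; exact zero_le
  refine h1.continuousAt.congr ?_
  filter_upwards [eventually_le_nhds (show t < t + 1 by linarith)] with x hx
  congr 1
  rw [lconvolution_def, lconvolution_def]
  refine lintegral_congr fun y => ?_
  rcases lt_or_ge y 0 with hy | hy
  · simp [hp.causal y hy]
  · rw [indicator_of_mem (show -y + x ∈ Iic (t + 1) by rw [mem_Iic]; linarith)]

theorem IsLocDensity.integral_toReal {f : ℝ → ℝ≥0∞} (hf : IsLocDensity f) {t : ℝ} (ht : 0 ≤ t) :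
    ∫ s in (0 : ℝ)..t, (f s).toReal = (∫⁻ s in Iic t, f s).toReal := by
  have h : ∫⁻ s in Iic t, f s = ∫⁻ s in Icc 0 t, f s := by
    rw [← lintegral_indicator measurableSet_Iic, ← lintegral_indicator measurableSet_Icc]
    refine lintegral_congr fun x => ?_
    rcases lt_or_ge x 0 with hx | hx
    · simp [indicator, hf.causal x hx]
    · simp [indicator, hx]
  rw [intervalIntegral.integral_of_le ht, ← integral_Icc_eq_integral_Ioc, h,
    MeasureTheory.integral_toReal hf.measurable.aemeasurable (ae_restrict_of_ae hf.ae_lt_top)]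

theorem IsLocDensity.intervalIntegrable_toReal {f : ℝ → ℝ≥0∞} (hf : IsLocDensity f) (a b : ℝ) :
    IntervalIntegrable (fun s => (f s).toReal) volume a b :=
  (hf.locallyIntegrable_toReal.integrableOn_isCompact isCompact_uIcc).intervalIntegrable

/-- The number of particles on a vertex is the number of arrivals minus the number of
departures. -/
theorem tail_lconvolution_add {p J : ℝ → ℝ≥0∞} (hp : IsPosDensity p) (hJ : Measurable J) (t : ℝ) :
    (tail p ⋆ₗ J) t + ∫⁻ s in Iic t, (p ⋆ₗ J) s = ∫⁻ s in Iic t, J s := by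
  have e : J ⋆ₗ heaviside = tail p ⋆ₗ J + (p ⋆ₗ J) ⋆ₗ heaviside := by
    conv_lhs => rw [← tail_add hp]
    rw [lconvolution_add_right hJ (measurable_tail p),
      lconvolution_assoc hJ hp.measurable measurable_heaviside,
      lconvolution_comm (f := J) (g := tail p), lconvolution_comm (f := J) (g := p)]
  rw [← lconvolution_heaviside, ← lconvolution_heaviside, e, Pi.add_apply]

/-- All terms of the balance `tail_lconvolution_add` are finite, so departures may be subtracted
from arrivals. This exhibits `e^B u` as a primitive of `J - p ⋆ J`, the source of all its
regularity. -/
theorem toReal_tail_lconvolution {p J : ℝ → ℝ≥0∞} (hp : IsPosDensity p) (hJ : IsLocDensity J)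
    {t : ℝ} (ht : 0 ≤ t) : ((tail p ⋆ₗ J) t).toReal =
      ∫ s in (0 : ℝ)..t, ((J s).toReal - ((p ⋆ₗ J) s).toReal) := by
  have hI := hp.isLocDensity.lconvolution hJ
  rw [intervalIntegral.integral_sub (hJ.intervalIntegrable_toReal _ _)
    (hI.intervalIntegrable_toReal _ _), hJ.integral_toReal ht, hI.integral_toReal ht]
  have h := tail_lconvolution_add hp hJ.measurable t
  have h1 : (tail p ⋆ₗ J) t ≠ ∞ :=
    ne_of_lt (lt_of_le_of_lt (h ▸ le_self_add) (hJ.lintegral_lt_top t))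
  rw [← h, ENNReal.toReal_add h1 (hI.lintegral_lt_top t).ne]
  ring

section

/-! ### The generalized master equation -/

theorem IsLocDensity.growth_mul {B : ℝ → ℝ} {f : ℝ → ℝ≥0∞} (hf : IsLocDensity f)
    (hBm : Measurable B) (hB : Monotone B) : IsLocDensity (growth B * f) := by
  refine ⟨(measurable_growth hBm).mul hf.measurable, fun x hx => ?_, fun T => ?_⟩
  · rw [Pi.mul_apply, hf.causal x hx, mul_zero]
  · calc ∫⁻ x in Iic T, (growth B * f) x ≤ ∫⁻ x in Iic T, growth B T * f x :=
          setLIntegral_mono' measurableSet_Iic fun x hx => by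
            rw [Pi.mul_apply]
            gcongr
            exact ENNReal.ofReal_le_ofReal (Real.exp_le_exp.mpr (hB hx))
      _ = growth B T * ∫⁻ x in Iic T, f x := lintegral_const_mul' _ _ ENNReal.ofReal_ne_top
      _ < ∞ := ENNReal.mul_lt_top ENNReal.ofReal_lt_top (hf.lintegral_lt_top T)

theorem toReal_growth (B : ℝ → ℝ) (t : ℝ) : (growth B t).toReal = Real.exp (B t) :=
  ENNReal.toReal_ofReal (Real.exp_pos _).le

theorem toReal_decayFactor (B : ℝ → ℝ) (t : ℝ) : (decayFactor B t).toReal = Real.exp (-B t) :=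
  ENNReal.toReal_ofReal (Real.exp_pos _).le

variable {W : Type*} [Fintype W] {lam : W → W → ℝ} {p : W → ℝ → ℝ≥0∞} {B : W → ℝ → ℝ}
  {η : W → ℝ → ℝ≥0∞}

/-- The density of jumps from `w`. -/
def jumpRate (lam : W → W → ℝ) (p : W → ℝ → ℝ≥0∞) (B : W → ℝ → ℝ) (η : W → ℝ → ℝ≥0∞)
    (w : W) (t : ℝ) : ℝ :=
  (decayFactor (B w) t * (p w ⋆ₗ (growth (B w) * flux lam p B η w)) t).toReal

/-- The equation `flux_eq` in real numbers: arrivals are creations plus jumps from all vertices. It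
brings the terms `∑_i lam w i * I i` and `η` into the master equation. -/
theorem toReal_flux (hlam : IsJumpDensity lam) (hp : ∀ w, Measurable (p w))
    (hB : ∀ w, Measurable (B w)) (hη : ∀ w, Measurable (η w)) {w : W} {t : ℝ}
    (h : flux lam p B η w t ≠ ∞) : (flux lam p B η w t).toReal =
      (η w t).toReal + ∑ i, lam w i * jumpRate lam p B η i t := by
  have e := flux_eq (lam := lam) hp hB hη w t
  rw [e] at h ⊢
  rw [ENNReal.add_ne_top] at h
  rw [ENNReal.toReal_add h.1 h.2]
  congr 1
  have h2 := h.2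
  unfold fluxStep at h2 ⊢
  rw [ENNReal.toReal_sum fun i hi => (ENNReal.sum_ne_top.mp h2) i hi]
  refine Finset.sum_congr rfl fun i _ => ?_
  rw [ENNReal.toReal_mul, ENNReal.toReal_ofReal (hlam.nonneg w i), jumpRate]

end

end NetworkCTRW

end

/-! ### Assembly of the main theorem -/

open NetworkCTRW

theorem mainTheorem1 {W Ω : Type*} [Fintype W] [DecidableEq W] [MeasurableSpace W]
    [MeasurableSingletonClass W] [MeasurableSpace Ω]
    (ψ : W → ℝ → ℝ) (hψ : ∀ w, NetworkCTRW.IsWaitingDensity (ψ w))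
    (lam : W → W → ℝ) (hlam : NetworkCTRW.IsJumpDensity lam)
    (β : W → ℝ → ℝ) (hβ : ∀ w t, 0 ≤ t → 0 ≤ β w t)
    (hβ_int : ∀ w, LocallyIntegrableOn (β w) (Ici 0))
    (η : W → ℝ → ℝ) (hη : ∀ w t, 0 ≤ t → 0 ≤ η w t)
    (hη_int : ∀ w, LocallyIntegrableOn (η w) (Ici 0))
    (X : ℕ → Ω → W) (S : ℕ → Ω → ℝ) (E : Ω → ℝ)
    (P : W → Measure Ω) [∀ w₀, IsProbabilityMeasure (P w₀)]
    (hP : ∀ w₀, NetworkCTRW.IsCTRW ψ lam X S E w₀ (P w₀))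
    (u : W → ℝ → ℝ) (hu : u = NetworkCTRW.particleDensity β η X S E P) :
    (∀ w, ∃! K : 𝓢'(ℝ, ℂ), NetworkCTRW.IsMemoryKernel (ψ w) K) ∧
    ∀ K : W → 𝓢'(ℝ, ℂ), (∀ w, NetworkCTRW.IsMemoryKernel (ψ w) (K w)) →
      ∃ I : W → ℝ → ℝ,
        (∀ w, NetworkCTRW.IsMemoryIntegral (K w) (β w) (u w) (I w)) ∧
        (∀ w, ∀ T, 0 ≤ T → AbsolutelyContinuousOnInterval (u w) 0 T) ∧
        (∀ w, ∀ᵐ t ∂(volume.restrict (Ioi (0 : ℝ))),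
          HasDerivAt (u w)
            (NetworkCTRW.transport lam I w t - β w t * u w t + η w t) t) ∧
        ((∀ w, ContinuousOn (β w) (Ici 0) ∧ ContinuousOn (η w) (Ici 0)) →
          (∀ w, ContinuousOn (I w) (Ici 0)) ∧
          ∀ w t, 0 ≤ t →
            HasDerivWithinAt (u w)
              (NetworkCTRW.transport lam I w t - β w t * u w t + η w t) (Ici 0) t) := by
  refine ⟨fun w => (hψ w).existsUnique_isMemoryKernel, fun K hK => ?_⟩
  choose p hp using fun w => (hψ w).exists_represents
  choose e he hηe hηc using fun w => exists_isLocDensity (hη_int w)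
  let B : W → ℝ → ℝ := fun w => cumHazard (β w)
  have hBc : ∀ w, Continuous (B w) := fun w => continuous_cumHazard (hβ_int w)
  have hBm : ∀ w, Measurable (B w) := fun w => (hBc w).measurable
  have hB : ∀ w, Monotone (B w) := fun w => monotone_cumHazard (hβ_int w) (hβ w)
  have hB0 : ∀ w t, 0 ≤ t → 0 ≤ B w t := fun w t ht => by
    have h := hB w ht
    rwa [show B w 0 = 0 from intervalIntegral.integral_same] at h
  have hp' := fun w => (hp w).toIsPosDensity
  have hpm := fun w => (hp' w).measurable
  have hem := fun w => (he w).measurable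
  -- Arrivals with death undone: `e^B u = tail ⋆ J` and `e^B I = p ⋆ J`, as for a walk without
  -- death.
  let J : W → ℝ → ENNReal := fun w => growth (B w) * flux lam p B e w
  have hflux : ∀ w, IsLocDensity (flux lam p B e w) :=
    isLocDensity_flux hlam hp' hBm hB he
  have hJ : ∀ w, IsLocDensity (J w) := fun w => (hflux w).growth_mul (hBm w) (hB w)
  have hpJ : ∀ w, IsLocDensity (p w ⋆ₗ J w) := fun w => (hp' w).isLocDensity.lconvolution (hJ w)
  let m : W → ℝ → ℝ := fun w s => (J w s).toReal - ((p w ⋆ₗ J w) s).toReal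
  have hm : ∀ w, LocallyIntegrable (m w) := fun w =>
    (hJ w).locallyIntegrable_toReal.sub (hpJ w).locallyIntegrable_toReal
  let I := jumpRate lam p B e
  have hI : ∀ w t, I w t = Real.exp (-B w t) * ((p w ⋆ₗ J w) t).toReal := fun w t => by
    simp only [I, jumpRate, J]
    rw [ENNReal.toReal_mul, toReal_decayFactor]
  have hu0 : ∀ w t, 0 ≤ t → u w t = Real.exp (-B w t) * ((tail (p w) ⋆ₗ J w) t).toReal :=
    fun w t ht => by
      rw [hu, particleDensity_eq hP hlam hp hβ hβ_int hη he hηe w ht, ENNReal.toReal_mul,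
        toReal_decayFactor]
  have hu1 : ∀ w, ∀ t ∈ Ici (0 : ℝ), u w t = Real.exp (-B w t) * ∫ s in (0 : ℝ)..t, m w s :=
    fun w t ht => by
      rw [hu0 w t ht, toReal_tail_lconvolution (hp' w) (hJ w) ht]
  have hexp : ∀ w t (y : ℝ), Real.exp (B w t) * (Real.exp (-B w t) * y) = y := fun w t y => by
    rw [← mul_assoc, ← Real.exp_add, add_neg_cancel, Real.exp_zero, one_mul]
  have hexp' : ∀ w t (y : ℝ), Real.exp (-B w t) * (Real.exp (B w t) * y) = y := fun w t y => by
    rw [← mul_assoc, ← Real.exp_add, neg_add_cancel, Real.exp_zero, one_mul]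
  -- The product rule for `e^{-B} ∫ m` yields the right side of the master equation, as `e^{-B} m`
  -- is the flux minus `I`. The two hypotheses on `t` hold almost everywhere in general and
  -- everywhere for continuous data, so both cases use this identity.
  have hrate : ∀ w t, 0 ≤ t → flux lam p B e w t ≠ ⊤ → e w t = ENNReal.ofReal (η w t) →
      -β w t * Real.exp (-B w t) * (∫ s in (0 : ℝ)..t, m w s) + Real.exp (-B w t) * m w t =
        transport lam I w t - β w t * u w t + η w t := fun w t ht hf h => by
    have h1 : Real.exp (-B w t) * m w t = (flux lam p B e w t).toReal - I w t := by
      simp only [m]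
      rw [mul_sub, hI]
      congr 1
      simp only [J]
      rw [Pi.mul_apply, ENNReal.toReal_mul, toReal_growth, hexp']
    rw [h1, toReal_flux hlam hpm hBm hem hf, h, ENNReal.toReal_ofReal (hη w t ht), hu1 w t ht,
      transport]
    ring
  refine ⟨I, fun w => ?_, fun w T hT => ?_, fun w => ?_, fun hc => ?_⟩
  · refine (hp w).isCausalConvolution (hJ w) (hK w) (fun t ht => ?_) fun t ht => ?_
    · rw [integral_eq_cumHazard (hβ_int w) ht, hu0 w t ht]
      exact hexp w t _
    · rw [integral_eq_cumHazard (hβ_int w) ht, hI]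
      exact hexp w t _
  · have h1 : AbsolutelyContinuousOnInterval (B w) 0 T :=
      (intervalIntegrable_indicator_Ici (hβ_int w) 0 T).absolutelyContinuousOnInterval_intervalIntegral
        left_mem_uIcc
    have h2 : AbsolutelyContinuousOnInterval (fun t => ∫ s in (0 : ℝ)..t, m w s) 0 T :=
      (((hm w).integrableOn_isCompact isCompact_uIcc).intervalIntegrable
        ).absolutelyContinuousOnInterval_intervalIntegral left_mem_uIcc
    refine absolutelyContinuousOnInterval_congr ((absolutelyContinuousOnInterval_exp_neg h1
      fun x hx => hB0 w x ?_).mul h2) fun x hx => hu1 w x ?_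
    · rw [uIcc_of_le hT] at hx; exact hx.1
    · rw [uIcc_of_le hT] at hx; exact hx.1
  · rw [ae_restrict_iff' measurableSet_Ioi]
    have hηe' := (ae_restrict_iff' measurableSet_Ici).mp (hηe w)
    -- Lebesgue differentiation of the primitives of `m` and of `β` extended by zero; the extension
    -- does no harm at `t > 0`.
    filter_upwards [LocallyIntegrable.ae_hasDerivAt_integral (hm w),
      LocallyIntegrable.ae_hasDerivAt_integral (locallyIntegrable_indicator_Ici (hβ_int w)),
      (hflux w).ae_lt_top, hηe'] with t h1 h2 h3 h4 ht
    have ht0 : (0 : ℝ) ≤ t := le_of_lt ht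
    have h5 : HasDerivAt (B w) (β w t) t := by
      have := h2 0
      rwa [indicator_of_mem (show t ∈ Ici 0 from ht0)] at this
    rw [← hrate w t ht0 h3.ne (h4 ht0)]
    have h6 := (h5.neg.exp).mul (h1 0)
    refine (h6.congr_deriv (by simp only [Pi.neg_apply]; ring)).congr_of_eventuallyEq ?_
    filter_upwards [Ioi_mem_nhds ht] with x hx using hu1 w x (mem_Ici.mpr (le_of_lt hx))
  -- Continuous creation is bounded on compact intervals. Hence the flux is bounded on every `(-∞,
  -- T]`, in particular finite at every time, and `p ⋆ J` is continuous.
  · have hηb : ∀ T, ∃ C : ENNReal, C ≠ ⊤ ∧ ∀ w, ∀ x ≤ T, e w x ≤ C := fun T => by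
      have h1 : ∀ w, ∃ M, ∀ x ∈ Icc 0 T, η w x ≤ M := fun w => by
        obtain ⟨M, hM⟩ := isCompact_Icc.bddAbove_image ((hc w).2.mono Icc_subset_Ici_self)
        exact ⟨M, fun x hx => hM (mem_image_of_mem _ hx)⟩
      choose M hM using h1
      refine ⟨∑ w, ENNReal.ofReal (M w), ENNReal.sum_ne_top.mpr fun _ _ => ENNReal.ofReal_ne_top,
        fun w x hx => ?_⟩
      rcases lt_or_ge x 0 with h0 | h0
      · rw [(he w).causal x h0]; exact zero_le
      · rw [hηc w (hc w).2 x h0]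
        exact (ENNReal.ofReal_le_ofReal (hM w x ⟨h0, hx⟩)).trans
          (Finset.single_le_sum (f := fun w => ENNReal.ofReal (M w)) (fun _ _ => zero_le)
            (Finset.mem_univ w))
    have hfb : ∀ T, ∃ C : ENNReal, C ≠ ⊤ ∧ ∀ w, ∀ x ≤ T, flux lam p B e w x ≤ C := fun T => by
      obtain ⟨C, hC, h⟩ := hηb T
      exact exists_flux_le hlam hp' hB (fun w => (he w).causal) hC h
    have hfin : ∀ w t, flux lam p B e w t ≠ ⊤ := fun w t => by
      obtain ⟨C, hC, h⟩ := hfb t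
      exact ne_top_of_le_ne_top hC (h w t le_rfl)
    have hJb : ∀ w T, ∃ C : ENNReal, C ≠ ⊤ ∧ ∀ x ≤ T, J w x ≤ C := fun w T => by
      obtain ⟨C, hC, h⟩ := hfb T
      refine ⟨growth (B w) T * C, ENNReal.mul_ne_top ENNReal.ofReal_ne_top hC, fun x hx => ?_⟩
      simp only [J]
      rw [Pi.mul_apply]
      gcongr
      · exact ENNReal.ofReal_le_ofReal (Real.exp_le_exp.mpr (hB w hx))
      · exact h w x hx
    have hpJc : ∀ w, Continuous fun t => ((p w ⋆ₗ J w) t).toReal := fun w =>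
      continuous_toReal_lconvolution_of_causal (hp' w) (hJ w).measurable (hJb w)
    have hIc : ∀ w, Continuous (I w) := fun w => by
      have := hpJc w
      have := hBc w
      rw [show I w = _ from funext (hI w)]
      fun_prop
    -- The flux is defined by a series of which no continuity is known; the equation `toReal_flux`
    -- expresses it by `η` and the departure rates, whose continuity on `[0, ∞)` is already
    -- available.
    have hmc : ∀ w, ContinuousOn (m w) (Ici 0) := fun w => by
      have h1 : ContinuousOn (fun t => Real.exp (B w t) *
          (η w t + ∑ i, lam w i * I i t) - ((p w ⋆ₗ J w) t).toReal) (Ici 0) := by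
        have h2 := (hc w).2
        have h3 := (hBc w).continuousOn (s := Ici 0)
        have h4 := (hpJc w).continuousOn (s := Ici 0)
        have h5 := fun i => (hIc i).continuousOn (s := Ici 0)
        fun_prop
      refine h1.congr fun t ht => ?_
      simp only [m, J]
      rw [Pi.mul_apply, ENNReal.toReal_mul, toReal_growth,
        toReal_flux hlam hpm hBm hem (hfin w t), hηc w (hc w).2 t ht,
        ENNReal.toReal_ofReal (hη w t ht)]
    refine ⟨fun w => (hIc w).continuousOn, fun w t ht => ?_⟩
    rw [← hrate w t ht (hfin w t) (hηc w (hc w).2 t ht)]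
    have h5 : HasDerivWithinAt (B w) (β w t) (Ici 0) t :=
      (hasDerivWithinAt_integral_Ici (hc w).1 ht).congr
        (fun x hx => (integral_eq_cumHazard (hβ_int w) hx).symm)
        (integral_eq_cumHazard (hβ_int w) ht).symm
    have h6 := (h5.neg.exp).mul (hasDerivWithinAt_integral_Ici (hmc w) ht)
    exact (h6.congr_deriv (by simp only [Pi.neg_apply]; ring)).congr (hu1 w) (hu1 w t ht)
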